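/- Proposition. Let $(\omega_k)_{k\ge1}$ and $b=(b_k)_{k\ge1}$ be real sequences and let $\rho>1$ be such that (A1) $b\in\ell^2(\mathbb R)$ and $b_k\neq0$ for all $k$; (A2) $\omega_1>0$ and there is $\omega_*>0$ with $\omega_{k+1}-\omega_k\ge\omega_*$ for all $k$; (A3) $\sup_{k}\sum_{j\ne k}(\omega_k-\omega_j)^{-2}<\infty$; (A5) $\displaystyle\sum_{k\ge1}\frac1{|b_k|^{2\rho}}\sum_{j\neq k}\frac{|b_j|^{2(1+\rho)}}{(\omega_j-\omega_k)^2}<\infty$. Set $\beta=\rho-1$. Let $X=(\ell^2(\mathbb C))^4$ with its Hilbert norm and, for $\gamma\in\mathbb R$, let $V^X_{0,\gamma}$ be the set of all $\theta=(\theta^1,\theta^2,\theta^3,\theta^4)\in X$ with $$\|\theta\|_{V^X_{0,\gamma}}^2=\sum_{k\ge1}\frac{|\theta^1_k|^2+|\theta^2_k|^2+|\theta^3_k|^2+|\theta^4_k|^2}{|b_k|^{2\gamma}}<\infty .$$ For $T>0$, a solution of the Hamiltonian variational system on $[0,T]$ is a function $\Delta=(\delta\xi,\delta\eta,\delta\lambda,\delta\mu)\in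 C([0,T];X)$ whose coordinates are differentiable on $[0,T]$ and satisfy, for all $k\ge1$, $$\dot{\delta\xi}_k=\omega_k\,\delta\eta_k,\quad \dot{\delta\eta}_k=-\omega_k\,\delta\xi_k+b_k\sum_{j\ge1}b_j\,\delta\mu_j,\quad \dot{\delta\lambda}_k=\omega_k\,\delta\mu_k+\delta\xi_k,\quad \dot{\delta\mu}_k=-\omega_k\,\delta\lambda_k+\delta\eta_k .$$ Then there exists a constant $C>0$, depending only on $(\omega_k)$, $(b_k)$ and $\rho$, such that for every $T>0$, every solution $\Delta$ of this system on $[0,T]$ and every $t\in[0,T]$, one has $\Delta(t)\in V^X_{0,-\rho}$ and $$\|\Delta(t)\|_{V^X_{0,-\rho}}\le C\left(\frac{\|\Delta(0)\|_X}{(t+1)^{\beta}}+\frac{\|\Delta(T)\|_X}{(T-t+1)^{\beta}}\right).$$ -/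

import Mathlib

open scoped ENNReal

noncomputable section

namespace Turnpike

/-- The complex Hilbert space `X = (ℓ²(ℂ))⁴`, with its Hilbert norm. A vector `θ : X` has the
components `θ 0, θ 1, θ 2, θ 3`, in the order `δξ, δη, δλ, δμ`. The modes are indexed by
`k = 0, 1, 2, …` instead of `k = 1, 2, 3, …`. -/
abbrev X : Type := PiLp 2 (fun _ : Fin 4 => lp (fun _ : ℕ => ℂ) 2)

/-- (A1): `b ∈ ℓ²(ℝ)` and no `b k` vanishes. -/
def A1 (b : ℕ → ℝ) : Prop :=
  Memℓp b 2 ∧ ∀ k, b k ≠ 0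

/-- (A2): the first frequency is positive and consecutive gaps are bounded below. -/
def A2 (ω : ℕ → ℝ) : Prop :=
  0 < ω 0 ∧ ∃ ωstar : ℝ, 0 < ωstar ∧ ∀ k, ωstar ≤ ω (k + 1) - ω k

/-- (A3): the series `S_k = ∑_{j ≠ k} 1 / (ω_k - ω_j)²` converge and are bounded
uniformly in `k`. -/
def A3 (ω : ℕ → ℝ) : Prop :=
  ∃ C : ℝ, ∀ k, Summable (fun j : {j : ℕ // j ≠ k} => 1 / (ω k - ω j) ^ 2) ∧
    ∑' j : {j : ℕ // j ≠ k}, 1 / (ω k - ω j) ^ 2 ≤ C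

/-- (A5) with exponent `ρ`: the iterated series
`∑_k |b_k|^(-2ρ) ∑_{j ≠ k} |b_j|^(2(1+ρ)) / (ω_j - ω_k)²` of nonnegative terms converges. -/
def A5 (ω b : ℕ → ℝ) (ρ : ℝ) : Prop :=
  (∀ k, Summable (fun j : {j : ℕ // j ≠ k} => |b j| ^ (2 * (1 + ρ)) / (ω j - ω k) ^ 2)) ∧
  Summable (fun k : ℕ => 1 / |b k| ^ (2 * ρ) *
    ∑' j : {j : ℕ // j ≠ k}, |b j| ^ (2 * (1 + ρ)) / (ω j - ω k) ^ 2)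

/-- The `k`-th term of the series defining the squared norm of `V^X_{0,γ}`. -/
def weightedTerm (b : ℕ → ℝ) (γ : ℝ) (θ : X) (k : ℕ) : ℝ :=
  (∑ i : Fin 4, ‖θ i k‖ ^ 2) / |b k| ^ (2 * γ)

/-- Membership of `θ ∈ X` in the weighted space `V^X_{0,γ}`. -/
def MemV (b : ℕ → ℝ) (γ : ℝ) (θ : X) : Prop :=
  Summable (weightedTerm b γ θ)

/-- The norm of `V^X_{0,γ}`; meaningful on the `θ` with `MemV b γ θ`. -/
def normV (b : ℕ → ℝ) (γ : ℝ) (θ : X) : ℝ :=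
  Real.sqrt (∑' k, weightedTerm b γ θ k)

/-- The formal action of the Hamiltonian matrix
`[[0, Ω, 0, 0], [-Ω, 0, 0, b b*], [I, 0, 0, Ω], [0, I, -Ω, 0]]` on `θ ∈ X`, read off in the
component `i` and the mode `k`. The result need not lie in `X`, since `Ω` is unbounded. -/
def hamiltonianAction (ω b : ℕ → ℝ) (θ : X) (i : Fin 4) (k : ℕ) : ℂ :=
  ![(ω k : ℂ) * θ 1 k,
    -(ω k : ℂ) * θ 0 k + (b k : ℂ) * ∑' j, (b j : ℂ) * θ 3 j,
    θ 0 k + (ω k : ℂ) * θ 3 k,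
    θ 1 k - (ω k : ℂ) * θ 2 k] i

/-- `Δ ∈ C([0,T]; X)` solves the variational system on `[0,T]`: every coordinate is
differentiable (one-sidedly at the end points) and satisfies the equation of its mode. For
continuous `X`-valued functions this is the same as being a mild solution of `Δ' = Ã Δ`, by
variation of constants in each mode; `Δ(t)` is not required to lie in the domain of `Ã`. -/
def IsSolution (ω b : ℕ → ℝ) (T : ℝ) (Δ : ℝ → X) : Prop :=
  ContinuousOn Δ (Set.Icc 0 T) ∧
  ∀ t ∈ Set.Icc (0 : ℝ) T, ∀ (i : Fin 4) (k : ℕ),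
    HasDerivWithinAt (fun s => Δ s i k) (hamiltonianAction ω b (Δ t) i k) (Set.Icc 0 T) t

end Turnpike

end

/-! Complex coordinates `z = ±δξ + iδη`, `q = ±δλ + iδμ`, multiplied by the sign of `b`, turn the
system into `z' = -iνz + βf`, `q' = -iνq + z`, `f = Σ βq`, with `ν = ±ω` and `β = |b|/√2`. The
generator is symmetric for the bilinear pairing `bil` (`IsGen.bil_symm`), so every eigenvector is
also an eigenfunctional. Eigenvalues off the imaginary axis are the zeros of `h(s) = 1 - Σ β²/(s +
iν)²`, and an energy identity excludes imaginary eigenvalues (`IsGen.eq_zero_of_re_eq_zero`).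

For all but finitely many modes a contraction argument finds zeros `-iν_n + d` with `d` close to
`±β_n` and `|Re d| ≥ 3β_n/4` (`exists_isRoot`). The corresponding functionals satisfy `u' = su`
along solutions: one decays forward from time `0`, the other backward from time `T`. Recovering
`q_n` from the two requires a division by about `2β_n`. With the weight `w = β^ρ`, the remaining
`β_n^(ρ-1) exp(-cβ_n t)` is bounded by a multiple of `(t+1)^(-(ρ-1))`, uniformly in `n`; this
explains the exponent.

The coordinates recovered in this way differ from `(z_n, q_n)` by an operator that is
Hilbert–Schmidt in the weighted space, by (A5). Apart from finitely many modes it is small, and a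
Neumann series inverts the change of coordinates (`exists_decomposition`). What remains is the
common kernel of the eigenfunctionals, which is finite-dimensional. The resolvent is bijective on
it, which gives its elements enough regularity to act as functionals on the weighted space; the
generator restricts to it without imaginary eigenvalues, and the pairing is nondegenerate on it
(`bil_nondegenerate`). Hence finitely many functionals control the kernel component, and each is a
sum of generalised eigenvectors with exponential layers at both ends (`decays_of_mem_kerSpec`).
`exists_turnpike` combines the two components. -/

noncomputable section

namespace Turnpike

/-! ### Square-summable families. -/

/-- Square-summable real families. -/
def SqSummable {ι : Type*} (f : ι → ℝ) : Prop := Summable fun k => f k ^ 2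

namespace SqSummable

variable {ι : Type*} {f g : ι → ℝ}

theorem of_le (hg : SqSummable g) (C : ℝ) (h : ∀ k, |f k| ≤ C * |g k|) : SqSummable f := by
  refine Summable.of_nonneg_of_le (fun k => sq_nonneg _) (fun k => ?_) (Summable.mul_left (C ^ 2) hg)
  calc f k ^ 2 = |f k| ^ 2 := (sq_abs _).symm
    _ ≤ (C * |g k|) ^ 2 := pow_le_pow_left₀ (abs_nonneg _) (h k) 2
    _ = C ^ 2 * g k ^ 2 := by rw [mul_pow, sq_abs]

theorem const_mul (hf : SqSummable f) (c : ℝ) : SqSummable fun k => c * f k :=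
  hf.of_le |c| fun k => by rw [abs_mul]

theorem add (hf : SqSummable f) (hg : SqSummable g) : SqSummable fun k => f k + g k := by
  refine Summable.of_nonneg_of_le (fun k => sq_nonneg _) (fun k => ?_)
    ((Summable.mul_left 2 hf).add (Summable.mul_left 2 hg))
  nlinarith [sq_nonneg (f k - g k)]

theorem mul (hf : SqSummable f) (hg : SqSummable g) : Summable fun k => f k * g k := by
  refine Summable.of_norm_bounded (g := fun k => f k ^ 2 + g k ^ 2) (Summable.add hf hg)
    fun k => ?_
  rw [Real.norm_eq_abs, abs_mul]
  nlinarith [sq_nonneg (|f k| - |g k|), sq_abs (f k), sq_abs (g k), abs_nonneg (f k),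
    abs_nonneg (g k)]

theorem sq_le_tsum (hf : SqSummable f) (k : ι) : f k ^ 2 ≤ ∑' j, f j ^ 2 :=
  hf.le_tsum k fun _ _ => sq_nonneg _

theorem bdd (hf : SqSummable f) : ∃ C, 0 ≤ C ∧ ∀ k, |f k| ≤ C :=
  ⟨√(∑' j, f j ^ 2), Real.sqrt_nonneg _, fun k => Real.abs_le_sqrt (hf.sq_le_tsum k)⟩

theorem sum_abs_mul_le (hf : SqSummable f) (hg : SqSummable g) (s : Finset ι) :
    ∑ k ∈ s, |f k * g k| ≤ √(∑' k, f k ^ 2) * √(∑' k, g k ^ 2) := by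
  rw [← Real.sqrt_mul (tsum_nonneg fun k => sq_nonneg _)]
  refine Real.le_sqrt_of_sq_le ?_
  calc (∑ k ∈ s, |f k * g k|) ^ 2 = (∑ k ∈ s, |f k| * |g k|) ^ 2 := by simp only [abs_mul]
    _ ≤ (∑ k ∈ s, |f k| ^ 2) * ∑ k ∈ s, |g k| ^ 2 := Finset.sum_mul_sq_le_sq_mul_sq s _ _
    _ ≤ _ := by
      simp only [sq_abs]
      exact mul_le_mul (hf.sum_le_tsum s fun k _ => sq_nonneg _)
        (hg.sum_le_tsum s fun k _ => sq_nonneg _) (Finset.sum_nonneg fun k _ => sq_nonneg _)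
        (tsum_nonneg fun k => sq_nonneg _)

/-- Cauchy–Schwarz for families. -/
theorem tsum_abs_mul_le (hf : SqSummable f) (hg : SqSummable g) :
    ∑' k, |f k * g k| ≤ √(∑' k, f k ^ 2) * √(∑' k, g k ^ 2) :=
  (hf.mul hg).abs.tsum_le_of_sum_le (hf.sum_abs_mul_le hg)

theorem tsum_mul_le (hf : SqSummable f) (hg : SqSummable g) :
    ∑' k, f k * g k ≤ √(∑' k, f k ^ 2) * √(∑' k, g k ^ 2) :=
  ((hf.mul hg).tsum_le_tsum (fun _ => le_abs_self _) (hf.mul hg).abs).trans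
    (hf.tsum_abs_mul_le hg)

end SqSummable

/-! ### The abstract modal system and its weighted spaces. -/

/-- The data of the variational system in complex modal coordinates
`z k' = -i ν k z k + β k f`, `q k' = -i ν k q k + z k`, `f = ∑ β k q k`,
with a weight `w` for which the coupling matrix is Hilbert–Schmidt. -/
structure ModalSystem (ι : Type*) where
  ν : ι → ℝ
  β : ι → ℝ
  w : ι → ℝ
  gap : ℝ
  β_pos : ∀ k, 0 < β k
  w_pos : ∀ k, 0 < w k
  gap_pos : 0 < gap
  β_sq : SqSummable β
  w_bdd : ∃ C, 0 ≤ C ∧ ∀ k, w k ≤ C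
  gap_le : ∀ n k, n ≠ k → gap ≤ |ν n - ν k|
  -- Division by zero yields zero, so the diagonal entries vanish and only distinct frequencies
  -- count.
  hs : SqSummable fun p : ι × ι => β p.1 * w p.1 / (w p.2 * (ν p.1 - ν p.2))

namespace ModalSystem

variable {ι : Type*} (S : ModalSystem ι)

/-- The resolvent symbol `1 / (s + i ν k)` of a mode. -/
def a (s : ℂ) (k : ι) : ℂ := (s + Complex.I * S.ν k)⁻¹

theorem β_bdd : ∃ C, 0 ≤ C ∧ ∀ k, S.β k ≤ C := by
  obtain ⟨C, hC, h⟩ := S.β_sq.bdd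
  exact ⟨C, hC, fun k => (le_abs_self _).trans (h k)⟩

/-- A row of the Hilbert–Schmidt matrix with its nonzero prefactor `β n * w n` divided out. -/
theorem sqSummable_col (n : ι) : SqSummable fun k => 1 / (S.w k * (S.ν n - S.ν k)) := by
  have h : SqSummable fun k => S.β n * S.w n / (S.w k * (S.ν n - S.ν k)) :=
    S.hs.comp_injective (i := fun k => (n, k)) fun _ _ h => (Prod.mk.inj h).2
  have hp : 0 < S.β n * S.w n := mul_pos (S.β_pos n) (S.w_pos n)
  convert h.const_mul (S.β n * S.w n)⁻¹ using 2 with k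
  rw [div_eq_mul_inv (S.β n * S.w n), inv_mul_cancel_left₀ hp.ne', one_div]

theorem tendsto_inv_sq (n : ι) :
    Filter.Tendsto (fun k => 1 / (S.ν n - S.ν k) ^ 2) Filter.cofinite (nhds 0) := by
  obtain ⟨C, hC, hw⟩ := S.w_bdd
  have h : SqSummable fun k => 1 / (S.ν n - S.ν k) := by
    refine (S.sqSummable_col n).of_le C fun k => ?_
    rw [abs_div, abs_div, abs_mul, abs_one, abs_of_pos (S.w_pos k)]
    rcases eq_or_ne (S.ν n - S.ν k) 0 with h0 | h0
    · simp [h0]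
    · have := S.w_pos k
      have h1 : 0 < |S.ν n - S.ν k| := abs_pos.2 h0
      rw [mul_one_div, div_le_div_iff₀ h1 (by positivity)]
      nlinarith [mul_le_mul_of_nonneg_right (hw k) h1.le]
  simpa [one_div, inv_pow] using Summable.tendsto_cofinite_zero h

/-- The frequencies leave every bounded set: the weight is bounded above, so the reciprocal
differences are themselves square summable. The gap keeps the differences nonzero, so that a small
reciprocal does mean a large difference. -/
theorem tendsto_abs_sub (n : ι) (M : ℝ) : ∀ᶠ k in Filter.cofinite, M ≤ |S.ν n - S.ν k| := by
  have h := (S.tendsto_inv_sq n).eventually (gt_mem_nhds (show (0 : ℝ) < 1 / (|M| + 1) ^ 2 by positivity))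
  have hne : ∀ᶠ k in Filter.cofinite, k ≠ n := by simp [Filter.eventually_cofinite]
  filter_upwards [h, hne] with k hk hkn
  have h1 : 0 < |S.ν n - S.ν k| := S.gap_pos.trans_le (S.gap_le n k hkn.symm)
  rw [← sq_abs (S.ν n - S.ν k), one_div_lt_one_div (by positivity) (by positivity)] at hk
  have := abs_lt_of_sq_lt_sq hk h1.le
  rw [abs_of_pos (by positivity)] at this
  linarith [le_abs_self M]

/-- The resolvent symbols belong to the dual weighted space. -/
theorem sqSummable_a [Nonempty ι] (s : ℂ) : SqSummable fun k => ‖S.a s k‖ / S.w k := by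
  obtain ⟨n⟩ := ‹Nonempty ι›
  refine Summable.of_norm_bounded_eventually
    (Summable.mul_left (2 ^ 2) (S.sqSummable_col n)) ?_
  -- Once the frequency difference exceeds `2‖s + iν_n‖`, the triangle inequality makes it at most
  -- `2‖s + iν_k‖`. The added `1` keeps it strictly positive.
  filter_upwards [S.tendsto_abs_sub n (2 * ‖s + Complex.I * S.ν n‖ + 1)] with k hk
  have h1 : |S.ν n - S.ν k| ≤ 2 * ‖s + Complex.I * S.ν k‖ := by
    have : ‖(Complex.I * S.ν n - Complex.I * S.ν k : ℂ)‖ = |S.ν n - S.ν k| := by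
      rw [← mul_sub, norm_mul, Complex.norm_I, one_mul, ← Complex.ofReal_sub, Complex.norm_real,
        Real.norm_eq_abs]
    have h2 := norm_sub_le (s + Complex.I * S.ν n) (s + Complex.I * S.ν k)
    rw [show s + Complex.I * S.ν n - (s + Complex.I * S.ν k)
      = Complex.I * S.ν n - Complex.I * S.ν k by ring, this] at h2
    linarith
  have hp : 0 < |S.ν n - S.ν k| := lt_of_lt_of_le (by positivity) hk
  have hw := S.w_pos k
  rw [Real.norm_of_nonneg (sq_nonneg _), ← mul_pow, ← sq_abs (2 * _)]
  refine pow_le_pow_left₀ (by positivity) ?_ 2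
  rw [a, norm_inv, abs_mul, abs_div, abs_mul, abs_of_pos hw, abs_one, abs_two, mul_one_div,
    inv_eq_one_div, div_div, div_le_div_iff₀ (by nlinarith) (by positivity)]
  nlinarith

theorem a_bdd [Nonempty ι] (s : ℂ) : ∃ C, 0 ≤ C ∧ ∀ k, ‖S.a s k‖ ≤ C := by
  obtain ⟨C, hC, h⟩ := (S.sqSummable_a s).bdd
  obtain ⟨W, hW, hw⟩ := S.w_bdd
  refine ⟨C * W, by positivity, fun k => ?_⟩
  have h1 := (le_abs_self _).trans (h k)
  rw [div_le_iff₀ (S.w_pos k)] at h1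
  exact h1.trans (mul_le_mul_of_nonneg_left (hw k) hC)

/-- Square-summability of a complex family with a weight. -/
def WSq (u : ι → ℝ) (x : ι → ℂ) : Prop := SqSummable fun k => u k * ‖x k‖

theorem WSq.mono {u v : ι → ℝ} {x y : ι → ℂ} (hy : WSq v y) (C : ℝ)
    (h : ∀ k, |u k| * ‖x k‖ ≤ C * (|v k| * ‖y k‖)) : WSq u x :=
  SqSummable.of_le hy C fun k => by simpa only [abs_mul, abs_norm] using h k

theorem WSq.add {u : ι → ℝ} {x y : ι → ℂ} (hx : WSq u x) (hy : WSq u y) :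
    WSq u fun k => x k + y k := by
  have h2 : SqSummable fun k => |u k * ‖x k‖| + |u k * ‖y k‖| :=
    (hx.of_le (f := fun k => |u k * ‖x k‖|) 1 (by simp)).add (hy.of_le 1 (by simp))
  refine h2.of_le 1 fun k => ?_
  simp only [abs_mul, abs_norm, one_mul]
  rw [← mul_add, abs_mul, abs_abs]
  exact mul_le_mul_of_nonneg_left ((norm_add_le _ _).trans (le_abs_self _)) (abs_nonneg _)

theorem WSq.bdd_mul {u : ι → ℝ} {x c : ι → ℂ} (hx : WSq u x) {C : ℝ} (hc : ∀ k, ‖c k‖ ≤ C) :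
    WSq u fun k => c k * x k :=
  hx.mono C fun k => by
    rw [norm_mul]
    calc |u k| * (‖c k‖ * ‖x k‖) = ‖c k‖ * (|u k| * ‖x k‖) := by ring
      _ ≤ C * (|u k| * ‖x k‖) := by gcongr; exact hc k

theorem WSq.const_mul {u : ι → ℝ} {x : ι → ℂ} (hx : WSq u x) (c : ℂ) :
    WSq u fun k => c * x k := hx.bdd_mul (c := fun _ => c) fun _ => le_rfl

theorem WSq.mul_const {u : ι → ℝ} {x : ι → ℂ} (hx : WSq u x) (c : ℂ) :
    WSq u fun k => x k * c := by
  simpa only [mul_comm] using hx.const_mul c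

/-- The weighted space of pairs `(z, q)` with weight `u`. -/
def space (u : ι → ℝ) : Submodule ℂ ((ι → ℂ) × (ι → ℂ)) where
  carrier := {θ | WSq u θ.1 ∧ WSq u θ.2}
  zero_mem' := by constructor <;> simp [WSq, SqSummable, summable_zero]
  add_mem' := fun hx hy => ⟨hx.1.add hy.1, hx.2.add hy.2⟩
  smul_mem' := fun c _ hx => ⟨hx.1.const_mul c, hx.2.const_mul c⟩

/-- The state space with weight `w`. -/
abbrev E : Submodule ℂ ((ι → ℂ) × (ι → ℂ)) := space S.w

/-- The dual of the state space. -/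
abbrev G : Submodule ℂ ((ι → ℂ) × (ι → ℂ)) := space fun k => (S.w k)⁻¹

end ModalSystem

/-! ### The symmetric pairing, the formal generator and its eigenvectors. -/

namespace ModalSystem

variable {ι : Type*} (S : ModalSystem ι)

theorem wsq_mul_summable {x y : ι → ℂ} (hx : WSq (fun k => (S.w k)⁻¹) x) (hy : WSq S.w y) :
    Summable fun k => x k * y k := by
  refine Summable.of_norm_bounded (SqSummable.mul hx hy) fun k => le_of_eq ?_
  have := (S.w_pos k).ne'
  rw [norm_mul]
  field_simp

theorem wsq_w_of_one {x : ι → ℂ} (hx : WSq (fun _ => 1) x) : WSq S.w x := by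
  obtain ⟨C, hC, h⟩ := S.w_bdd
  refine hx.mono C fun k => ?_
  rw [abs_one, one_mul, abs_of_pos (S.w_pos k)]
  gcongr
  exact h k

theorem wsq_one_of_inv {x : ι → ℂ} (hx : WSq (fun k => (S.w k)⁻¹) x) : WSq (fun _ => 1) x := by
  obtain ⟨C, hC, h⟩ := S.w_bdd
  refine hx.mono C fun k => ?_
  have hw := S.w_pos k
  rw [abs_one, one_mul, abs_of_pos (inv_pos.2 hw), ← mul_assoc]
  refine le_mul_of_one_le_left (norm_nonneg _) ?_
  rw [← div_eq_mul_inv, one_le_div hw]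
  exact h k

theorem wsq_β : WSq (fun _ => 1) fun k => (S.β k : ℂ) :=
  S.β_sq.of_le 1 fun k => by simp

theorem wsq_w_β : WSq S.w fun k => (S.β k : ℂ) := S.wsq_w_of_one S.wsq_β

theorem wsq_a [Nonempty ι] (s : ℂ) : WSq (fun k => (S.w k)⁻¹) (S.a s) :=
  (S.sqSummable_a s).of_le 1 fun k => by
    rw [one_mul, div_eq_inv_mul]

theorem norm_β_le : ∃ C, 0 ≤ C ∧ ∀ k, ‖(S.β k : ℂ)‖ ≤ C := by
  obtain ⟨C, hC, h⟩ := S.β_bdd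
  exact ⟨C, hC, fun k => by
    rw [Complex.norm_real, Real.norm_of_nonneg (S.β_pos k).le]; exact h k⟩

theorem G_le_E : S.G ≤ S.E := fun _ h =>
  ⟨S.wsq_w_of_one (S.wsq_one_of_inv h.1), S.wsq_w_of_one (S.wsq_one_of_inv h.2)⟩

/-- The symmetric pairing `∑ (z q' + q z')`. -/
def bil (φ θ : (ι → ℂ) × (ι → ℂ)) : ℂ := ∑' k, (φ.1 k * θ.2 k + φ.2 k * θ.1 k)

variable {S} in
theorem hasSum_bil {φ θ : (ι → ℂ) × (ι → ℂ)} (hφ : φ ∈ S.G) (hθ : θ ∈ S.E) :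
    HasSum (fun k => φ.1 k * θ.2 k + φ.2 k * θ.1 k) (bil φ θ) :=
  ((S.wsq_mul_summable hφ.1 hθ.2).add (S.wsq_mul_summable hφ.2 hθ.1)).hasSum

variable {S} in
theorem bil_add {φ θ θ' : (ι → ℂ) × (ι → ℂ)} (hφ : φ ∈ S.G) (hθ : θ ∈ S.E) (hθ' : θ' ∈ S.E) :
    bil φ (θ + θ') = bil φ θ + bil φ θ' := by
  refine HasSum.tsum_eq ?_
  convert (hasSum_bil hφ hθ).add (hasSum_bil hφ hθ') using 2 with k
  simp; ring

theorem bil_smul (φ θ : (ι → ℂ) × (ι → ℂ)) (c : ℂ) : bil φ (c • θ) = c * bil φ θ := by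
  rw [bil, bil, ← tsum_mul_left]
  exact tsum_congr fun k => by simp; ring

theorem bil_comm (φ θ : (ι → ℂ) × (ι → ℂ)) : bil φ θ = bil θ φ :=
  tsum_congr fun k => by ring

/-- The formal eigenvector at the spectral parameter `s`. -/
def phi (s : ℂ) : (ι → ℂ) × (ι → ℂ) := (fun k => S.β k * S.a s k, fun k => S.β k * S.a s k ^ 2)

/-- The characteristic function of the system. -/
def h (s : ℂ) : ℂ := 1 - ∑' k, (S.β k : ℂ) ^ 2 * S.a s k ^ 2

theorem wsq_inv_β_mul_a [Nonempty ι] (s : ℂ) :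
    WSq (fun k => (S.w k)⁻¹) fun k => S.β k * S.a s k := by
  obtain ⟨C, _, hC⟩ := S.norm_β_le
  exact (S.wsq_a s).bdd_mul hC

/-- This makes pairing with `phi s` a bounded functional on the large space `E`, where the final
estimate is taken. -/
theorem phi_mem_G [Nonempty ι] (s : ℂ) : S.phi s ∈ S.G := by
  obtain ⟨C, _, hC⟩ := S.a_bdd s
  refine ⟨S.wsq_inv_β_mul_a s, ?_⟩
  convert (S.wsq_inv_β_mul_a s).bdd_mul hC using 2 with k
  simp only [phi]; ring

theorem hasSum_h [Nonempty ι] (s : ℂ) :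
    HasSum (fun k => (S.β k : ℂ) ^ 2 * S.a s k ^ 2) (1 - S.h s) := by
  rw [h, sub_sub_cancel]
  refine Summable.hasSum ?_
  obtain ⟨C, _, hC⟩ := S.a_bdd s
  refine Summable.of_norm_bounded (Summable.mul_left (C ^ 2) S.β_sq) fun k => ?_
  rw [norm_mul, norm_pow, norm_pow, Complex.norm_real, Real.norm_eq_abs, sq_abs, mul_comm]
  gcongr
  exact hC k

/-- `θ'` is the image of `θ` under the formal generator. -/
def IsGen (θ θ' : (ι → ℂ) × (ι → ℂ)) : Prop :=
  ∃ f : ℂ, HasSum (fun k => S.β k * θ.2 k) f ∧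
    (∀ k, θ'.1 k = -Complex.I * S.ν k * θ.1 k + S.β k * f) ∧
    ∀ k, θ'.2 k = -Complex.I * S.ν k * θ.2 k + θ.1 k

variable {S}

theorem IsGen.unique {θ θ' θ'' : (ι → ℂ) × (ι → ℂ)} (h1 : S.IsGen θ θ') (h2 : S.IsGen θ θ'') :
    θ' = θ'' := by
  obtain ⟨f, hf, h1, h1'⟩ := h1
  obtain ⟨g, hg, h2, h2'⟩ := h2
  obtain rfl := hf.unique hg
  exact Prod.ext (funext fun k => (h1 k).trans (h2 k).symm)
    (funext fun k => (h1' k).trans (h2' k).symm)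

theorem IsGen.add {θ θ' η η' : (ι → ℂ) × (ι → ℂ)} (h1 : S.IsGen θ θ') (h2 : S.IsGen η η') :
    S.IsGen (θ + η) (θ' + η') := by
  obtain ⟨f, hf, h1, h1'⟩ := h1
  obtain ⟨g, hg, h2, h2'⟩ := h2
  refine ⟨f + g, ?_, fun k => ?_, fun k => ?_⟩
  · convert hf.add hg using 2 with k
    simp; ring
  · simp only [Prod.fst_add, Pi.add_apply, h1, h2]; ring
  · simp only [Prod.fst_add, Prod.snd_add, Pi.add_apply, h1', h2']; ring

theorem IsGen.smul {θ θ' : (ι → ℂ) × (ι → ℂ)} (h1 : S.IsGen θ θ') (c : ℂ) :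
    S.IsGen (c • θ) (c • θ') := by
  obtain ⟨f, hf, h1, h1'⟩ := h1
  refine ⟨c * f, ?_, fun k => ?_, fun k => ?_⟩
  · have e : (fun k => (S.β k : ℂ) * (c • θ).2 k) = fun k => c * (S.β k * θ.2 k) := by
      funext k
      simp only [Prod.smul_snd, Pi.smul_apply, smul_eq_mul]; ring
    rw [e]
    exact hf.mul_left c
  · simp only [Prod.smul_fst, Pi.smul_apply, h1, smul_eq_mul]; ring
  · simp only [Prod.smul_fst, Prod.smul_snd, Pi.smul_apply, h1', smul_eq_mul]; ring

/-- The diagonal terms and the coupling of `z` into `q` cancel in each mode. What remains is `β_k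
(ζ_k g - f θ_k)` in the second components, with sum `fg - fg = 0`. -/
theorem IsGen.bil_symm {ζ ζ' θ θ' : (ι → ℂ) × (ι → ℂ)} (h1 : S.IsGen ζ ζ') (h2 : S.IsGen θ θ')
    (hζ : ζ ∈ S.G) (hζ' : ζ' ∈ S.G) (hθ : θ ∈ S.E) (hθ' : θ' ∈ S.E) :
    bil ζ θ' = bil ζ' θ := by
  obtain ⟨f, hf, h1, h1'⟩ := h1
  obtain ⟨g, hg, h2, h2'⟩ := h2
  have e1 := (hasSum_bil hζ hθ').sub (hasSum_bil hζ' hθ)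
  have e2 := (hf.mul_right g).sub (hg.mul_left f)
  rw [sub_self] at e2
  refine sub_eq_zero.1 (e1.unique ?_)
  convert e2 using 2 with k
  rw [h1, h1', h2, h2']
  ring

theorem a_mul_cancel {s : ℂ} {k : ι} (h : s + Complex.I * S.ν k ≠ 0) :
    S.a s k * (s + Complex.I * S.ν k) = 1 := inv_mul_cancel₀ h

theorem add_I_mul_ne_zero {s : ℂ} (h : s.re ≠ 0) (x : ℝ) : s + Complex.I * x ≠ 0 := by
  intro h0
  apply h
  simpa using congrArg Complex.re h0

/-- For `q = βa²` the control `Σ βq` equals `1 - h(s)`. The normalisation `f = 1` is therefore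
consistent exactly when `h(s) = 0`. -/
theorem isGen_phi [Nonempty ι] {s : ℂ} (hre : s.re ≠ 0) (hs : S.h s = 0) :
    S.IsGen (S.phi s) (s • S.phi s) := by
  refine ⟨1, ?_, fun k => ?_, fun k => ?_⟩
  · have := S.hasSum_h s
    rw [hs, sub_zero] at this
    convert this using 2 with k
    simp only [phi]; ring
  all_goals
    have := a_mul_cancel (S := S) (add_I_mul_ne_zero hre (S.ν k))
    simp only [phi, Prod.smul_mk, Pi.smul_apply, smul_eq_mul]
  · linear_combination (S.β k : ℂ) * this
  · linear_combination (S.β k : ℂ) * S.a s k * this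

/-- There is no nonzero eigenvector with an imaginary eigenvalue. -/
theorem IsGen.eq_zero_of_re_eq_zero {s : ℂ} (hre : s.re = 0) {θ : (ι → ℂ) × (ι → ℂ)}
    (h : S.IsGen θ (s • θ)) : θ = 0 := by
  obtain ⟨f, hf, h1, h2⟩ := h
  simp only [Prod.smul_fst, Prod.smul_snd, Pi.smul_apply, smul_eq_mul] at h1 h2
  have hs : (starRingEnd ℂ) s = -s := by
    apply Complex.ext <;> simp [hre]
  -- Conjugate the `q`-equation, use `conj s = -s`, and cancel the oscillating terms against the
  -- `z`-equation. Summed over `k` this reads `Σ|z_k|² = -|f|²`, so both sides vanish.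
  have key : ∀ k, ((‖θ.1 k‖ ^ 2 : ℝ) : ℂ) = -((starRingEnd ℂ) (S.β k * θ.2 k) * f) := by
    intro k
    have e2 := congrArg (starRingEnd ℂ) (h2 k)
    simp only [map_mul, map_add, map_neg, Complex.conj_I, Complex.conj_ofReal, hs] at e2 ⊢
    have e0 : ((‖θ.1 k‖ ^ 2 : ℝ) : ℂ) = θ.1 k * (starRingEnd ℂ) (θ.1 k) := by
      rw [Complex.mul_conj, Complex.normSq_eq_norm_sq]
    rw [e0]
    linear_combination (-θ.1 k) * e2 - (starRingEnd ℂ) (θ.2 k) * h1 k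
  have hsum : HasSum (fun k => ((‖θ.1 k‖ ^ 2 : ℝ) : ℂ)) (-((starRingEnd ℂ) f * f)) := by
    simp only [key]
    exact ((hf.map (starRingEnd ℂ) Complex.continuous_conj).mul_right f).neg
  rw [mul_comm, Complex.mul_conj, ← Complex.ofReal_neg, Complex.hasSum_ofReal] at hsum
  have hf0 : f = 0 := by
    have := hsum.nonneg fun k => sq_nonneg _
    have := Complex.normSq_nonneg f
    exact Complex.normSq_eq_zero.1 (by linarith)
  have hz : ∀ k, θ.1 k = 0 := by
    intro k
    rw [hf0, map_zero, neg_zero] at hsum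
    have := (hasSum_zero_iff_of_nonneg fun k => sq_nonneg ‖θ.1 k‖).1 hsum
    simpa using congrFun this k
  have hq0 : ∀ k, (s + Complex.I * S.ν k) * θ.2 k = 0 := by
    intro k
    have := h2 k
    rw [hz] at this
    linear_combination this
  -- With `z = 0`, the component `q` can live only on a mode with `s = -iν_n`. The gap allows at
  -- most one such mode, and then `β_n q_n = f = 0`.
  have hq : ∀ k, θ.2 k = 0 := by
    intro n
    by_contra hn
    have hn0 : s + Complex.I * S.ν n = 0 := (mul_eq_zero.1 (hq0 n)).resolve_right hn
    have hother : ∀ k, k ≠ n → S.β k * θ.2 k = 0 := by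
      intro k hk
      rcases mul_eq_zero.1 (hq0 k) with h0 | h0
      · exfalso
        have h3 : Complex.I * (S.ν k - S.ν n) = 0 := by linear_combination h0 - hn0
        have h4 := (mul_eq_zero.1 h3).resolve_left Complex.I_ne_zero
        have h5 := S.gap_le k n hk
        rw [← Complex.ofReal_sub, Complex.ofReal_eq_zero] at h4
        rw [h4, abs_zero] at h5
        exact absurd S.gap_pos (not_lt.2 h5)
      · rw [h0, mul_zero]
    have h6 := (hasSum_single n hother).unique hf
    rw [hf0] at h6
    rcases mul_eq_zero.1 h6 with h7 | h7
    · exact (S.β_pos n).ne' (Complex.ofReal_eq_zero.1 h7)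
    · exact hn h7
  exact Prod.ext (funext hz) (funext hq)

/-- Off the imaginary axis `s + iν_k` is invertible, so the value of `f` determines every
coordinate. -/
theorem IsGen.exists_eq_smul_phi {s : ℂ} (hre : s.re ≠ 0) {θ : (ι → ℂ) × (ι → ℂ)}
    (h : S.IsGen θ (s • θ)) : ∃ f : ℂ, θ = f • S.phi s := by
  obtain ⟨f, -, h1, h2⟩ := h
  simp only [Prod.smul_fst, Prod.smul_snd, Pi.smul_apply, smul_eq_mul] at h1 h2
  refine ⟨f, ?_⟩
  have hz : ∀ k, θ.1 k = f * (S.β k * S.a s k) := fun k => by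
    have := a_mul_cancel (S := S) (add_I_mul_ne_zero hre (S.ν k))
    linear_combination (-θ.1 k) * this + S.a s k * h1 k
  have hq : ∀ k, θ.2 k = f * (S.β k * S.a s k ^ 2) := fun k => by
    have := a_mul_cancel (S := S) (add_I_mul_ne_zero hre (S.ν k))
    linear_combination (-θ.2 k) * this + S.a s k * h2 k + S.a s k * hz k
  exact Prod.ext (funext hz) (funext hq)

end ModalSystem

/-! ### The resolvent, and the kernel of the eigenfunctionals. -/

namespace ModalSystem

variable {ι : Type*} (S : ModalSystem ι)

theorem exists_h_ne_zero [Nonempty ι] : ∃ s : ℂ, s.re ≠ 0 ∧ S.h s ≠ 0 := by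
  set B : ℝ := ∑' k, S.β k ^ 2 with hB
  have hB0 : 0 ≤ B := tsum_nonneg fun k => sq_nonneg _
  -- At this point `|a_k| ≤ 1/(1+B)`, so a zero of `h` would give `1 ≤ B/(1+B)²`, which is
  -- impossible.
  refine ⟨((1 + B : ℝ) : ℂ), by rw [Complex.ofReal_re]; positivity, fun h0 => ?_⟩
  set s : ℂ := ((1 + B : ℝ) : ℂ) with hs
  have ha : ∀ k, ‖S.a s k‖ ≤ (1 + B)⁻¹ := fun k => by
    rw [a, norm_inv]
    refine inv_anti₀ (by positivity) ?_
    refine le_trans ?_ (Complex.abs_re_le_norm _)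
    simp [hs, abs_of_nonneg (show 0 ≤ 1 + B by positivity)]
  have h1 := S.hasSum_h s
  rw [h0, sub_zero] at h1
  have h2 : HasSum (fun k => S.β k ^ 2 * ((1 + B)⁻¹) ^ 2) (B * ((1 + B)⁻¹) ^ 2) :=
    (Summable.hasSum S.β_sq).mul_right _
  have h3 : ‖(1 : ℂ)‖ ≤ B * ((1 + B)⁻¹) ^ 2 := by
    rw [← h1.tsum_eq]
    refine tsum_of_norm_bounded h2 fun k => ?_
    rw [norm_mul, norm_pow, norm_pow, Complex.norm_real, Real.norm_eq_abs, sq_abs]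
    gcongr
    exact ha k
  rw [norm_one, inv_pow, ← div_eq_mul_inv, le_div_iff₀ (by positivity)] at h3
  nlinarith

/-- The resolvent of the formal generator. -/
def resolv (s : ℂ) (θ : (ι → ℂ) × (ι → ℂ)) : (ι → ℂ) × (ι → ℂ) :=
  (fun k => S.a s k * (θ.1 k + S.β k * (bil (S.phi s) θ / S.h s)),
   fun k => S.a s k * (θ.2 k + S.a s k * (θ.1 k + S.β k * (bil (S.phi s) θ / S.h s))))

variable {S}

theorem resolv_mem_E [Nonempty ι] (s : ℂ) {θ : (ι → ℂ) × (ι → ℂ)} (hθ : θ ∈ S.E) :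
    S.resolv s θ ∈ S.E := by
  obtain ⟨C, _, hC⟩ := S.a_bdd s
  have h1 := (hθ.1.add (S.wsq_w_β.mul_const (bil (S.phi s) θ / S.h s))).bdd_mul hC
  exact ⟨h1, (hθ.2.add h1).bdd_mul hC⟩

theorem a_mul_bdd [Nonempty ι] (s : ℂ) {x : ι → ℂ} (hx : WSq S.w x) :
    ∃ C, ∀ k, ‖S.a s k * x k‖ ≤ C := by
  obtain ⟨C, hC0, hC⟩ := SqSummable.bdd (S.wsq_a s)
  obtain ⟨D, hD0, hD⟩ := SqSummable.bdd hx
  refine ⟨C * D, fun k => ?_⟩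
  have := (S.w_pos k).ne'
  calc ‖S.a s k * x k‖ = ((S.w k)⁻¹ * ‖S.a s k‖) * (S.w k * ‖x k‖) := by
        rw [norm_mul]; field_simp
    _ ≤ C * D := mul_le_mul ((le_abs_self _).trans (hC k)) ((le_abs_self _).trans (hD k))
        (mul_nonneg (S.w_pos k).le (norm_nonneg _)) hC0

/-- First gain of regularity: a symbol square summable with weight `1/w`, times a state square
summable with weight `w`, is bounded. -/
theorem resolv_bdd [Nonempty ι] (s : ℂ) {θ : (ι → ℂ) × (ι → ℂ)} (hθ : θ ∈ S.E) :
    (∃ C, ∀ k, ‖(S.resolv s θ).1 k‖ ≤ C) ∧ ∃ C, ∀ k, ‖(S.resolv s θ).2 k‖ ≤ C :=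
  ⟨a_mul_bdd s (hθ.1.add (S.wsq_w_β.mul_const _)),
    a_mul_bdd s (hθ.2.add (resolv_mem_E s hθ).1)⟩

/-- Second gain: a bounded family times the resolvent symbol inherits the summability of the symbol
with weight `1/w`. Two resolvents thus carry `E` into `G`. -/
theorem resolv_mem_G [Nonempty ι] (s : ℂ) {θ : (ι → ℂ) × (ι → ℂ)}
    (h1 : ∃ C, ∀ k, ‖θ.1 k‖ ≤ C) (h2 : ∃ C, ∀ k, ‖θ.2 k‖ ≤ C) :
    S.resolv s θ ∈ S.G := by
  obtain ⟨C, _, hC⟩ := S.a_bdd s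
  obtain ⟨C₁, h1⟩ := h1
  obtain ⟨C₂, h2⟩ := h2
  have hz : WSq (fun k => (S.w k)⁻¹) (S.resolv s θ).1 := by
    have e := ((S.wsq_a s).bdd_mul h1).add
      ((S.wsq_inv_β_mul_a s).mul_const (bil (S.phi s) θ / S.h s))
    convert e using 2 with k
    simp only [resolv]; ring
  refine ⟨hz, ?_⟩
  have e := ((S.wsq_a s).bdd_mul h2).add (hz.bdd_mul hC)
  convert e using 2 with k
  simp only [resolv]; ring

/-- Solving mode by mode with an unknown control `F` leaves the condition `F = bil (phi s) θ + F (1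
- h s)`. It determines `F` because `h s ≠ 0`. -/
theorem isGen_resolv [Nonempty ι] {s : ℂ} (hre : s.re ≠ 0) (hs : S.h s ≠ 0)
    {θ : (ι → ℂ) × (ι → ℂ)} (hθ : θ ∈ S.E) :
    S.IsGen (S.resolv s θ) (s • S.resolv s θ - θ) := by
  set F := bil (S.phi s) θ / S.h s with hF
  refine ⟨F, ?_, fun k => ?_, fun k => ?_⟩
  · have h1 := (hasSum_bil (S.phi_mem_G s) hθ).add ((S.hasSum_h s).mul_left F)
    have h2 : bil (S.phi s) θ + F * (1 - S.h s) = F := by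
      rw [hF]; field_simp; ring
    rw [h2] at h1
    convert h1 using 2 with k
    simp only [resolv, ← hF]
    simp only [phi]; ring
  all_goals
    have := a_mul_cancel (S := S) (add_I_mul_ne_zero hre (S.ν k))
    simp only [resolv, ← hF, Prod.fst_sub, Prod.snd_sub, Prod.smul_mk, Pi.sub_apply, Pi.smul_apply,
      smul_eq_mul]
  · linear_combination (θ.1 k + S.β k * F) * this
  · linear_combination (θ.2 k + S.a s k * (θ.1 k + S.β k * F)) * this

theorem resolv_add [Nonempty ι] (s : ℂ) {θ η : (ι → ℂ) × (ι → ℂ)} (hθ : θ ∈ S.E) (hη : η ∈ S.E) :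
    S.resolv s (θ + η) = S.resolv s θ + S.resolv s η := by
  refine Prod.ext (funext fun k => ?_) (funext fun k => ?_) <;>
  · simp only [resolv, bil_add (S.phi_mem_G s) hθ hη, Prod.fst_add, Prod.snd_add, Pi.add_apply]
    ring

theorem resolv_smul (s c : ℂ) (θ : (ι → ℂ) × (ι → ℂ)) :
    S.resolv s (c • θ) = c • S.resolv s θ := by
  refine Prod.ext (funext fun k => ?_) (funext fun k => ?_) <;>
  · simp only [resolv, bil_smul, Prod.smul_fst, Prod.smul_snd, Pi.smul_apply, smul_eq_mul]
    ring

theorem IsGen.zero_left {θ : (ι → ℂ) × (ι → ℂ)} (h : S.IsGen 0 θ) : θ = 0 :=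
  h.unique (by simpa using h.smul 0)

variable (S)

/-- The states annihilated by the eigenfunctionals with spectral parameters in `P`. -/
def kerSpec [Nonempty ι] (P : Set ℂ) : Submodule ℂ ((ι → ℂ) × (ι → ℂ)) where
  carrier := {θ | θ ∈ S.E ∧ ∀ s ∈ P, bil (S.phi s) θ = 0}
  zero_mem' := ⟨S.E.zero_mem, fun s _ => by simp [bil]⟩
  add_mem' := fun hx hy => ⟨S.E.add_mem hx.1 hy.1, fun s hs => by
    rw [bil_add (S.phi_mem_G s) hx.1 hy.1, hx.2 s hs, hy.2 s hs, add_zero]⟩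
  smul_mem' := fun c _ hx => ⟨S.E.smul_mem c hx.1, fun s hs => by
    rw [bil_smul, hx.2 s hs, mul_zero]⟩

/-- The parameters in `P` are simple zeros of the characteristic function off the imaginary
axis. -/
structure IsSpec (P : Set ℂ) : Prop where
  re_ne_zero : ∀ s ∈ P, s.re ≠ 0
  h_eq_zero : ∀ s ∈ P, S.h s = 0
  bil_ne_zero : ∀ s ∈ P, bil (S.phi s) (S.phi s) ≠ 0

variable {S} [Nonempty ι] {P : Set ℂ}

/-- Pairing with `phi σ` and moving the generator across by symmetry gives `(s - σ) * bil (phi σ) θ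
= 0`. Hence the kernel is stable under resolvents at points outside `P`. -/
theorem mem_kerSpec_of_isGen (hP : S.IsSpec P) {θ ζ : (ι → ℂ) × (ι → ℂ)} {s : ℂ}
    (hθ : θ ∈ S.E) (hζ : ζ ∈ S.kerSpec P) (hg : S.IsGen θ (s • θ + ζ)) (hs : s ∉ P) :
    θ ∈ S.kerSpec P := by
  refine ⟨hθ, fun σ hσ => ?_⟩
  have h1 := (isGen_phi (hP.re_ne_zero σ hσ) (hP.h_eq_zero σ hσ)).bil_symm hg (S.phi_mem_G σ)
    (S.G.smul_mem σ (S.phi_mem_G σ)) hθ (S.E.add_mem (S.E.smul_mem s hθ) hζ.1)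
  rw [bil_add (S.phi_mem_G σ) (S.E.smul_mem s hθ) hζ.1, hζ.2 σ hσ, bil_comm (σ • S.phi σ),
    bil_smul, bil_smul, bil_comm θ, add_zero] at h1
  have h2 : (s - σ) * bil (S.phi σ) θ = 0 := by linear_combination h1
  refine (mul_eq_zero.1 h2).resolve_left fun h3 => hs ?_
  rw [sub_eq_zero.1 h3]
  exact hσ

/-- The resolvent maps the kernel to itself injectively, so finite dimension makes it onto there. -/
theorem exists_resolv_eq (hP : S.IsSpec P) [FiniteDimensional ℂ (S.kerSpec P)] {s : ℂ}
    (hre : s.re ≠ 0) (hs : S.h s ≠ 0) {ζ : (ι → ℂ) × (ι → ℂ)} (hζ : ζ ∈ S.kerSpec P) :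
    ∃ η ∈ S.kerSpec P, S.resolv s η = ζ := by
  have hsP : s ∉ P := fun h => hs (hP.h_eq_zero s h)
  let R : S.kerSpec P →ₗ[ℂ] S.kerSpec P :=
    { toFun := fun η => ⟨S.resolv s η, mem_kerSpec_of_isGen hP (resolv_mem_E s η.2.1)
        (ζ := -η.1) (neg_mem η.2) (by
          rw [← sub_eq_add_neg]; exact isGen_resolv hre hs η.2.1) hsP⟩
      map_add' := fun x y => Subtype.ext (resolv_add s x.2.1 y.2.1)
      map_smul' := fun c x => Subtype.ext (resolv_smul s c x.1) }
  have hinj : Function.Injective R := by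
    rw [← LinearMap.ker_eq_bot, LinearMap.ker_eq_bot']
    intro η hη
    have h0 : S.resolv s η.1 = 0 := congrArg Subtype.val hη
    have h1 := isGen_resolv hre hs η.2.1
    rw [h0] at h1
    have h2 := h1.zero_left
    rw [smul_zero, zero_sub, neg_eq_zero] at h2
    exact Subtype.ext h2
  obtain ⟨η, hη⟩ := LinearMap.injective_iff_surjective.1 hinj ⟨ζ, hζ⟩
  exact ⟨η.1, η.2, congrArg Subtype.val hη⟩

/-- Every element of the kernel is the image of another under two resolvents, hence as regular as
the range of the squared resolvent. Kernel elements may then be used as functionals on `E`. -/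
theorem kerSpec_le_G (hP : S.IsSpec P) [FiniteDimensional ℂ (S.kerSpec P)] :
    S.kerSpec P ≤ S.G := by
  intro ζ hζ
  obtain ⟨s, hre, hs⟩ := S.exists_h_ne_zero
  obtain ⟨η, hη, rfl⟩ := exists_resolv_eq hP hre hs hζ
  obtain ⟨θ, hθ, rfl⟩ := exists_resolv_eq hP hre hs hη
  have := resolv_bdd s hθ.1
  exact resolv_mem_G s this.1 this.2

theorem exists_isGen (hP : S.IsSpec P) [FiniteDimensional ℂ (S.kerSpec P)]
    {ζ : (ι → ℂ) × (ι → ℂ)} (hζ : ζ ∈ S.kerSpec P) : ∃ η ∈ S.kerSpec P, S.IsGen ζ η := by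
  obtain ⟨s, hre, hs⟩ := S.exists_h_ne_zero
  obtain ⟨η, hη, rfl⟩ := exists_resolv_eq hP hre hs hζ
  exact ⟨_, sub_mem (Submodule.smul_mem _ s hζ) hη, isGen_resolv hre hs hη.1⟩

/-- The restriction of the formal generator to the kernel of the eigenfunctionals. -/
theorem exists_generator (hP : S.IsSpec P) [FiniteDimensional ℂ (S.kerSpec P)] :
    ∃ A : Module.End ℂ (S.kerSpec P), ∀ ζ, S.IsGen ζ.1 (A ζ).1 := by
  have key : ∀ ζ : S.kerSpec P, ∃ η : S.kerSpec P, S.IsGen ζ.1 η.1 := fun ζ => by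
    obtain ⟨η, hη, h⟩ := exists_isGen hP ζ.2
    exact ⟨⟨η, hη⟩, h⟩
  choose A hA using key
  exact ⟨{ toFun := A
           map_add' := fun x y => Subtype.ext ((hA (x + y)).unique ((hA x).add (hA y)))
           map_smul' := fun c x => Subtype.ext ((hA (c • x)).unique ((hA x).smul c)) }, hA⟩

theorem bil_symm_generator (hP : S.IsSpec P) [FiniteDimensional ℂ (S.kerSpec P)]
    {A : Module.End ℂ (S.kerSpec P)} (hA : ∀ ζ, S.IsGen ζ.1 (A ζ).1) (ζ θ : S.kerSpec P) :
    bil ζ.1 (A θ).1 = bil (A ζ).1 θ.1 :=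
  (hA ζ).bil_symm (hA θ) (kerSpec_le_G hP ζ.2) (kerSpec_le_G hP (A ζ).2) θ.2.1 (A θ).2.1

/-- The pairing is nondegenerate on the kernel of the eigenfunctionals. -/
theorem bil_nondegenerate (hP : S.IsSpec P) [FiniteDimensional ℂ (S.kerSpec P)]
    (θ : S.kerSpec P) (hθ : ∀ ζ : S.kerSpec P, bil ζ.1 θ.1 = 0) : θ = 0 := by
  obtain ⟨A, hA⟩ := exists_generator hP
  -- `W` is the radical of the pairing on the kernel. It is invariant under the symmetric operator
  -- `A`, so a nonzero `W` contains an eigenvector, which must be a multiple of some `phi s`.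
  let W : Submodule ℂ (S.kerSpec P) :=
    { carrier := {θ | ∀ ζ : S.kerSpec P, bil ζ.1 θ.1 = 0}
      zero_mem' := fun ζ => by simp [bil]
      add_mem' := fun {x y} hx hy ζ => by
        rw [Submodule.coe_add, bil_add (kerSpec_le_G hP ζ.2) x.2.1 y.2.1, hx ζ, hy ζ, add_zero]
      smul_mem' := fun c x hx ζ => by rw [Submodule.coe_smul, bil_smul, hx ζ, mul_zero] }
  have hW : ∀ x ∈ W, A x ∈ W := fun x hx ζ => by
    rw [bil_symm_generator hP hA]; exact hx _
  suffices hbot : W = ⊥ by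
    have : θ ∈ W := hθ
    rwa [hbot, Submodule.mem_bot] at this
  by_contra hne
  have : Nontrivial W := Submodule.nontrivial_iff_ne_bot.2 hne
  obtain ⟨s, hs⟩ := Module.End.exists_eigenvalue (K := ℂ) (V := W) (A.restrict hW)
  obtain ⟨v, hv, hv0⟩ := hs.exists_hasEigenvector
  have hAv : A v.1 = s • v.1 := congrArg Subtype.val (Module.End.mem_eigenspace_iff.1 hv)
  have hgen := hA v.1
  rw [hAv] at hgen
  have hvne : v.1 ≠ 0 := fun h => hv0 (Subtype.ext h)
  have hre : s.re ≠ 0 := fun h => hvne (Subtype.ext (IsGen.eq_zero_of_re_eq_zero h hgen))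
  obtain ⟨f, hf⟩ := IsGen.exists_eq_smul_phi hre hgen
  have hf0 : f ≠ 0 := by
    rintro rfl
    exact hvne (Subtype.ext (by rw [hf, zero_smul]; rfl))
  -- If `s` were in `P`, the eigenvector would annihilate itself, contrary to the nonvanishing of
  -- `bil (phi s) (phi s)`.
  have hsP : s ∉ P := fun hsP => by
    have h1 := v.1.2.2 s hsP
    rw [hf, bil_smul] at h1
    exact (mul_ne_zero hf0 (hP.bil_ne_zero s hsP)) h1
  have hphi : ∀ ζ : S.kerSpec P, bil (S.phi s) ζ.1 = 0 := fun ζ => by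
    have h1 : bil ζ.1 v.1.1 = 0 := v.2 ζ
    rw [hf, bil_smul] at h1
    rw [bil_comm]
    exact (mul_eq_zero.1 h1).resolve_left hf0
  -- Since `phi s` annihilates the whole kernel, the equation for `x` with right-hand side `ζ` is
  -- solvable with zero control: the condition `Σ βq = 0` is exactly `bil (phi s) ζ = 0`. So `A - s`
  -- is onto, hence injective, contradicting its eigenvector.
  have hsurj : Function.Surjective (A - s • (1 : Module.End ℂ (S.kerSpec P))) := by
    intro ζ
    obtain ⟨C, _, hC⟩ := S.a_bdd s
    let x : (ι → ℂ) × (ι → ℂ) := (fun k => S.a s k * -ζ.1.1 k,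
      fun k => S.a s k * (S.a s k * -ζ.1.1 k + -ζ.1.2 k))
    have hneg : -ζ.1 ∈ S.E := neg_mem ζ.2.1
    have hx1 : WSq S.w x.1 := hneg.1.bdd_mul hC
    have hx : x ∈ S.E := ⟨hx1, (hx1.add hneg.2).bdd_mul hC⟩
    have hxg : S.IsGen x (s • x + ζ.1) := by
      refine ⟨0, ?_, fun k => ?_, fun k => ?_⟩
      · have h1 := (hasSum_bil (S.phi_mem_G s) ζ.2.1).neg
        rw [hphi ζ, neg_zero] at h1
        have e : (fun k => (S.β k : ℂ) * x.2 k) =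
            fun k => -((S.phi s).1 k * ζ.1.2 k + (S.phi s).2 k * ζ.1.1 k) := by
          funext k
          simp only [x, phi]; ring
        rw [e]
        exact h1
      all_goals
        have := a_mul_cancel (S := S) (add_I_mul_ne_zero hre (S.ν k))
        simp only [x, Prod.fst_add, Prod.snd_add, Prod.smul_mk, Pi.add_apply, Pi.smul_apply,
          smul_eq_mul]
      · linear_combination (-ζ.1.1 k) * this
      · linear_combination (S.a s k * -ζ.1.1 k + -ζ.1.2 k) * this
    have hxZ := mem_kerSpec_of_isGen hP hx ζ.2 hxg hsP
    refine ⟨⟨x, hxZ⟩, Subtype.ext ?_⟩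
    have h2 := (hA ⟨x, hxZ⟩).unique hxg
    change (A ⟨x, hxZ⟩).1 - s • x = ζ.1
    rw [h2, add_sub_cancel_left]
  have hinj := LinearMap.injective_iff_surjective.2 hsurj
  refine hvne (hinj ?_)
  rw [map_zero, LinearMap.sub_apply, LinearMap.smul_apply, Module.End.one_apply, hAv, sub_self]

end ModalSystem

/-! ### Localisation of the zeros of the characteristic function. -/

namespace ModalSystem

variable {ι : Type*} (S : ModalSystem ι)

/-- The reciprocal frequency differences; they vanish on the diagonal. -/
def recDiff (n m : ι) : ℝ := |1 / (S.ν n - S.ν m)|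

/-- The resolvent symbols with the mode `n` removed. -/
def offA (n : ι) (s : ℂ) : ι → ℂ := ({n}ᶜ : Set ι).indicator (S.a s)

/-- The characteristic sum with the mode `n` removed. -/
def eps (n : ι) (s : ℂ) : ℂ := ∑' m, (S.β m : ℂ) ^ 2 * S.offA n s m ^ 2

/-- A bound for the characteristic sums with the mode `n` removed. -/
def offSum (n : ι) : ℝ := ∑' m, S.β m ^ 2 * S.recDiff n m ^ 2

/-- The modes for which the spectrum near `-i ν n` is localised. -/
def IsGood (n : ι) : Prop := S.β n ≤ S.gap / 4 ∧ S.offSum n ≤ 1 / 64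

variable {S}

theorem recDiff_nonneg (n m : ι) : 0 ≤ S.recDiff n m := abs_nonneg _

theorem recDiff_self (n : ι) : S.recDiff n n = 0 := by simp [recDiff]

theorem recDiff_le (n m : ι) : S.recDiff n m ≤ 1 / S.gap := by
  rcases eq_or_ne n m with rfl | h
  · rw [recDiff_self]; exact (one_div_pos.2 S.gap_pos).le
  · rw [recDiff, abs_div, abs_one]
    exact one_div_le_one_div_of_le S.gap_pos (S.gap_le n m h)

theorem summable_β_recDiff (n : ι) : Summable fun m => S.β m ^ 2 * S.recDiff n m ^ 2 := by
  refine Summable.of_nonneg_of_le (fun m => by positivity) (fun m => ?_)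
    (Summable.mul_right ((1 / S.gap) ^ 2) S.β_sq)
  gcongr
  · exact recDiff_nonneg n m
  · exact recDiff_le n m

theorem offSum_nonneg (n : ι) : 0 ≤ S.offSum n := tsum_nonneg fun m => by positivity

/-- Dominated convergence: for fixed `m` the term tends to zero as `n` varies, because the
frequencies escape, and the gap provides the majorant `β_m²/gap²`. -/
theorem tendsto_offSum : Filter.Tendsto S.offSum Filter.cofinite (nhds 0) := by
  have h := tendsto_tsum_of_dominated_convergence (𝓕 := Filter.cofinite)
    (f := fun n m => S.β m ^ 2 * S.recDiff n m ^ 2) (g := fun _ => (0 : ℝ))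
    (Summable.mul_right ((1 / S.gap) ^ 2) S.β_sq) (fun m => ?_)
    (Filter.Eventually.of_forall fun n m => ?_)
  · rw [tsum_zero] at h
    exact h
  · have h1 := (S.tendsto_inv_sq m).const_mul (S.β m ^ 2)
    rw [mul_zero] at h1
    refine h1.congr fun n => ?_
    rw [recDiff, sq_abs, div_pow, one_pow, ← sq_abs (S.ν m - S.ν n), abs_sub_comm, sq_abs]
  · rw [Real.norm_of_nonneg (by positivity)]
    gcongr
    · exact recDiff_nonneg n m
    · exact recDiff_le n m

theorem eventually_isGood : ∀ᶠ n in Filter.cofinite, S.IsGood n := by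
  have h1 : Filter.Tendsto S.β Filter.cofinite (nhds 0) := by
    have := (Summable.tendsto_cofinite_zero S.β_sq).sqrt
    rw [Real.sqrt_zero] at this
    exact this.congr fun n => Real.sqrt_sq (S.β_pos n).le
  filter_upwards [h1.eventually (ge_mem_nhds (show (0 : ℝ) < S.gap / 4 by linarith [S.gap_pos])),
    tendsto_offSum.eventually (ge_mem_nhds (show (0 : ℝ) < 1 / 64 by norm_num))] with n hn hn'
  exact ⟨hn, hn'⟩

theorem offA_self (n : ι) (s : ℂ) : S.offA n s n = 0 := by simp [offA]

theorem offA_of_ne {n m : ι} (h : m ≠ n) (s : ℂ) : S.offA n s m = S.a s m := by simp [offA, h]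

/-- The distance `gap/2` to `-iν_n` uses up at most half of the frequency difference, which leaves
the other half as distance to `-iν_m`. -/
theorem le_norm_of_near {n m : ι} (hm : m ≠ n) {s : ℂ} (hs : ‖s + Complex.I * S.ν n‖ ≤ S.gap / 2) :
    |S.ν n - S.ν m| ≤ 2 * ‖s + Complex.I * S.ν m‖ := by
  have : ‖(Complex.I * S.ν n - Complex.I * S.ν m : ℂ)‖ = |S.ν n - S.ν m| := by
    rw [← mul_sub, norm_mul, Complex.norm_I, one_mul, ← Complex.ofReal_sub, Complex.norm_real,
      Real.norm_eq_abs]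
  have h2 := norm_sub_le (s + Complex.I * S.ν n) (s + Complex.I * S.ν m)
  rw [show s + Complex.I * S.ν n - (s + Complex.I * S.ν m)
    = Complex.I * S.ν n - Complex.I * S.ν m by ring, this] at h2
  linarith [S.gap_le n m hm.symm]

theorem norm_offA_le {n : ι} {s : ℂ} (hs : ‖s + Complex.I * S.ν n‖ ≤ S.gap / 2) (m : ι) :
    ‖S.offA n s m‖ ≤ 2 * S.recDiff n m := by
  rcases eq_or_ne m n with rfl | h
  · rw [offA_self, norm_zero]; linarith [recDiff_nonneg (S := S) m m]
  · have h1 := le_norm_of_near h hs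
    have h2 : 0 < |S.ν n - S.ν m| := S.gap_pos.trans_le (S.gap_le n m h.symm)
    rw [offA_of_ne h, a, norm_inv, recDiff, abs_div, abs_one, mul_one_div, inv_eq_one_div,
      div_le_div_iff₀ (by linarith) h2]
    linarith

theorem norm_offA_sub_le {n : ι} {s t : ℂ} (hs : ‖s + Complex.I * S.ν n‖ ≤ S.gap / 2)
    (ht : ‖t + Complex.I * S.ν n‖ ≤ S.gap / 2) (m : ι) :
    ‖S.offA n s m - S.offA n t m‖ ≤ 4 * ‖s - t‖ * S.recDiff n m ^ 2 := by
  rcases eq_or_ne m n with rfl | h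
  · rw [offA_self, offA_self, sub_zero, norm_zero]; positivity
  · have h2 : 0 < |S.ν n - S.ν m| := S.gap_pos.trans_le (S.gap_le n m h.symm)
    have h0 : ∀ x : ℂ, ‖x + Complex.I * S.ν n‖ ≤ S.gap / 2 → x + Complex.I * S.ν m ≠ 0 :=
      fun x hx h0 => by
        have := le_norm_of_near h hx
        rw [h0, norm_zero] at this
        linarith
    -- The resolvent identity.
    have e : S.offA n s m - S.offA n t m = (t - s) * (S.offA n s m * S.offA n t m) := by
      rw [offA_of_ne h, offA_of_ne h, a, a, inv_sub_inv (h0 s hs) (h0 t ht), div_eq_mul_inv,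
        mul_inv]
      ring
    rw [e, norm_mul, norm_mul, norm_sub_rev]
    calc ‖s - t‖ * (‖S.offA n s m‖ * ‖S.offA n t m‖)
        ≤ ‖s - t‖ * ((2 * S.recDiff n m) * (2 * S.recDiff n m)) := by
          gcongr
          · linarith [recDiff_nonneg (S := S) n m]
          · exact norm_offA_le hs m
          · exact norm_offA_le ht m
      _ = 4 * ‖s - t‖ * S.recDiff n m ^ 2 := by ring

theorem norm_offA_sq_sub_le {n : ι} {s t : ℂ} (hs : ‖s + Complex.I * S.ν n‖ ≤ S.gap / 2)
    (ht : ‖t + Complex.I * S.ν n‖ ≤ S.gap / 2) (m : ι) :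
    ‖S.offA n s m ^ 2 - S.offA n t m ^ 2‖ ≤ 16 / S.gap * ‖s - t‖ * S.recDiff n m ^ 2 := by
  have hr := recDiff_nonneg (S := S) n m
  rw [sq_sub_sq, norm_mul]
  calc ‖S.offA n s m + S.offA n t m‖ * ‖S.offA n s m - S.offA n t m‖
      ≤ (2 * S.recDiff n m + 2 * S.recDiff n m) * (4 * ‖s - t‖ * S.recDiff n m ^ 2) := by
        gcongr
        · exact (norm_add_le _ _).trans (add_le_add (norm_offA_le hs m) (norm_offA_le ht m))
        · exact norm_offA_sub_le hs ht m
    _ = S.recDiff n m * (16 * ‖s - t‖ * S.recDiff n m ^ 2) := by ring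
    _ ≤ 1 / S.gap * (16 * ‖s - t‖ * S.recDiff n m ^ 2) := by gcongr; exact recDiff_le n m
    _ = 16 / S.gap * ‖s - t‖ * S.recDiff n m ^ 2 := by ring

theorem norm_β_sq (m : ι) : ‖(S.β m : ℂ) ^ 2‖ = S.β m ^ 2 := by
  rw [norm_pow, Complex.norm_real, Real.norm_eq_abs, sq_abs]

theorem hasSum_eps {n : ι} {s : ℂ} (hs : ‖s + Complex.I * S.ν n‖ ≤ S.gap / 2) :
    HasSum (fun m => (S.β m : ℂ) ^ 2 * S.offA n s m ^ 2) (S.eps n s) := by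
  refine (Summable.of_norm_bounded (Summable.mul_left 4 (summable_β_recDiff (S := S) n)) fun m => ?_).hasSum
  rw [norm_mul, norm_β_sq, norm_pow]
  calc S.β m ^ 2 * ‖S.offA n s m‖ ^ 2 ≤ S.β m ^ 2 * (2 * S.recDiff n m) ^ 2 := by
        gcongr; exact norm_offA_le hs m
    _ = _ := by ring

theorem norm_eps_le {n : ι} {s : ℂ} (hs : ‖s + Complex.I * S.ν n‖ ≤ S.gap / 2) :
    ‖S.eps n s‖ ≤ 4 * S.offSum n := by
  refine tsum_of_norm_bounded ((summable_β_recDiff n).hasSum.mul_left 4) fun m => ?_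
  rw [norm_mul, norm_β_sq, norm_pow]
  calc S.β m ^ 2 * ‖S.offA n s m‖ ^ 2 ≤ S.β m ^ 2 * (2 * S.recDiff n m) ^ 2 := by
        gcongr; exact norm_offA_le hs m
    _ = _ := by ring

theorem norm_eps_sub_le {n : ι} {s t : ℂ} (hs : ‖s + Complex.I * S.ν n‖ ≤ S.gap / 2)
    (ht : ‖t + Complex.I * S.ν n‖ ≤ S.gap / 2) :
    ‖S.eps n s - S.eps n t‖ ≤ 16 / S.gap * ‖s - t‖ * S.offSum n := by
  rw [← ((hasSum_eps hs).sub (hasSum_eps ht)).tsum_eq]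
  refine tsum_of_norm_bounded ((summable_β_recDiff n).hasSum.mul_left (16 / S.gap * ‖s - t‖))
    fun m => ?_
  rw [← mul_sub, norm_mul, norm_β_sq]
  calc S.β m ^ 2 * ‖S.offA n s m ^ 2 - S.offA n t m ^ 2‖
      ≤ S.β m ^ 2 * (16 / S.gap * ‖s - t‖ * S.recDiff n m ^ 2) := by
        gcongr; exact norm_offA_sq_sub_le hs ht m
    _ = _ := by ring

variable (S) in
/-- `d` is the deviation from `-i ν n` of a zero of the characteristic function. -/
def IsRoot (n : ι) (d : ℂ) : Prop :=
  ‖d‖ ≤ 5 / 4 * S.β n ∧ d ^ 2 * (1 - S.eps n (-Complex.I * S.ν n + d)) = (S.β n : ℂ) ^ 2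

theorem near_of_norm_le {n : ι} (hn : S.IsGood n) {d : ℂ} (hd : ‖d‖ ≤ 5 / 4 * S.β n) :
    ‖-Complex.I * S.ν n + d + Complex.I * S.ν n‖ ≤ S.gap / 2 := by
  rw [show -Complex.I * S.ν n + d + Complex.I * S.ν n = d by ring]
  linarith [hn.1, S.gap_pos]

theorem exists_fixedPoint_of_contracting {f : ℂ → ℂ} {r : ℝ} (hr : 0 ≤ r)
    (hmaps : ∀ x, ‖x‖ ≤ r → ‖f x‖ ≤ r)
    (hlip : ∀ x y, ‖x‖ ≤ r → ‖y‖ ≤ r → ‖f x - f y‖ ≤ 1 / 2 * ‖x - y‖) :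
    ∃ x, ‖x‖ ≤ r ∧ f x = x := by
  have hm : Set.MapsTo f (Metric.closedBall 0 r) (Metric.closedBall 0 r) := fun x hx => by
    rw [mem_closedBall_zero_iff] at hx ⊢; exact hmaps x hx
  have hc : ContractingWith (1 / 2) (hm.restrict f _ _) := by
    refine ⟨by norm_num, LipschitzWith.of_dist_le_mul fun x y => ?_⟩
    rw [Subtype.dist_eq, Subtype.dist_eq, dist_eq_norm, dist_eq_norm]
    simpa using hlip x.1 y.1 (mem_closedBall_zero_iff.1 x.2) (mem_closedBall_zero_iff.1 y.2)
  obtain ⟨x, hx, hfx, -⟩ := hc.exists_fixedPoint' (Metric.isClosed_closedBall.isComplete) hm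
    (Metric.mem_closedBall_self hr) (edist_ne_top _ _)
  exact ⟨x, mem_closedBall_zero_iff.1 hx, hfx⟩

/-- With `d = β_n(1 + x)` the root equation becomes `x = (ε(1+x)² - x²)/2`, a contraction of the
disc `‖x‖ ≤ 1/4`. The constants of `IsGood` give `‖ε‖ ≤ 4/64 = 1/16` there and keep `d` within
`gap/2`; the radius `1/4` yields the bounds `5/4` and `3/4`. -/
theorem exists_isRoot {n : ι} (hn : S.IsGood n) :
    ∃ d : ℂ, S.IsRoot n d ∧ 3 / 4 * S.β n ≤ d.re := by
  have hβ := S.β_pos n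
  have hg := S.gap_pos
  have he0 := offSum_nonneg (S := S) n
  let s : ℂ → ℂ := fun x => -Complex.I * S.ν n + S.β n * (1 + x)
  let f : ℂ → ℂ := fun x => (S.eps n (s x) * (1 + x) ^ 2 - x ^ 2) / 2
  have hone : ∀ x : ℂ, ‖x‖ ≤ 1 / 4 → ‖1 + x‖ ≤ 5 / 4 := fun x hx => by
    have := norm_add_le (1 : ℂ) x
    rw [norm_one] at this
    linarith
  have hd : ∀ x : ℂ, ‖x‖ ≤ 1 / 4 → ‖(S.β n : ℂ) * (1 + x)‖ ≤ 5 / 4 * S.β n := fun x hx => by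
    rw [norm_mul, Complex.norm_real, Real.norm_of_nonneg hβ.le]
    nlinarith [hone x hx]
  have hnear : ∀ x : ℂ, ‖x‖ ≤ 1 / 4 → ‖s x + Complex.I * S.ν n‖ ≤ S.gap / 2 := fun x hx =>
    near_of_norm_le hn (hd x hx)
  have heps : ∀ x : ℂ, ‖x‖ ≤ 1 / 4 → ‖S.eps n (s x)‖ ≤ 1 / 16 := fun x hx =>
    (norm_eps_le (hnear x hx)).trans (by linarith [hn.2])
  obtain ⟨x, hx, hfx⟩ := exists_fixedPoint_of_contracting (f := f) (r := 1 / 4) (by norm_num)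
    (fun x hx => by
      have h1 : ‖S.eps n (s x) * (1 + x) ^ 2‖ ≤ 1 / 16 * (5 / 4) ^ 2 := by
        rw [norm_mul, norm_pow]
        gcongr
        · exact heps x hx
        · exact hone x hx
      have h2 : ‖x ^ 2‖ ≤ (1 / 4) ^ 2 := by
        rw [norm_pow]; gcongr
      have h3 := norm_sub_le (S.eps n (s x) * (1 + x) ^ 2) (x ^ 2)
      simp only [f, norm_div, Complex.norm_ofNat]
      linarith)
    (fun x y hx hy => by
      have hxy := norm_nonneg (x - y)
      have h1 : ‖(S.eps n (s x) - S.eps n (s y)) * (1 + x) ^ 2‖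
          ≤ (1 / 16 * ‖x - y‖) * (5 / 4) ^ 2 := by
        rw [norm_mul, norm_pow]
        gcongr
        · refine (norm_eps_sub_le (hnear x hx) (hnear y hy)).trans ?_
          have : s x - s y = S.β n * (x - y) := by simp only [s]; ring
          rw [this, norm_mul, Complex.norm_real, Real.norm_of_nonneg hβ.le]
          calc 16 / S.gap * (S.β n * ‖x - y‖) * S.offSum n
              ≤ 16 / S.gap * (S.gap / 4 * ‖x - y‖) * (1 / 64) := by
                gcongr
                · exact hn.1
                · exact hn.2
            _ = 1 / 16 * ‖x - y‖ := by field_simp; ring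
        · exact hone x hx
      have h2 : ‖S.eps n (s y) * ((2 + x + y) * (x - y))‖ ≤ 1 / 16 * ((5 / 2) * ‖x - y‖) := by
        rw [norm_mul, norm_mul]
        gcongr
        · exact heps y hy
        · refine (norm_add_le _ _).trans ?_
          have := norm_add_le (2 : ℂ) x
          rw [Complex.norm_ofNat] at this
          linarith
      have h3 : ‖(x + y) * (x - y)‖ ≤ 1 / 2 * ‖x - y‖ := by
        rw [norm_mul]
        gcongr
        linarith [norm_add_le x y]
      have e : f x - f y = ((S.eps n (s x) - S.eps n (s y)) * (1 + x) ^ 2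
          + S.eps n (s y) * ((2 + x + y) * (x - y)) - (x + y) * (x - y)) / 2 := by
        simp only [f]; ring
      rw [e, norm_div, Complex.norm_ofNat]
      have h4 := norm_sub_le ((S.eps n (s x) - S.eps n (s y)) * (1 + x) ^ 2
          + S.eps n (s y) * ((2 + x + y) * (x - y))) ((x + y) * (x - y))
      have h5 := norm_add_le ((S.eps n (s x) - S.eps n (s y)) * (1 + x) ^ 2)
          (S.eps n (s y) * ((2 + x + y) * (x - y)))
      linarith)
  refine ⟨S.β n * (1 + x), ⟨hd x hx, ?_⟩, ?_⟩
  · have h1 : S.eps n (s x) * (1 + x) ^ 2 - x ^ 2 = 2 * x := by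
      simp only [f] at hfx
      linear_combination 2 * hfx
    change (S.β n * (1 + x)) ^ 2 * (1 - S.eps n (s x)) = (S.β n : ℂ) ^ 2
    linear_combination -(S.β n : ℂ) ^ 2 * h1
  · rw [Complex.re_ofReal_mul, Complex.add_re, Complex.one_re]
    have := (abs_le.1 (Complex.abs_re_le_norm x)).1
    nlinarith

/-- Reflection in the imaginary axis sends each resolvent symbol to minus its conjugate, because the
frequencies are real, and squaring removes the sign. This pairs each unstable zero with a stable
one. -/
theorem eps_neg_conj (n : ι) (d : ℂ) :
    S.eps n (-Complex.I * S.ν n + -(starRingEnd ℂ) d)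
      = (starRingEnd ℂ) (S.eps n (-Complex.I * S.ν n + d)) := by
  rw [eps, eps, Complex.conj_tsum]
  refine tsum_congr fun m => ?_
  have h : S.offA n (-Complex.I * S.ν n + -(starRingEnd ℂ) d) m
      = -(starRingEnd ℂ) (S.offA n (-Complex.I * S.ν n + d) m) := by
    rcases eq_or_ne m n with rfl | h
    · rw [offA_self, offA_self, map_zero, neg_zero]
    · rw [offA_of_ne h, offA_of_ne h, a, a, map_inv₀, ← inv_neg]
      congr 1
      simp only [map_add, map_mul, map_neg, Complex.conj_I, Complex.conj_ofReal]
      ring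
  rw [h]
  simp only [map_mul, map_pow, Complex.conj_ofReal, neg_sq]

theorem IsRoot.neg_conj {n : ι} {d : ℂ} (h : S.IsRoot n d) :
    S.IsRoot n (-(starRingEnd ℂ) d) := by
  refine ⟨by rw [norm_neg, Complex.norm_conj]; exact h.1, ?_⟩
  rw [eps_neg_conj]
  have := congrArg (starRingEnd ℂ) h.2
  simp only [map_mul, map_pow, map_sub, map_one, Complex.conj_ofReal] at this
  rw [neg_sq]
  exact this

end ModalSystem

/-! ### Normalised eigenfunctionals and their off-diagonal parts. -/

namespace ModalSystem

variable {ι : Type*} (S : ModalSystem ι)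

/-- The spectral parameter with deviation `d` from `-i ν n`. -/
def sp (n : ι) (d : ℂ) : ℂ := -Complex.I * S.ν n + d

/-- The formal eigenvector with the mode `n` removed. -/
def offPhi (n : ι) (s : ℂ) : (ι → ℂ) × (ι → ℂ) :=
  (fun k => S.β k * S.offA n s k, fun k => S.β k * S.offA n s k ^ 2)

/-- The majorant of the coupling of the mode `n` to the other modes. -/
def coupling (n : ι) (θ : (ι → ℂ) × (ι → ℂ)) : ℝ :=
  ∑' m, S.β m * S.recDiff n m * (‖θ.1 m‖ + ‖θ.2 m‖)

/-- The normalised eigenfunctional at the spectral parameter `sp n d`. -/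
def eigFun (n : ι) (d : ℂ) (θ : (ι → ℂ) × (ι → ℂ)) : ℂ := d ^ 2 / S.β n * bil (S.phi (S.sp n d)) θ

variable {S}

theorem hasSum_of_eq_off {f g : ι → ℂ} {c : ℂ} {n : ι} (hg : HasSum g c) (h0 : g n = 0)
    (h : ∀ m, m ≠ n → f m = g m) : HasSum f (f n + c) := by
  classical
  have h1 : HasSum (Pi.single n (f n) : ι → ℂ) (f n) := by
    have := hasSum_single (f := (Pi.single n (f n) : ι → ℂ)) n fun m hm => by simp [hm]
    simpa using this
  convert h1.add hg using 2 with m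
  rcases eq_or_ne m n with rfl | hm
  · simp [h0]
  · simp [hm, h m hm]

theorem sp_add (n : ι) (d : ℂ) : S.sp n d + Complex.I * S.ν n = d := by rw [sp]; ring

theorem sp_re (n : ι) (d : ℂ) : (S.sp n d).re = d.re := by simp [sp]

theorem a_sp (n : ι) (d : ℂ) : S.a (S.sp n d) n = d⁻¹ := by rw [a, sp_add]

theorem IsRoot.near {n : ι} {d : ℂ} (hn : S.IsGood n) (hd : S.IsRoot n d) :
    ‖S.sp n d + Complex.I * S.ν n‖ ≤ S.gap / 2 := near_of_norm_le hn hd.1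

theorem ofReal_β_ne_zero (n : ι) : (S.β n : ℂ) ≠ 0 := Complex.ofReal_ne_zero.2 (S.β_pos n).ne'

theorem IsRoot.ne_zero {n : ι} {d : ℂ} (hd : S.IsRoot n d) : d ≠ 0 := by
  rintro rfl
  have := hd.2
  rw [zero_pow two_ne_zero, zero_mul] at this
  exact pow_ne_zero 2 (ofReal_β_ne_zero n) this.symm

theorem IsRoot.norm_eps_le {n : ι} {d : ℂ} (hn : S.IsGood n) (hd : S.IsRoot n d) :
    ‖S.eps n (S.sp n d)‖ ≤ 1 / 16 :=
  (ModalSystem.norm_eps_le (hd.near hn)).trans (by linarith [hn.2])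

theorem IsRoot.le_norm_one_sub {n : ι} {d : ℂ} (hn : S.IsGood n) (hd : S.IsRoot n d) :
    15 / 16 ≤ ‖1 - S.eps n (S.sp n d)‖ := by
  have := norm_sub_norm_le 1 (S.eps n (S.sp n d))
  rw [norm_one] at this
  linarith [hd.norm_eps_le hn]

/-- The mode `n` contributes `β_n²/d²` to the characteristic sum and the others contribute `eps`.
The root equation is `h = 0` multiplied by `d²`. -/
theorem IsRoot.h_eq_zero [Nonempty ι] {n : ι} {d : ℂ} (hn : S.IsGood n) (hd : S.IsRoot n d) :
    S.h (S.sp n d) = 0 := by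
  have h1 := hasSum_of_eq_off (n := n) (f := fun m => (S.β m : ℂ) ^ 2 * S.a (S.sp n d) m ^ 2)
    (hasSum_eps (hd.near hn)) (by simp [offA_self]) fun m hm => by rw [offA_of_ne hm]
  have h2 := (S.hasSum_h (S.sp n d)).unique h1
  rw [a_sp] at h2
  have h3 : d ^ 2 * (1 - S.eps n (S.sp n d)) = (S.β n : ℂ) ^ 2 := hd.2
  have hd0 := hd.ne_zero
  have h4 : (S.β n : ℂ) ^ 2 * d⁻¹ ^ 2 = 1 - S.eps n (S.sp n d) := by
    rw [← h3]; field_simp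
  linear_combination -h2 - h4

theorem wsq_recDiff (n : ι) : WSq (fun k => (S.w k)⁻¹) fun m => (S.recDiff n m : ℂ) := by
  refine (S.sqSummable_col n).of_le 1 fun k => le_of_eq ?_
  rw [one_mul, Complex.norm_real, Real.norm_of_nonneg (recDiff_nonneg _ _), recDiff, abs_mul,
    abs_abs, abs_div, abs_div, abs_mul, abs_inv, abs_one]
  ring

theorem wsq_inv_β_mul {n : ι} {c : ι → ℂ} {C : ℝ} (hc : ∀ m, ‖c m‖ ≤ C * S.recDiff n m) :
    WSq (fun k => (S.w k)⁻¹) fun m => S.β m * c m := by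
  obtain ⟨B, _, hB⟩ := S.norm_β_le
  refine WSq.bdd_mul ?_ hB
  refine (wsq_recDiff (S := S) n).mono C fun k => ?_
  rw [Complex.norm_real, Real.norm_of_nonneg (recDiff_nonneg _ _)]
  calc |(S.w k)⁻¹| * ‖c k‖ ≤ |(S.w k)⁻¹| * (C * S.recDiff n k) := by gcongr; exact hc k
    _ = _ := by ring

theorem summable_coupling (n : ι) {θ : (ι → ℂ) × (ι → ℂ)} (hθ : θ ∈ S.E) :
    Summable fun m => S.β m * S.recDiff n m * (‖θ.1 m‖ + ‖θ.2 m‖) := by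
  have h := wsq_inv_β_mul (S := S) (n := n) (c := fun m => (S.recDiff n m : ℂ)) (C := 1) fun m => by
    rw [one_mul, Complex.norm_real, Real.norm_of_nonneg (recDiff_nonneg _ _)]
  refine ((S.wsq_mul_summable h hθ.1).norm.add (S.wsq_mul_summable h hθ.2).norm).congr fun m => ?_
  simp only [norm_mul, Complex.norm_real, Real.norm_of_nonneg (recDiff_nonneg n m),
    Real.norm_of_nonneg (S.β_pos m).le]
  ring

theorem coupling_nonneg (n : ι) (θ : (ι → ℂ) × (ι → ℂ)) : 0 ≤ S.coupling n θ :=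
  tsum_nonneg fun m => mul_nonneg (mul_nonneg (S.β_pos m).le (recDiff_nonneg n m)) (by positivity)

/-- Functionals whose coefficients are controlled by the reciprocal frequency differences are
controlled by the coupling majorant. -/
theorem norm_bil_le_coupling {n : ι} {c₁ c₂ : ι → ℂ} {C : ℝ}
    (h1 : ∀ m, ‖c₁ m‖ ≤ C * S.recDiff n m) (h2 : ∀ m, ‖c₂ m‖ ≤ C * S.recDiff n m)
    {θ : (ι → ℂ) × (ι → ℂ)} (hθ : θ ∈ S.E) :
    ‖bil (fun m => S.β m * c₁ m, fun m => S.β m * c₂ m) θ‖ ≤ C * S.coupling n θ := by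
  refine tsum_of_norm_bounded ((summable_coupling n hθ).hasSum.mul_left C) fun m => ?_
  have hβ := S.β_pos m
  calc ‖S.β m * c₁ m * θ.2 m + S.β m * c₂ m * θ.1 m‖
      ≤ S.β m * ‖c₁ m‖ * ‖θ.2 m‖ + S.β m * ‖c₂ m‖ * ‖θ.1 m‖ := by
        refine (norm_add_le _ _).trans (le_of_eq ?_)
        simp only [norm_mul, Complex.norm_real, Real.norm_of_nonneg hβ.le]
    _ ≤ S.β m * (C * S.recDiff n m) * ‖θ.2 m‖ + S.β m * (C * S.recDiff n m) * ‖θ.1 m‖ := by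
        gcongr
        · exact h1 m
        · exact h2 m
    _ = _ := by ring

theorem norm_offA_sq_le {n : ι} {s : ℂ} (hs : ‖s + Complex.I * S.ν n‖ ≤ S.gap / 2) (m : ι) :
    ‖S.offA n s m ^ 2‖ ≤ 4 * S.recDiff n m ^ 2 := by
  rw [norm_pow]
  calc ‖S.offA n s m‖ ^ 2 ≤ (2 * S.recDiff n m) ^ 2 := by gcongr; exact norm_offA_le hs m
    _ = _ := by ring

theorem recDiff_sq_le (n m : ι) : S.recDiff n m ^ 2 ≤ 1 / S.gap * S.recDiff n m := by
  rw [sq]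
  exact mul_le_mul_of_nonneg_right (recDiff_le n m) (recDiff_nonneg n m)

theorem offPhi_mem_G {n : ι} {s : ℂ} (hs : ‖s + Complex.I * S.ν n‖ ≤ S.gap / 2) :
    S.offPhi n s ∈ S.G := by
  refine ⟨wsq_inv_β_mul (norm_offA_le hs), wsq_inv_β_mul (n := n) (C := 4 * (1 / S.gap)) fun m => ?_⟩
  linarith [norm_offA_sq_le hs m, recDiff_sq_le (S := S) n m]

theorem bil_phi_sp [Nonempty ι] {n : ι} {d : ℂ} (hn : S.IsGood n) (hd : S.IsRoot n d)
    {θ : (ι → ℂ) × (ι → ℂ)} (hθ : θ ∈ S.E) :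
    bil (S.phi (S.sp n d)) θ
      = S.β n * d⁻¹ * θ.2 n + S.β n * d⁻¹ ^ 2 * θ.1 n + bil (S.offPhi n (S.sp n d)) θ := by
  have h1 := hasSum_of_eq_off (n := n)
    (f := fun m => (S.phi (S.sp n d)).1 m * θ.2 m + (S.phi (S.sp n d)).2 m * θ.1 m)
    (hasSum_bil (offPhi_mem_G (hd.near hn)) hθ) (by simp [offPhi, offA_self])
    fun m hm => by simp only [offPhi, phi, offA_of_ne hm]
  rw [(hasSum_bil (S.phi_mem_G _) hθ).unique h1]
  simp only [phi, a_sp]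

/-- The factor `d²/β_n` normalises the coefficient of `z_n` to `1` and that of `q_n` to `d`. Two
distinct values of `d` then determine both coordinates up to the coupling. -/
theorem eigFun_eq [Nonempty ι] {n : ι} {d : ℂ} (hn : S.IsGood n) (hd : S.IsRoot n d)
    {θ : (ι → ℂ) × (ι → ℂ)} (hθ : θ ∈ S.E) :
    S.eigFun n d θ = θ.1 n + d * θ.2 n + d ^ 2 / S.β n * bil (S.offPhi n (S.sp n d)) θ := by
  have h1 := hd.ne_zero
  have h2 := ofReal_β_ne_zero (S := S) n
  rw [eigFun, bil_phi_sp hn hd hθ]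
  field_simp
  ring

theorem eigFun_eq_zero_iff {n : ι} {d : ℂ} (hd : S.IsRoot n d) {θ : (ι → ℂ) × (ι → ℂ)} :
    S.eigFun n d θ = 0 ↔ bil (S.phi (S.sp n d)) θ = 0 := by
  have h1 := hd.ne_zero
  have h2 := ofReal_β_ne_zero (S := S) n
  rw [eigFun, mul_eq_zero, or_iff_right (div_ne_zero (pow_ne_zero 2 h1) h2)]

theorem IsRoot.norm_scale_le {n : ι} {d : ℂ} (hd : S.IsRoot n d) :
    ‖d ^ 2 / S.β n‖ ≤ 25 / 16 * S.β n := by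
  have hβ := S.β_pos n
  rw [norm_div, norm_pow, Complex.norm_real, Real.norm_of_nonneg hβ.le, div_le_iff₀ hβ]
  nlinarith [hd.1, norm_nonneg d]

/-- The root equation rewrites `d²/β_n` as `β_n/(1 - ε)`, so the Lipschitz bound for `ε` applies and
a factor `β_n` survives. Factoring `d² - e²` directly would lose it. -/
theorem IsRoot.norm_scale_sub_le {n : ι} {d e : ℂ} (hn : S.IsGood n) (hd : S.IsRoot n d)
    (he : S.IsRoot n e) :
    ‖d ^ 2 / S.β n - e ^ 2 / S.β n‖ ≤ S.β n * ‖d - e‖ * (1 / S.gap) := by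
  have hβ := S.β_pos n
  have hg := S.gap_pos
  have hβ' := ofReal_β_ne_zero (S := S) n
  have key : ∀ x : ℂ, S.IsRoot n x → 1 - S.eps n (S.sp n x) ≠ 0 ∧
      x ^ 2 / S.β n = S.β n / (1 - S.eps n (S.sp n x)) := fun x hx => by
    have h0 : 1 - S.eps n (S.sp n x) ≠ 0 := fun h0 => by
      have := hx.le_norm_one_sub hn
      rw [h0, norm_zero] at this
      norm_num at this
    refine ⟨h0, ?_⟩
    rw [div_eq_div_iff hβ' h0, ← sq]
    exact hx.2
  obtain ⟨hd0, hd'⟩ := key d hd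
  obtain ⟨he0, he'⟩ := key e he
  have e1 : d ^ 2 / S.β n - e ^ 2 / S.β n = S.β n * (S.eps n (S.sp n d) - S.eps n (S.sp n e))
      / ((1 - S.eps n (S.sp n d)) * (1 - S.eps n (S.sp n e))) := by
    rw [hd', he', div_sub_div _ _ hd0 he0]
    congr 1; ring
  have h1 := norm_eps_sub_le (hd.near hn) (he.near hn)
  have h2 : S.sp n d - S.sp n e = d - e := by simp only [sp]; ring
  rw [h2] at h1
  have h3 : 1 / 2 ≤ ‖1 - S.eps n (S.sp n d)‖ * ‖1 - S.eps n (S.sp n e)‖ := by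
    nlinarith [hd.le_norm_one_sub hn, he.le_norm_one_sub hn]
  rw [e1, norm_div, norm_mul, norm_mul, Complex.norm_real, Real.norm_of_nonneg hβ.le,
    div_le_iff₀ (by linarith)]
  have h4 : ‖S.eps n (S.sp n d) - S.eps n (S.sp n e)‖ ≤ 1 / 4 * (‖d - e‖ * (1 / S.gap)) := by
    refine h1.trans ?_
    calc 16 / S.gap * ‖d - e‖ * S.offSum n ≤ 16 / S.gap * ‖d - e‖ * (1 / 64) := by
          gcongr; exact hn.2
      _ = _ := by ring
  have h5 : 0 ≤ ‖d - e‖ * (1 / S.gap) := by positivity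
  calc S.β n * ‖S.eps n (S.sp n d) - S.eps n (S.sp n e)‖
      ≤ S.β n * (‖d - e‖ * (1 / S.gap) * (1 / 2)) := by gcongr; linarith
    _ = S.β n * ‖d - e‖ * (1 / S.gap) * (1 / 2) := by ring
    _ ≤ _ := by gcongr

/-- The off-diagonal part of a normalised eigenfunctional. -/
theorem IsRoot.norm_off_le {n : ι} {d : ℂ} (hn : S.IsGood n) (hd : S.IsRoot n d)
    {θ : (ι → ℂ) × (ι → ℂ)} (hθ : θ ∈ S.E) :
    ‖d ^ 2 / S.β n * bil (S.offPhi n (S.sp n d)) θ‖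
      ≤ (4 + 7 / S.gap) * S.β n * S.coupling n θ := by
  have hg := S.gap_pos
  have hβ := S.β_pos n
  have ho := coupling_nonneg (S := S) n θ
  have h1 := norm_bil_le_coupling (c₁ := S.offA n (S.sp n d)) (c₂ := fun m => S.offA n (S.sp n d) m ^ 2)
    (C := 2 + 4 * (1 / S.gap)) (n := n)
    (fun m => (norm_offA_le (hd.near hn) m).trans (by
      have := recDiff_nonneg (S := S) n m
      gcongr
      have : 0 ≤ 1 / S.gap := by positivity
      linarith))
    (fun m => (norm_offA_sq_le (hd.near hn) m).trans (by
      have := recDiff_nonneg (S := S) n m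
      linarith [recDiff_sq_le (S := S) n m])) hθ
  rw [norm_mul]
  calc ‖d ^ 2 / S.β n‖ * ‖bil (S.offPhi n (S.sp n d)) θ‖
      ≤ (25 / 16 * S.β n) * ((2 + 4 * (1 / S.gap)) * S.coupling n θ) := by
        gcongr
        · exact hd.norm_scale_le
        · exact h1
    _ = (25 / 8 + 25 / 4 * (1 / S.gap)) * (S.β n * S.coupling n θ) := by ring
    _ ≤ (4 + 7 * (1 / S.gap)) * (S.β n * S.coupling n θ) := by
        gcongr <;> norm_num
    _ = _ := by ring

/-- The off-diagonal parts of the eigenfunctionals of two zeros near the same mode differ by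
a multiple of the distance of the zeros. -/
theorem IsRoot.norm_off_sub_le {n : ι} {d e : ℂ} (hn : S.IsGood n) (hd : S.IsRoot n d)
    (he : S.IsRoot n e) {θ : (ι → ℂ) × (ι → ℂ)} (hθ : θ ∈ S.E) :
    ‖d ^ 2 / S.β n * bil (S.offPhi n (S.sp n d)) θ - e ^ 2 / S.β n * bil (S.offPhi n (S.sp n e)) θ‖
      ≤ (9 / S.gap + 29 / S.gap ^ 2) * S.β n * ‖d - e‖ * S.coupling n θ := by
  have hg := S.gap_pos
  have hβ := S.β_pos n
  have hg' : 0 ≤ 1 / S.gap := by positivity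
  set x := d ^ 2 / S.β n with hx
  set y := e ^ 2 / S.β n with hy
  have hxy : ‖x - y‖ ≤ S.β n * ‖d - e‖ * (1 / S.gap) := hd.norm_scale_sub_le hn he
  have hyn : ‖y‖ ≤ 25 / 16 * S.β n := he.norm_scale_le
  have hde : S.sp n d - S.sp n e = d - e := by simp only [sp]; ring
  have e1 : x * bil (S.offPhi n (S.sp n d)) θ - y * bil (S.offPhi n (S.sp n e)) θ
      = bil (fun m => S.β m * (x * S.offA n (S.sp n d) m - y * S.offA n (S.sp n e) m),
          fun m => S.β m * (x * S.offA n (S.sp n d) m ^ 2 - y * S.offA n (S.sp n e) m ^ 2)) θ := by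
    refine (HasSum.tsum_eq ?_).symm
    have h := ((hasSum_bil (offPhi_mem_G (hd.near hn)) hθ).mul_left x).sub
      ((hasSum_bil (offPhi_mem_G (he.near hn)) hθ).mul_left y)
    refine h.congr_fun fun m => ?_
    simp only [offPhi]; ring
  have hC : (9 / S.gap + 29 / S.gap ^ 2) * S.β n * ‖d - e‖ * S.coupling n θ
      = (S.β n * ‖d - e‖ * (9 * (1 / S.gap) + 29 * (1 / S.gap) ^ 2)) * S.coupling n θ := by
    field_simp
  rw [e1, hC]
  refine norm_bil_le_coupling (fun m => ?_) (fun m => ?_) hθ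
  · have hr := recDiff_nonneg (S := S) n m
    have hr2 := recDiff_sq_le (S := S) n m
    have h1 := norm_offA_sub_le (hd.near hn) (he.near hn) m
    rw [hde] at h1
    have e2 : x * S.offA n (S.sp n d) m - y * S.offA n (S.sp n e) m
        = (x - y) * S.offA n (S.sp n d) m + y * (S.offA n (S.sp n d) m - S.offA n (S.sp n e) m) := by
      ring
    rw [e2]
    calc _ ≤ ‖x - y‖ * ‖S.offA n (S.sp n d) m‖
          + ‖y‖ * ‖S.offA n (S.sp n d) m - S.offA n (S.sp n e) m‖ := by
          refine (norm_add_le _ _).trans ?_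
          rw [norm_mul, norm_mul]
      _ ≤ (S.β n * ‖d - e‖ * (1 / S.gap)) * (2 * S.recDiff n m)
          + (25 / 16 * S.β n) * (4 * ‖d - e‖ * (1 / S.gap * S.recDiff n m)) := by
          gcongr
          · exact norm_offA_le (hd.near hn) m
          · exact h1.trans (by gcongr)
      _ = S.β n * ‖d - e‖ * (33 / 4 * (1 / S.gap)) * S.recDiff n m := by ring
      _ ≤ _ := by
          gcongr
          nlinarith [sq_nonneg (1 / S.gap)]
  · have hr := recDiff_nonneg (S := S) n m
    have hr2 := recDiff_sq_le (S := S) n m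
    have h1 := norm_offA_sq_sub_le (hd.near hn) (he.near hn) m
    rw [hde] at h1
    have e2 : x * S.offA n (S.sp n d) m ^ 2 - y * S.offA n (S.sp n e) m ^ 2
        = (x - y) * S.offA n (S.sp n d) m ^ 2
          + y * (S.offA n (S.sp n d) m ^ 2 - S.offA n (S.sp n e) m ^ 2) := by
      ring
    rw [e2]
    calc _ ≤ ‖x - y‖ * ‖S.offA n (S.sp n d) m ^ 2‖
          + ‖y‖ * ‖S.offA n (S.sp n d) m ^ 2 - S.offA n (S.sp n e) m ^ 2‖ := by
          refine (norm_add_le _ _).trans ?_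
          rw [norm_mul, norm_mul]
      _ ≤ (S.β n * ‖d - e‖ * (1 / S.gap)) * (4 * (1 / S.gap * S.recDiff n m))
          + (25 / 16 * S.β n) * (16 / S.gap * ‖d - e‖ * (1 / S.gap * S.recDiff n m)) := by
          gcongr
          · exact (norm_offA_sq_le (hd.near hn) m).trans (by gcongr)
          · exact h1.trans (by gcongr)
      _ = S.β n * ‖d - e‖ * (29 * (1 / S.gap) ^ 2) * S.recDiff n m := by ring
      _ ≤ _ := by
          gcongr
          nlinarith

/-- The self-pairing is `2 Σ β²a³`, formally `h'(s)`, so this is simplicity of the zero. After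
multiplication by `d`, the mode `n` contributes `2(1 - ε)`, of modulus at least `15/8`, and the
other modes at most `5/64`. -/
theorem IsRoot.bil_ne_zero [Nonempty ι] {n : ι} {d : ℂ} (hn : S.IsGood n) (hd : S.IsRoot n d) :
    bil (S.phi (S.sp n d)) (S.phi (S.sp n d)) ≠ 0 := by
  intro h0
  have hg := S.gap_pos
  have hβ := S.β_pos n
  have hβ' := ofReal_β_ne_zero (S := S) n
  have hd0 := hd.ne_zero
  have h1 := bil_phi_sp hn hd (S.G_le_E (S.phi_mem_G (S.sp n d)))
  rw [h0] at h1
  simp only [phi, a_sp] at h1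
  have h2 : ‖bil (S.offPhi n (S.sp n d)) (S.phi (S.sp n d))‖ ≤ 16 / S.gap * S.offSum n := by
    refine tsum_of_norm_bounded ((summable_β_recDiff n).hasSum.mul_left (16 / S.gap)) fun m => ?_
    have hb := norm_offA_le (hd.near hn) m
    have hr := recDiff_nonneg (S := S) n m
    have hr1 := recDiff_le (S := S) n m
    have e1 : (S.offPhi n (S.sp n d)).1 m * (S.phi (S.sp n d)).2 m
        + (S.offPhi n (S.sp n d)).2 m * (S.phi (S.sp n d)).1 m
        = 2 * (S.β m : ℂ) ^ 2 * S.offA n (S.sp n d) m ^ 3 := by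
      rcases eq_or_ne m n with rfl | hm
      · simp [offPhi, offA_self]
      · simp only [offPhi, phi, offA_of_ne hm]; ring
    rw [e1, norm_mul, norm_mul, norm_β_sq, norm_pow, Complex.norm_ofNat]
    calc 2 * S.β m ^ 2 * ‖S.offA n (S.sp n d) m‖ ^ 3
        ≤ 2 * S.β m ^ 2 * (2 * S.recDiff n m) ^ 3 := by gcongr
      _ = 16 * S.recDiff n m * (S.β m ^ 2 * S.recDiff n m ^ 2) := by ring
      _ ≤ 16 * (1 / S.gap) * (S.β m ^ 2 * S.recDiff n m ^ 2) := by gcongr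
      _ = _ := by ring
  have h3 : (S.β n : ℂ) ^ 2 / d ^ 2 = 1 - S.eps n (S.sp n d) := by
    have h3 : d ^ 2 * (1 - S.eps n (S.sp n d)) = (S.β n : ℂ) ^ 2 := hd.2
    rw [← h3]; field_simp
  have h4 : bil (S.offPhi n (S.sp n d)) (S.phi (S.sp n d)) * d
      = -2 * (1 - S.eps n (S.sp n d)) := by
    rw [← h3]
    have : bil (S.offPhi n (S.sp n d)) (S.phi (S.sp n d))
        = -(S.β n * d⁻¹ * (S.β n * d⁻¹ ^ 2) + S.β n * d⁻¹ ^ 2 * (S.β n * d⁻¹)) := by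
      simp only [phi]
      linear_combination -h1
    rw [this]
    field_simp
    ring
  have h5 := congrArg norm h4
  rw [norm_mul, norm_mul, norm_neg, Complex.norm_ofNat] at h5
  have h6 : ‖bil (S.offPhi n (S.sp n d)) (S.phi (S.sp n d))‖ * ‖d‖
      ≤ (16 / S.gap * (1 / 64)) * (5 / 4 * (S.gap / 4)) := by
    gcongr
    · exact h2.trans (by gcongr; exact hn.2)
    · exact hd.1.trans (by gcongr; exact hn.1)
  have h7 : (16 / S.gap * (1 / 64)) * (5 / 4 * (S.gap / 4)) = 5 / 64 := by field_simp; norm_num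
  linarith [hd.le_norm_one_sub hn]

end ModalSystem

/-! ### Inversion of the identity plus a small Hilbert–Schmidt operator. -/

/-- Inversion of a small Hilbert–Schmidt perturbation of the identity, given by its rows. -/
theorem lp_neumann {ι F : Type*} [NormedAddCommGroup F] [NormedSpace ℂ F] [CompleteSpace F]
    (K : ι → lp (fun _ : ι => F) 2 →ₗ[ℂ] F) {r : ι → ℝ} (hr : Summable r)
    (hK : ∀ n y, ‖K n y‖ ^ 2 ≤ r n * ‖y‖ ^ 2) (hsum : ∑' n, r n ≤ 1 / 4) :
    (∀ u : lp (fun _ : ι => F) 2, ∃ y : lp (fun _ : ι => F) 2, ∀ n, y n + K n y = u n) ∧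
      ∀ y u : lp (fun _ : ι => F) 2, (∀ n, y n + K n y = u n) → ‖y‖ ≤ 2 * ‖u‖ := by
  have h2 : (2 : ℝ≥0∞).toReal = (2 : ℕ) := by norm_num
  have hsm : ∀ y, Summable fun n => ‖K n y‖ ^ (2 : ℝ≥0∞).toReal := fun y => by
    simp only [h2, Real.rpow_natCast]
    exact Summable.of_nonneg_of_le (fun n => sq_nonneg _) (fun n => hK n y) (hr.mul_right _)
  let K₀ : lp (fun _ : ι => F) 2 →ₗ[ℂ] lp (fun _ : ι => F) 2 :=
    { toFun := fun y => ⟨fun n => K n y, memℓp_gen (hsm y)⟩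
      map_add' := fun x y => lp.ext (funext fun n => (K n).map_add x y)
      map_smul' := fun c y => lp.ext (funext fun n => (K n).map_smul c y) }
  have hK₀ : ∀ y, ‖K₀ y‖ ≤ 1 / 2 * ‖y‖ := fun y => by
    refine lp.norm_le_of_tsum_le (by norm_num) (by positivity) ?_
    simp only [h2, Real.rpow_natCast]
    have h1 : ∑' n, ‖K n y‖ ^ 2 ≤ ∑' n, r n * ‖y‖ ^ 2 := by
      have := hsm y
      simp only [h2, Real.rpow_natCast] at this
      exact this.tsum_le_tsum (fun n => hK n y) (hr.mul_right _)
    rw [tsum_mul_right] at h1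
    change ∑' n, ‖K n y‖ ^ 2 ≤ _
    nlinarith [sq_nonneg ‖y‖]
  let T : lp (fun _ : ι => F) 2 →L[ℂ] lp (fun _ : ι => F) 2 := K₀.mkContinuous (1 / 2) hK₀
  have hT : ‖-T‖ < 1 := by
    rw [norm_neg]
    exact (K₀.mkContinuous_norm_le (by norm_num) hK₀).trans_lt (by norm_num)
  have hval : ∀ y n, (((1 : lp (fun _ : ι => F) 2 →L[ℂ] lp (fun _ : ι => F) 2) - -T) y) n
      = y n + K n y := fun y n => by
    rw [sub_neg_eq_add]; rfl
  constructor
  · intro u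
    obtain ⟨U, hU⟩ := isUnit_one_sub_of_norm_lt_one hT
    refine ⟨(↑U⁻¹ : lp (fun _ : ι => F) 2 →L[ℂ] lp (fun _ : ι => F) 2) u, fun n => ?_⟩
    have h3 := congrArg (fun f : lp (fun _ : ι => F) 2 →L[ℂ] lp (fun _ : ι => F) 2 => f u)
      U.mul_inv
    rw [hU] at h3
    rw [← hval]
    exact congrArg (fun v : lp (fun _ : ι => F) 2 => v n) h3
  · intro y u h
    have e : y + K₀ y = u := lp.ext (funext h)
    have h4 := norm_sub_le u (K₀ y)
    rw [← e, add_sub_cancel_right, e] at h4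
    linarith [hK₀ y]

/-! ### Diagonalising coordinates and the weighted coupling estimate. -/

namespace ModalSystem

variable {ι : Type*} (S : ModalSystem ι)

/-- The square of the norm of the weighted state space. -/
def eNormSq (θ : (ι → ℂ) × (ι → ℂ)) : ℝ := ∑' k, ((S.w k * ‖θ.1 k‖) ^ 2 + (S.w k * ‖θ.2 k‖) ^ 2)

/-- The sums of squares of the rows of the coupling matrix. -/
def row (n : ι) : ℝ := ∑' m, (S.β n * S.w n / (S.w m * (S.ν n - S.ν m))) ^ 2

/-- The diagonalised `q` coordinate. -/
def hatQ (n : ι) (d : ℂ) (θ : (ι → ℂ) × (ι → ℂ)) : ℂ :=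
  (S.eigFun n d θ - S.eigFun n (-(starRingEnd ℂ) d) θ) / (d - -(starRingEnd ℂ) d)

/-- The diagonalised `z` coordinate. -/
def hatZ (n : ι) (d : ℂ) (θ : (ι → ℂ) × (ι → ℂ)) : ℂ := S.eigFun n d θ - d * S.hatQ n d θ

/-- The modes `n` with localised spectrum and a zero with deviation `d` in the right half plane. -/
structure IsPair (n : ι) (d : ℂ) : Prop where
  good : S.IsGood n
  root : S.IsRoot n d
  le_re : 3 / 4 * S.β n ≤ d.re

variable {S}

theorem summable_row : Summable S.row := Summable.prod S.hs

theorem row_nonneg (n : ι) : 0 ≤ S.row n := tsum_nonneg fun _ => sq_nonneg _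

theorem eNormSq_nonneg (θ : (ι → ℂ) × (ι → ℂ)) : 0 ≤ S.eNormSq θ :=
  tsum_nonneg fun _ => by positivity

/-- Here the Hilbert–Schmidt hypothesis enters. Inserting `w_m/w_m` writes the weighted coupling as
a row of the matrix applied to the weighted state, up to the bounded factor `β_m`, and
Cauchy–Schwarz concludes. -/
theorem coupling_le : ∃ C, 0 ≤ C ∧ ∀ n, ∀ θ ∈ S.E,
    (S.w n * (S.β n * S.coupling n θ)) ^ 2 ≤ C * S.row n * S.eNormSq θ := by
  obtain ⟨B, hB0, hB⟩ := S.β_bdd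
  refine ⟨2 * B ^ 2, by positivity, fun n θ hθ => ?_⟩
  have h1 : SqSummable fun m => S.w m * (‖θ.1 m‖ + ‖θ.2 m‖) := by
    have := SqSummable.add (f := fun k => S.w k * ‖θ.1 k‖) hθ.1 hθ.2
    simpa only [← mul_add] using this
  have h2 : SqSummable fun m => S.β n * S.w n / (S.w m * (S.ν n - S.ν m)) :=
    S.hs.comp_injective (i := fun k => (n, k)) fun _ _ h => (Prod.mk.inj h).2
  have h3 := SqSummable.tsum_abs_mul_le h2 h1
  have h4 : S.w n * (S.β n * S.coupling n θ) ≤ B * ∑' m, |S.β n * S.w n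
      / (S.w m * (S.ν n - S.ν m)) * (S.w m * (‖θ.1 m‖ + ‖θ.2 m‖))| := by
    rw [coupling, ← mul_assoc, ← tsum_mul_left, ← tsum_mul_left]
    refine ((summable_coupling n hθ).mul_left _).tsum_le_tsum (fun m => ?_)
      ((h2.mul h1).abs.mul_left B)
    have hw := S.w_pos m
    have e : |S.β n * S.w n / (S.w m * (S.ν n - S.ν m)) * (S.w m * (‖θ.1 m‖ + ‖θ.2 m‖))|
        = S.w n * S.β n * (S.recDiff n m * (‖θ.1 m‖ + ‖θ.2 m‖)) := by
      rw [abs_mul, abs_div, abs_mul, abs_mul, abs_mul, recDiff, abs_div, abs_one, abs_of_pos hw,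
        abs_of_pos (S.w_pos n), abs_of_pos (S.β_pos n),
        abs_of_nonneg (by positivity : 0 ≤ ‖θ.1 m‖ + ‖θ.2 m‖)]
      field_simp
    rw [e]
    have hp : 0 ≤ S.w n * S.β n * (S.recDiff n m * (‖θ.1 m‖ + ‖θ.2 m‖)) :=
      mul_nonneg (mul_pos (S.w_pos n) (S.β_pos n)).le
        (mul_nonneg (recDiff_nonneg n m) (by positivity))
    calc _ = S.β m * (S.w n * S.β n * (S.recDiff n m * (‖θ.1 m‖ + ‖θ.2 m‖))) := by ring
      _ ≤ _ := mul_le_mul_of_nonneg_right (hB m) hp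
  have h5 : ∑' m, (S.w m * (‖θ.1 m‖ + ‖θ.2 m‖)) ^ 2 ≤ 2 * S.eNormSq θ := by
    rw [eNormSq, ← tsum_mul_left]
    refine Summable.tsum_le_tsum (fun m => ?_) h1
      ((Summable.add (f := fun k => (S.w k * ‖θ.1 k‖) ^ 2) hθ.1 hθ.2).mul_left 2)
    nlinarith [sq_nonneg (S.w m * ‖θ.1 m‖ - S.w m * ‖θ.2 m‖)]
  have h6 : S.w n * (S.β n * S.coupling n θ) ≤ B * (√(S.row n) * √(2 * S.eNormSq θ)) :=
    h4.trans (mul_le_mul_of_nonneg_left (h3.trans (mul_le_mul_of_nonneg_left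
      (Real.sqrt_le_sqrt h5) (Real.sqrt_nonneg _))) hB0)
  have h7 : 0 ≤ S.w n * (S.β n * S.coupling n θ) :=
    mul_nonneg (S.w_pos n).le (mul_nonneg (S.β_pos n).le (coupling_nonneg n θ))
  calc _ ≤ (B * (√(S.row n) * √(2 * S.eNormSq θ))) ^ 2 := pow_le_pow_left₀ h7 h6 2
    _ = B ^ 2 * (√(S.row n) ^ 2 * √(2 * S.eNormSq θ) ^ 2) := by ring
    _ = _ := by
      rw [Real.sq_sqrt (row_nonneg n), Real.sq_sqrt (by linarith [eNormSq_nonneg (S := S) θ])]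
      ring

theorem IsPair.sub_eq {n : ι} {d : ℂ} (h : S.IsPair n d) :
    3 / 2 * S.β n ≤ ‖d - -(starRingEnd ℂ) d‖ ∧ d - -(starRingEnd ℂ) d ≠ 0 := by
  have e : d - -(starRingEnd ℂ) d = ((2 * d.re : ℝ) : ℂ) := by
    rw [sub_neg_eq_add, Complex.add_conj]
  have hβ := S.β_pos n
  have hre := h.le_re
  rw [e, Complex.norm_real, Real.norm_of_nonneg (by linarith)]
  exact ⟨by linarith, Complex.ofReal_ne_zero.2 (by nlinarith)⟩

theorem hatQ_smul (n : ι) (d c : ℂ) (θ : (ι → ℂ) × (ι → ℂ)) :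
    S.hatQ n d (c • θ) = c * S.hatQ n d θ := by
  simp only [hatQ, eigFun, bil_smul]; ring

theorem hatZ_smul (n : ι) (d c : ℂ) (θ : (ι → ℂ) × (ι → ℂ)) :
    S.hatZ n d (c • θ) = c * S.hatZ n d θ := by
  simp only [hatZ, hatQ_smul, eigFun, bil_smul]; ring

variable [Nonempty ι]

theorem eigFun_add (n : ι) (d : ℂ) {θ η : (ι → ℂ) × (ι → ℂ)} (hθ : θ ∈ S.E) (hη : η ∈ S.E) :
    S.eigFun n d (θ + η) = S.eigFun n d θ + S.eigFun n d η := by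
  rw [eigFun, bil_add (S.phi_mem_G _) hθ hη, mul_add]; rfl

theorem hatQ_add (n : ι) (d : ℂ) {θ η : (ι → ℂ) × (ι → ℂ)} (hθ : θ ∈ S.E) (hη : η ∈ S.E) :
    S.hatQ n d (θ + η) = S.hatQ n d θ + S.hatQ n d η := by
  simp only [hatQ, eigFun_add _ _ hθ hη]; ring

theorem hatZ_add (n : ι) (d : ℂ) {θ η : (ι → ℂ) × (ι → ℂ)} (hθ : θ ∈ S.E) (hη : η ∈ S.E) :
    S.hatZ n d (θ + η) = S.hatZ n d θ + S.hatZ n d η := by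
  simp only [hatZ, eigFun_add _ _ hθ hη, hatQ_add _ _ hθ hη]; ring

/-- In the difference quotient `z_n` cancels and `q_n` has coefficient one. The off-diagonal
difference carries the factor `‖d - e‖`, which absorbs the small denominator. -/
theorem IsPair.norm_hatQ_sub_le {n : ι} {d : ℂ} (h : S.IsPair n d) {θ : (ι → ℂ) × (ι → ℂ)}
    (hθ : θ ∈ S.E) :
    ‖S.hatQ n d θ - θ.2 n‖ ≤ (9 / S.gap + 29 / S.gap ^ 2) * (S.β n * S.coupling n θ) := by
  have hr' := h.root.neg_conj
  obtain ⟨-, hne⟩ := h.sub_eq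
  have h1 := h.root.norm_off_sub_le h.good hr' hθ
  have e : (S.hatQ n d θ - θ.2 n) * (d - -(starRingEnd ℂ) d)
      = d ^ 2 / S.β n * bil (S.offPhi n (S.sp n d)) θ
        - (-(starRingEnd ℂ) d) ^ 2 / S.β n
          * bil (S.offPhi n (S.sp n (-(starRingEnd ℂ) d))) θ := by
    rw [hatQ, sub_mul, div_mul_cancel₀ _ hne, eigFun_eq h.good h.root hθ,
      eigFun_eq h.good hr' hθ]
    ring
  rw [← e, norm_mul] at h1
  refine le_of_mul_le_mul_right (h1.trans (le_of_eq ?_)) (norm_pos_iff.2 hne)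
  ring

variable (S) in
/-- The constant of the off-diagonal bounds. -/
def offConst : ℝ := (4 + 7 / S.gap) + (1 + S.gap) * (9 / S.gap + 29 / S.gap ^ 2)

theorem IsPair.norm_hat_sub_le {n : ι} {d : ℂ} (h : S.IsPair n d) {θ : (ι → ℂ) × (ι → ℂ)}
    (hθ : θ ∈ S.E) :
    ‖S.hatZ n d θ - θ.1 n‖ ≤ S.offConst * (S.β n * S.coupling n θ) ∧
    ‖S.hatQ n d θ - θ.2 n‖ ≤ S.offConst * (S.β n * S.coupling n θ) := by
  have hg := S.gap_pos
  have ho : 0 ≤ S.β n * S.coupling n θ := mul_nonneg (S.β_pos n).le (coupling_nonneg n θ)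
  have h1 := h.norm_hatQ_sub_le hθ
  set c := 9 / S.gap + 29 / S.gap ^ 2 with hc
  have hc0 : 0 ≤ c := by positivity
  have h7 : 0 ≤ 7 / S.gap := by positivity
  constructor
  · have e : S.hatZ n d θ - θ.1 n = d ^ 2 / S.β n * bil (S.offPhi n (S.sp n d)) θ
        - d * (S.hatQ n d θ - θ.2 n) := by
      rw [hatZ, eigFun_eq h.good h.root hθ]; ring
    rw [e]
    refine (norm_sub_le _ _).trans ?_
    rw [norm_mul d]
    have hd : ‖d‖ ≤ S.gap := h.root.1.trans (by linarith [h.good.1])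
    calc _ ≤ (4 + 7 / S.gap) * S.β n * S.coupling n θ + S.gap * (c * (S.β n * S.coupling n θ)) := by
          gcongr
          exact h.root.norm_off_le h.good hθ
      _ = ((4 + 7 / S.gap) + S.gap * c) * (S.β n * S.coupling n θ) := by ring
      _ ≤ _ := by
          rw [offConst, ← hc]
          gcongr
          linarith
  · refine h1.trans ?_
    rw [offConst, ← hc]
    gcongr
    nlinarith

end ModalSystem

/-! ### Decomposition modulo a finite-dimensional kernel. -/

namespace ModalSystem

variable {ι : Type*} (S : ModalSystem ι)

/-- The pair of coordinates of a state given by an element of the unweighted space. -/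
def raw (y : lp (fun _ : ι => ℂ × ℂ) 2) : (ι → ℂ) × (ι → ℂ) :=
  (fun k => (y k).1 / S.w k, fun k => (y k).2 / S.w k)

/-- The spectral parameters of the modes outside `Low`. -/
def specSet (Low : Finset ι) (d : ι → ℂ) : Set ℂ :=
  {s | ∃ n ∉ Low, s = S.sp n (d n) ∨ s = S.sp n (-(starRingEnd ℂ) (d n))}

variable {S}

theorem lp_two_summable {F : Type*} [NormedAddCommGroup F] (y : lp (fun _ : ι => F) 2) :
    Summable fun k => ‖y k‖ ^ 2 := by
  have := (lp.memℓp y).summable (by norm_num)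
  simpa using this

theorem lp_two_norm_sq {F : Type*} [NormedAddCommGroup F] (y : lp (fun _ : ι => F) 2) :
    ‖y‖ ^ 2 = ∑' k, ‖y k‖ ^ 2 := by
  have := lp.norm_rpow_eq_tsum (p := 2) (by norm_num) y
  simpa using this

theorem w_mul_norm_div (k : ι) (c : ℂ) : S.w k * ‖c / S.w k‖ = ‖c‖ := by
  rw [norm_div, Complex.norm_real, Real.norm_of_nonneg (S.w_pos k).le,
    mul_div_cancel₀ _ (S.w_pos k).ne']

theorem raw_mem (y : lp (fun _ : ι => ℂ × ℂ) 2) : S.raw y ∈ S.E := by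
  constructor <;>
  · refine Summable.of_nonneg_of_le (fun _ => sq_nonneg _) (fun k => ?_) (lp_two_summable y)
    simp only [raw, w_mul_norm_div]
    gcongr
    first | exact norm_fst_le _ | exact norm_snd_le _

theorem eNormSq_raw_le (y : lp (fun _ : ι => ℂ × ℂ) 2) : S.eNormSq (S.raw y) ≤ 2 * ‖y‖ ^ 2 := by
  rw [lp_two_norm_sq, eNormSq, ← tsum_mul_left]
  refine Summable.tsum_le_tsum (fun k => ?_) (Summable.add (raw_mem y).1 (raw_mem y).2)
    ((lp_two_summable y).mul_left 2)
  simp only [raw, w_mul_norm_div]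
  have h1 := pow_le_pow_left₀ (norm_nonneg _) (norm_fst_le (y k)) 2
  have h2 := pow_le_pow_left₀ (norm_nonneg _) (norm_snd_le (y k)) 2
  linarith

theorem raw_add (x y : lp (fun _ : ι => ℂ × ℂ) 2) : S.raw (x + y) = S.raw x + S.raw y :=
  Prod.ext (funext fun _ => add_div _ _ _) (funext fun _ => add_div _ _ _)

theorem raw_sub (x y : lp (fun _ : ι => ℂ × ℂ) 2) : S.raw (x - y) = S.raw x - S.raw y :=
  Prod.ext (funext fun _ => sub_div _ _ _) (funext fun _ => sub_div _ _ _)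

theorem raw_smul (c : ℂ) (y : lp (fun _ : ι => ℂ × ℂ) 2) : S.raw (c • y) = c • S.raw y :=
  Prod.ext (funext fun _ => mul_div_assoc _ _ _) (funext fun _ => mul_div_assoc _ _ _)

theorem exists_raw_eq {θ : (ι → ℂ) × (ι → ℂ)} (hθ : θ ∈ S.E) :
    ∃ y : lp (fun _ : ι => ℂ × ℂ) 2, S.raw y = θ := by
  refine ⟨⟨fun k => (S.w k * θ.1 k, S.w k * θ.2 k), memℓp_gen ?_⟩, ?_⟩
  · have h2 : (2 : ℝ≥0∞).toReal = (2 : ℕ) := by norm_num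
    simp only [h2, Real.rpow_natCast]
    refine Summable.of_nonneg_of_le (fun _ => sq_nonneg _) (fun k => ?_)
      (Summable.add hθ.1 hθ.2)
    rw [Prod.norm_def, norm_mul, norm_mul, Complex.norm_real, Real.norm_of_nonneg (S.w_pos k).le]
    rcases max_choice (S.w k * ‖θ.1 k‖) (S.w k * ‖θ.2 k‖) with h | h <;>
    · simp only [h]
      nlinarith [sq_nonneg (S.w k * ‖θ.1 k‖), sq_nonneg (S.w k * ‖θ.2 k‖)]
  · have hw : ∀ k, (S.w k : ℂ) ≠ 0 := fun k => Complex.ofReal_ne_zero.2 (S.w_pos k).ne'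
    exact Prod.ext (funext fun k => mul_div_cancel_left₀ _ (hw k))
      (funext fun k => mul_div_cancel_left₀ _ (hw k))

theorem exists_isPair : ∃ d : ι → ℂ, ∀ n, S.IsGood n → S.IsPair n (d n) := by
  classical
  have : ∀ n, ∃ d : ℂ, S.IsGood n → S.IsPair n d := fun n => by
    by_cases hn : S.IsGood n
    · obtain ⟨d, hd, hre⟩ := exists_isRoot hn
      exact ⟨d, fun _ => ⟨hn, hd, hre⟩⟩
    · exact ⟨0, fun h => absurd h hn⟩
  choose d hd using this
  exact ⟨d, hd⟩

theorem exists_low {ε : ℝ} (hε : 0 < ε) : ∃ Low : Finset ι, (∀ n ∉ Low, S.IsGood n) ∧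
    ∑' n, ((Low : Set ι)ᶜ).indicator S.row n ≤ ε := by
  classical
  have h1 : {n | ¬ S.IsGood n}.Finite := eventually_isGood (S := S)
  have h2 := (tendsto_tsum_compl_atTop_zero S.row).eventually (ge_mem_nhds hε)
  obtain ⟨s, hs⟩ := Filter.eventually_atTop.1 h2
  refine ⟨s ∪ h1.toFinset, fun n hn => ?_, ?_⟩
  · by_contra hg
    exact hn (Finset.mem_union_right _ (h1.mem_toFinset.2 hg))
  · have := hs (s ∪ h1.toFinset) Finset.subset_union_left
    rwa [← tsum_subtype]

theorem IsPair.isSpec [Nonempty ι] {Low : Finset ι} {d : ι → ℂ}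
    (hd : ∀ n ∉ Low, S.IsPair n (d n)) : S.IsSpec (S.specSet Low d) := by
  have key : ∀ s ∈ S.specSet Low d, ∃ n e, S.IsGood n ∧ S.IsRoot n e ∧ e.re ≠ 0 ∧ s = S.sp n e := by
    rintro s ⟨n, hn, rfl | rfl⟩
    · have h := hd n hn
      exact ⟨n, _, h.good, h.root, by linarith [h.le_re, S.β_pos n], rfl⟩
    · have h := hd n hn
      exact ⟨n, _, h.good, h.root.neg_conj, by simpa using by linarith [h.le_re, S.β_pos n], rfl⟩
  constructor
  · intro s hs
    obtain ⟨n, e, _, _, h3, rfl⟩ := key s hs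
    rwa [sp_re]
  · intro s hs
    obtain ⟨n, e, h1, h2, _, rfl⟩ := key s hs
    exact h2.h_eq_zero h1
  · intro s hs
    obtain ⟨n, e, h1, h2, _, rfl⟩ := key s hs
    exact h2.bil_ne_zero h1

theorem IsPair.eigFun_eq_zero [Nonempty ι] {n : ι} {d : ℂ} (h : S.IsPair n d)
    {θ : (ι → ℂ) × (ι → ℂ)} (hZ : S.hatZ n d θ = 0) (hQ : S.hatQ n d θ = 0) :
    bil (S.phi (S.sp n d)) θ = 0 ∧ bil (S.phi (S.sp n (-(starRingEnd ℂ) d))) θ = 0 := by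
  have h1 : S.eigFun n d θ = 0 := by
    rw [hatZ, hQ, mul_zero, sub_zero] at hZ; exact hZ
  have h2 : S.eigFun n (-(starRingEnd ℂ) d) θ = 0 := by
    rw [hatQ, h1, zero_sub, div_eq_zero_iff] at hQ
    exact neg_eq_zero.1 (hQ.resolve_right h.sub_eq.2)
  exact ⟨(eigFun_eq_zero_iff h.root).1 h1, (eigFun_eq_zero_iff h.root.neg_conj).1 h2⟩

theorem IsPair.hat_eq_zero {n : ι} {d : ℂ}
    {θ : (ι → ℂ) × (ι → ℂ)} (h1 : bil (S.phi (S.sp n d)) θ = 0)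
    (h2 : bil (S.phi (S.sp n (-(starRingEnd ℂ) d))) θ = 0) :
    S.hatZ n d θ = 0 ∧ S.hatQ n d θ = 0 := by
  have hQ : S.hatQ n d θ = 0 := by simp [hatQ, eigFun, h1, h2]
  exact ⟨by simp [hatZ, hQ, eigFun, h1], hQ⟩

/-- Recovering `q` divides by `2 Re d ≥ 3β_n/2`. This is why the hypotheses have `β_n * x` on the
right, and it costs one power of `β`. -/
theorem IsPair.norm_hat_le {n : ι} {d : ℂ} (h : S.IsPair n d) {θ : (ι → ℂ) × (ι → ℂ)} {x : ℝ}
    (h1 : S.w n * ‖S.eigFun n d θ‖ ≤ S.β n * x)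
    (h2 : S.w n * ‖S.eigFun n (-(starRingEnd ℂ) d) θ‖ ≤ S.β n * x) :
    S.w n * ‖S.hatZ n d θ‖ ≤ (2 + S.gap) * x ∧ S.w n * ‖S.hatQ n d θ‖ ≤ (2 + S.gap) * x := by
  have hβ := S.β_pos n
  have hw := S.w_pos n
  have hg := S.gap_pos
  have hx : 0 ≤ x := by
    by_contra hx
    have : 0 ≤ S.w n * ‖S.eigFun n d θ‖ := by positivity
    nlinarith
  obtain ⟨h3, h4⟩ := h.sub_eq
  have hQ : S.w n * ‖S.hatQ n d θ‖ ≤ 2 * x := by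
    rw [hatQ, norm_div, ← mul_div_assoc, div_le_iff₀ (norm_pos_iff.2 h4)]
    calc S.w n * ‖S.eigFun n d θ - S.eigFun n (-(starRingEnd ℂ) d) θ‖
        ≤ S.w n * (‖S.eigFun n d θ‖ + ‖S.eigFun n (-(starRingEnd ℂ) d) θ‖) := by
          gcongr; exact norm_sub_le _ _
      _ ≤ 2 * (S.β n * x) := by linarith
      _ ≤ 2 * x * (3 / 2 * S.β n) := by nlinarith [mul_nonneg hx hβ.le]
      _ ≤ _ := by gcongr
  constructor
  · have hd : ‖d‖ ≤ 5 / 16 * S.gap := h.root.1.trans (by linarith [h.good.1])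
    calc S.w n * ‖S.hatZ n d θ‖
        ≤ S.w n * (‖S.eigFun n d θ‖ + ‖d‖ * ‖S.hatQ n d θ‖) := by
          gcongr
          rw [hatZ, ← norm_mul]
          exact norm_sub_le _ _
      _ = S.w n * ‖S.eigFun n d θ‖ + ‖d‖ * (S.w n * ‖S.hatQ n d θ‖) := by ring
      _ ≤ S.gap / 4 * x + 5 / 16 * S.gap * (2 * x) := by
          refine add_le_add (h1.trans (mul_le_mul_of_nonneg_right h.good.1 hx)) ?_
          gcongr
      _ ≤ _ := by nlinarith [mul_nonneg hg.le hx]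
  · nlinarith [mul_nonneg hg.le hx]

theorem norm_prod_sq_le {a b : ℂ} {M : ℝ} (ha : ‖a‖ ^ 2 ≤ M) (hb : ‖b‖ ^ 2 ≤ M) :
    ‖(a, b)‖ ^ 2 ≤ M := by
  rw [Prod.norm_def]
  rcases max_choice ‖a‖ ‖b‖ with h | h <;> simp only [h] <;> assumption

/-- The states are controlled, up to the kernel of the eigenfunctionals, which is
finite-dimensional, by the values of the eigenfunctionals. -/
theorem exists_decomposition [Nonempty ι] : ∃ (Low : Finset ι) (d : ι → ℂ),
    (∀ n ∉ Low, S.IsPair n (d n)) ∧ FiniteDimensional ℂ (S.kerSpec (S.specSet Low d)) ∧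
    ∃ C, 0 ≤ C ∧ ∀ θ ∈ S.E, ∀ x : ι → ℝ, SqSummable x →
      (∀ n ∉ Low, S.w n * ‖S.eigFun n (d n) θ‖ ≤ S.β n * x n ∧
        S.w n * ‖S.eigFun n (-(starRingEnd ℂ) (d n)) θ‖ ≤ S.β n * x n) →
      ∃ ζ ∈ S.kerSpec (S.specSet Low d), S.eNormSq (θ - ζ) ≤ C * ∑' n, x n ^ 2 := by
  classical
  obtain ⟨B, hB0, hB⟩ := coupling_le (S := S)
  obtain ⟨d, hd⟩ := exists_isPair (S := S)
  set c : ℝ := 2 * S.offConst ^ 2 * B with hc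
  have hc0 : 0 ≤ c := by positivity
  -- This tolerance makes the sum of the row bounds `c * row` at most `c/(4(c+1)) ≤ 1/4`, as the
  -- Neumann series requires.
  obtain ⟨Low, hLow, hsum⟩ := exists_low (S := S) (ε := 1 / (4 * (c + 1))) (by positivity)
  have hpair : ∀ n ∉ Low, S.IsPair n (d n) := fun n hn => hd n (hLow n hn)
  -- `K` is the passage to hat coordinates minus the identity, in weighted coordinates. It is zero
  -- on `Low`, where the original coordinates are kept.
  let K : ι → lp (fun _ : ι => ℂ × ℂ) 2 →ₗ[ℂ] ℂ × ℂ := fun n =>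
    if n ∈ Low then 0 else
    { toFun := fun y => (S.w n * (S.hatZ n (d n) (S.raw y) - (S.raw y).1 n),
        S.w n * (S.hatQ n (d n) (S.raw y) - (S.raw y).2 n))
      map_add' := fun x y => by
        simp only [raw_add, hatZ_add _ _ (raw_mem x) (raw_mem y),
          hatQ_add _ _ (raw_mem x) (raw_mem y), Prod.fst_add, Prod.snd_add, Pi.add_apply,
          Prod.mk_add_mk]
        ext <;> ring
      map_smul' := fun a y => by
        simp only [raw_smul, hatZ_smul, hatQ_smul, Prod.smul_fst, Prod.smul_snd, Pi.smul_apply,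
          smul_eq_mul, RingHom.id_apply, Prod.smul_mk]
        ext <;> ring }
  have hKval : ∀ n ∉ Low, ∀ y, y n + K n y
      = (S.w n * S.hatZ n (d n) (S.raw y), S.w n * S.hatQ n (d n) (S.raw y)) := by
    intro n hn y
    have hw : (S.w n : ℂ) ≠ 0 := Complex.ofReal_ne_zero.2 (S.w_pos n).ne'
    simp only [K, if_neg hn, LinearMap.coe_mk, AddHom.coe_mk, raw]
    ext
    · simp only [Prod.fst_add]; field_simp; ring
    · simp only [Prod.snd_add]; field_simp; ring
  have hKlow : ∀ n ∈ Low, ∀ y, K n y = 0 := fun n hn y => by simp [K, if_pos hn]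
  have hKb : ∀ n y, ‖K n y‖ ^ 2 ≤ (c * ((Low : Set ι)ᶜ).indicator S.row n) * ‖y‖ ^ 2 := by
    intro n y
    by_cases hn : n ∈ Low
    · rw [hKlow n hn, norm_zero, Set.indicator_of_notMem (by simpa using hn)]; norm_num
    · rw [Set.indicator_of_mem (by simpa using hn)]
      simp only [K, if_neg hn, LinearMap.coe_mk, AddHom.coe_mk]
      obtain ⟨h1, h2⟩ := (hpair n hn).norm_hat_sub_le (raw_mem y)
      have h3 := hB n _ (raw_mem y)
      have h4 := eNormSq_raw_le (S := S) y
      have hw := S.w_pos n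
      have ho : 0 ≤ S.β n * S.coupling n (S.raw y) :=
        mul_nonneg (S.β_pos n).le (coupling_nonneg n _)
      have key : ∀ t : ℂ, ‖t‖ ≤ S.offConst * (S.β n * S.coupling n (S.raw y)) →
          ‖S.w n * t‖ ^ 2 ≤ c * S.row n * ‖y‖ ^ 2 := fun t ht => by
        rw [norm_mul, Complex.norm_real, Real.norm_of_nonneg hw.le]
        calc (S.w n * ‖t‖) ^ 2 ≤ (S.w n * (S.offConst * (S.β n * S.coupling n (S.raw y)))) ^ 2 := by
              gcongr
          _ = S.offConst ^ 2 * (S.w n * (S.β n * S.coupling n (S.raw y))) ^ 2 := by ring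
          _ ≤ S.offConst ^ 2 * (B * S.row n * (2 * ‖y‖ ^ 2)) := by
              gcongr
              exact h3.trans (mul_le_mul_of_nonneg_left h4 (mul_nonneg hB0 (row_nonneg n)))
          _ = _ := by rw [hc]; ring
      exact norm_prod_sq_le (key _ h1) (key _ h2)
  have hsm : Summable fun n => c * ((Low : Set ι)ᶜ).indicator S.row n :=
    (summable_row.indicator _).mul_left c
  have hs4 : ∑' n, c * ((Low : Set ι)ᶜ).indicator S.row n ≤ 1 / 4 := by
    rw [tsum_mul_left]
    refine (mul_le_mul_of_nonneg_left hsum hc0).trans ?_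
    rw [mul_one_div, div_le_div_iff₀ (by positivity) (by norm_num)]
    linarith
  obtain ⟨hsolve, hbound⟩ := lp_neumann K hsm hKb hs4
  refine ⟨Low, d, hpair, ?_, 8 * (2 + S.gap) ^ 2, by positivity, ?_⟩
  -- A kernel element has vanishing hat coordinates outside `Low`. If its coordinates in `Low`
  -- vanish as well, then `(1 + K)y = 0`, so `y = 0`.
  · let ev : S.kerSpec (S.specSet Low d) →ₗ[ℂ] (Low → ℂ × ℂ) :=
      { toFun := fun ζ n => (ζ.1.1 n, ζ.1.2 n)
        map_add' := fun _ _ => rfl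
        map_smul' := fun _ _ => rfl }
    refine FiniteDimensional.of_injective ev ?_
    rw [← LinearMap.ker_eq_bot, LinearMap.ker_eq_bot']
    intro ζ hζ
    obtain ⟨y, hy⟩ := exists_raw_eq ζ.2.1
    have h0 : ∀ n, y n + K n y = (0 : lp (fun _ : ι => ℂ × ℂ) 2) n := by
      intro n
      by_cases hn : n ∈ Low
      · have h1 : ((S.raw y).1 n, (S.raw y).2 n) = 0 := by
          rw [hy]; exact congrFun hζ ⟨n, hn⟩
        have hw : (S.w n : ℂ) ≠ 0 := Complex.ofReal_ne_zero.2 (S.w_pos n).ne'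
        simp only [raw, Prod.mk_eq_zero, div_eq_zero_iff, hw, or_false] at h1
        rw [hKlow n hn, add_zero]
        exact Prod.ext h1.1 h1.2
      · rw [hKval n hn, hy]
        obtain ⟨h1, h2⟩ := IsPair.hat_eq_zero (S := S) (n := n) (d := d n)
          (ζ.2.2 _ ⟨n, hn, Or.inl rfl⟩) (ζ.2.2 _ ⟨n, hn, Or.inr rfl⟩)
        rw [h1, h2, mul_zero]; rfl
    have h1 := hbound y 0 h0
    rw [norm_zero, mul_zero] at h1
    have h2 : y = 0 := norm_le_zero_iff.1 h1
    refine Subtype.ext ?_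
    rw [← hy, h2]
    exact Prod.ext (funext fun k => zero_div _) (funext fun k => zero_div _)
  · intro θ hθ x hx hbd
    obtain ⟨y, rfl⟩ := exists_raw_eq hθ
    have hx0 : ∀ n ∉ Low, ‖(S.w n * S.hatZ n (d n) (S.raw y), S.w n * S.hatQ n (d n) (S.raw y))‖ ^ 2
        ≤ (2 + S.gap) ^ 2 * x n ^ 2 := by
      intro n hn
      obtain ⟨h1, h2⟩ := (hpair n hn).norm_hat_le (hbd n hn).1 (hbd n hn).2
      have hw := S.w_pos n
      rw [← mul_pow]
      refine norm_prod_sq_le ?_ ?_ <;>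
      · rw [norm_mul, Complex.norm_real, Real.norm_of_nonneg hw.le]
        gcongr
    -- The state `y₁` solved from `u₀` has the same hat coordinates as `y` outside `Low` and zero
    -- coordinates in `Low`. Thus `y - y₁` lies in the kernel and `y₁` is bounded by the
    -- eigenfunctionals.
    let u₀ : ι → ℂ × ℂ := fun n => if n ∈ Low then 0 else
      (S.w n * S.hatZ n (d n) (S.raw y), S.w n * S.hatQ n (d n) (S.raw y))
    have hu₀ : ∀ n, ‖u₀ n‖ ^ 2 ≤ (2 + S.gap) ^ 2 * x n ^ 2 := by
      intro n
      by_cases hn : n ∈ Low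
      · simp only [u₀, if_pos hn, norm_zero, zero_pow two_ne_zero]; positivity
      · simp only [u₀, if_neg hn]; exact hx0 n hn
    have hus : Summable fun n => ‖u₀ n‖ ^ 2 :=
      Summable.of_nonneg_of_le (fun _ => sq_nonneg _) hu₀ (Summable.mul_left _ hx)
    let u : lp (fun _ : ι => ℂ × ℂ) 2 := ⟨u₀, memℓp_gen (by simpa using hus)⟩
    have hun : ‖u‖ ^ 2 ≤ (2 + S.gap) ^ 2 * ∑' n, x n ^ 2 := by
      rw [lp_two_norm_sq, ← tsum_mul_left]
      exact hus.tsum_le_tsum hu₀ (Summable.mul_left _ hx)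
    obtain ⟨y₁, hy₁⟩ := hsolve u
    refine ⟨S.raw (y - y₁), ⟨raw_mem _, ?_⟩, ?_⟩
    · have hzero : ∀ n ∉ Low, S.hatZ n (d n) (S.raw (y - y₁)) = 0 ∧
          S.hatQ n (d n) (S.raw (y - y₁)) = 0 := by
        intro n hn
        have hw : (S.w n : ℂ) ≠ 0 := Complex.ofReal_ne_zero.2 (S.w_pos n).ne'
        have h1 : (y - y₁) n + K n (y - y₁) = 0 := by
          have h2 : y n + K n y = u n := by
            rw [hKval n hn]
            change _ = u₀ n
            simp only [u₀, if_neg hn]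
          have h3 : (y - y₁) n = y n - y₁ n := rfl
          rw [h3, map_sub, sub_add_sub_comm, h2, hy₁, sub_self]
        rw [hKval n hn, Prod.mk_eq_zero] at h1
        exact ⟨(mul_eq_zero.1 h1.1).resolve_left hw, (mul_eq_zero.1 h1.2).resolve_left hw⟩
      rintro s ⟨n, hn, rfl | rfl⟩
      · exact ((hpair n hn).eigFun_eq_zero (hzero n hn).1 (hzero n hn).2).1
      · exact ((hpair n hn).eigFun_eq_zero (hzero n hn).1 (hzero n hn).2).2
    · rw [raw_sub, sub_sub_cancel]
      have h1 := hbound y₁ u hy₁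
      calc S.eNormSq (S.raw y₁) ≤ 2 * ‖y₁‖ ^ 2 := eNormSq_raw_le y₁
        _ ≤ 2 * (2 * ‖u‖) ^ 2 := by gcongr
        _ = 8 * ‖u‖ ^ 2 := by ring
        _ ≤ 8 * ((2 + S.gap) ^ 2 * ∑' n, x n ^ 2) := by gcongr
        _ = _ := by ring

end ModalSystem

/-! ### Scalar equations with exponential layers at both ends. -/

/-- Pairing `v` with the fixed vector `v t` reduces the estimate to monotonicity of a real function.
-/
theorem norm_le_add_sub_of_norm_deriv_le {v v' : ℝ → ℂ} {B B' : ℝ → ℝ} {T : ℝ}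
    (hv : ContinuousOn v (Set.Icc 0 T)) (hB : ContinuousOn B (Set.Icc 0 T))
    (hv' : ∀ t ∈ Set.Ioo 0 T, HasDerivAt v (v' t) t)
    (hB' : ∀ t ∈ Set.Ioo 0 T, HasDerivAt B (B' t) t)
    (h : ∀ t ∈ Set.Ioo 0 T, ‖v' t‖ ≤ B' t) {t : ℝ} (ht : t ∈ Set.Icc 0 T) :
    ‖v t‖ ≤ ‖v 0‖ + (B t - B 0) := by
  have h0 : (0 : ℝ) ∈ Set.Icc 0 T := ⟨le_rfl, ht.1.trans ht.2⟩
  set c := (starRingEnd ℂ) (v t) with hc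
  have hmono : MonotoneOn (fun τ => ‖v t‖ * B τ - (c * v τ).re) (Set.Icc 0 T) := by
    refine monotoneOn_of_hasDerivWithinAt_nonneg (convex_Icc 0 T)
      (f' := fun τ => ‖v t‖ * B' τ - (c * v' τ).re) ?_ ?_ ?_
    · exact (continuousOn_const.mul hB).sub
        (Complex.continuous_re.comp_continuousOn (continuousOn_const.mul hv))
    · intro τ hτ
      rw [interior_Icc] at hτ ⊢
      have h1 : HasDerivAt (fun τ => (c * v τ).re) (c * v' τ).re τ :=
        (Complex.reCLM.hasFDerivAt.comp_hasDerivAt τ ((hv' τ hτ).const_mul c))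
      exact (((hB' τ hτ).const_mul _).sub h1).hasDerivWithinAt
    · intro τ hτ
      rw [interior_Icc] at hτ
      have h1 := Complex.re_le_norm (c * v' τ)
      rw [norm_mul, hc, Complex.norm_conj] at h1
      nlinarith [mul_le_mul_of_nonneg_left (h τ hτ) (norm_nonneg (v t))]
  have h1 := hmono h0 ht ht.1
  simp only at h1
  have h2 : (c * v t).re = ‖v t‖ ^ 2 := by
    rw [hc, mul_comm, Complex.mul_conj, Complex.normSq_eq_norm_sq, Complex.ofReal_re]
  have h3 := Complex.re_le_norm (c * v 0)
  rw [norm_mul, hc, Complex.norm_conj] at h3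
  rw [h2] at h1
  -- The factor `‖v t‖` can be cancelled only if it is nonzero; otherwise monotonicity of `B`
  -- suffices.
  rcases (norm_nonneg (v t)).eq_or_lt with h4 | h4
  · have h5 : MonotoneOn B (Set.Icc 0 T) := by
      refine monotoneOn_of_hasDerivWithinAt_nonneg (convex_Icc 0 T) (f' := B') hB ?_ ?_
      · intro τ hτ
        rw [interior_Icc] at hτ ⊢
        exact (hB' τ hτ).hasDerivWithinAt
      · intro τ hτ
        rw [interior_Icc] at hτ
        exact (norm_nonneg _).trans (h τ hτ)
    rw [← h4]
    linarith [h5 h0 ht ht.1, norm_nonneg (v 0)]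
  · refine le_of_mul_le_mul_left ?_ h4
    nlinarith

/-- Decay of a stable scalar mode forced by exponential layers at both ends. -/
theorem scalar_stable {u g : ℝ → ℂ} {s : ℂ} {r c A B T : ℝ} (hr : 0 < r) (hs : s.re = -r)
    (hc : 0 < c) (hcr : c ≤ r / 2) (hA : 0 ≤ A) (hB : 0 ≤ B)
    (hu : ContinuousOn u (Set.Icc 0 T))
    (hu' : ∀ t ∈ Set.Ioo 0 T, HasDerivAt u (s * u t + g t) t)
    (hg : ∀ t ∈ Set.Icc 0 T, ‖g t‖ ≤ A * Real.exp (-c * t) + B * Real.exp (-c * (T - t)))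
    {t : ℝ} (ht : t ∈ Set.Icc 0 T) :
    ‖u t‖ ≤ Real.exp (-r * t) * ‖u 0‖
      + 2 / r * (A * Real.exp (-c * t) + B * Real.exp (-c * (T - t))) := by
  have hexp : ∀ τ : ℝ, ‖Complex.exp (-s * τ)‖ = Real.exp (r * τ) := fun τ => by
    rw [Complex.norm_exp]
    congr 1
    simp [hs]
  have key := norm_le_add_sub_of_norm_deriv_le
    (v := fun τ => Complex.exp (-s * τ) * u τ) (v' := fun τ => Complex.exp (-s * τ) * g τ)
    -- Because `c ≤ r/2`, both `r - c` and `r + c` are at least `r/2`, so the prefactor `2/r` makes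
    -- the derivative dominate the integrated forcing.
    (B := fun τ => 2 / r * (A * Real.exp ((r - c) * τ) + B * Real.exp (-c * T + (r + c) * τ)))
    (B' := fun τ => 2 / r * (A * (Real.exp ((r - c) * τ) * (r - c))
      + B * (Real.exp (-c * T + (r + c) * τ) * (r + c)))) ?_ ?_ ?_ ?_ ?_ ht
  · have e0 : ‖Complex.exp (-s * ((0 : ℝ) : ℂ)) * u 0‖ = ‖u 0‖ := by
      rw [norm_mul, hexp, mul_zero, Real.exp_zero, one_mul]
    have e1 : ‖Complex.exp (-s * t) * u t‖ = Real.exp (r * t) * ‖u t‖ := by rw [norm_mul, hexp]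
    rw [e0, e1] at key
    have h0 : 0 ≤ 2 / r * (A * Real.exp ((r - c) * 0) + B * Real.exp (-c * T + (r + c) * 0)) := by
      positivity
    have h1 : Real.exp (r * t) * ‖u t‖ ≤ ‖u 0‖ + 2 / r * (A * Real.exp ((r - c) * t)
        + B * Real.exp (-c * T + (r + c) * t)) := by linarith
    have h2 := mul_le_mul_of_nonneg_left h1 (Real.exp_pos (-r * t)).le
    rw [← mul_assoc, ← Real.exp_add] at h2
    have e2 : -r * t + r * t = 0 := by ring
    rw [e2, Real.exp_zero, one_mul] at h2
    refine h2.trans (le_of_eq ?_)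
    have e3 : Real.exp (-c * t) = Real.exp (-r * t) * Real.exp ((r - c) * t) := by
      rw [← Real.exp_add]; congr 1; ring
    have e4 : Real.exp (-c * (T - t)) = Real.exp (-r * t) * Real.exp (-c * T + (r + c) * t) := by
      rw [← Real.exp_add]; congr 1; ring
    rw [e3, e4]; ring
  · exact ContinuousOn.mul (by fun_prop) hu
  · fun_prop
  · intro τ hτ
    have h1 : HasDerivAt (fun τ : ℝ => Complex.exp (-s * τ)) (Complex.exp (-s * τ) * (-s * 1)) τ :=
      ((Complex.ofRealCLM.hasDerivAt (x := τ)).const_mul (-s)).cexp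
    refine (h1.mul (hu' τ hτ)).congr_deriv ?_
    ring
  · intro τ _
    have h1 : HasDerivAt (fun τ : ℝ => Real.exp ((r - c) * τ)) (Real.exp ((r - c) * τ) * (r - c)) τ := by
      simpa using ((hasDerivAt_id τ).const_mul (r - c)).exp
    have h2 : HasDerivAt (fun τ : ℝ => Real.exp (-c * T + (r + c) * τ))
        (Real.exp (-c * T + (r + c) * τ) * (r + c)) τ := by
      simpa using (((hasDerivAt_id τ).const_mul (r + c)).const_add (-c * T)).exp
    exact ((h1.const_mul A).add (h2.const_mul B)).const_mul (2 / r)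
  · intro τ hτ
    rw [norm_mul, hexp]
    have h1 := mul_le_mul_of_nonneg_left (hg τ (Set.Ioo_subset_Icc_self hτ)) (Real.exp_pos (r * τ)).le
    refine h1.trans ?_
    have e3 : Real.exp (r * τ) * Real.exp (-c * τ) = Real.exp ((r - c) * τ) := by
      rw [← Real.exp_add]; congr 1; ring
    have e4 : Real.exp (r * τ) * Real.exp (-c * (T - τ)) = Real.exp (-c * T + (r + c) * τ) := by
      rw [← Real.exp_add]; congr 1; ring
    have e5 : Real.exp (r * τ) * (A * Real.exp (-c * τ) + B * Real.exp (-c * (T - τ)))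
        = A * Real.exp ((r - c) * τ) + B * Real.exp (-c * T + (r + c) * τ) := by
      rw [← e3, ← e4]; ring
    rw [e5]
    have e6 : ∀ x y : ℝ, 2 / r * (A * (x * (r - c)) + B * (y * (r + c)))
        = A * x * (2 * (r - c) / r) + B * y * (2 * (r + c) / r) := fun x y => by field_simp
    rw [e6]
    refine add_le_add (le_mul_of_one_le_right (by positivity) ?_)
      (le_mul_of_one_le_right (by positivity) ?_) <;>
    · rw [le_div_iff₀ hr]; linarith

/-- Decay of an unstable scalar mode, read backwards from the right end. -/
theorem scalar_unstable {u g : ℝ → ℂ} {s : ℂ} {r c A B T : ℝ} (hr : 0 < r) (hs : s.re = r)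
    (hc : 0 < c) (hcr : c ≤ r / 2) (hA : 0 ≤ A) (hB : 0 ≤ B)
    (hu : ContinuousOn u (Set.Icc 0 T))
    (hu' : ∀ t ∈ Set.Ioo 0 T, HasDerivAt u (s * u t + g t) t)
    (hg : ∀ t ∈ Set.Icc 0 T, ‖g t‖ ≤ A * Real.exp (-c * t) + B * Real.exp (-c * (T - t)))
    {t : ℝ} (ht : t ∈ Set.Icc 0 T) :
    ‖u t‖ ≤ Real.exp (-r * (T - t)) * ‖u T‖
      + 2 / r * (A * Real.exp (-c * t) + B * Real.exp (-c * (T - t))) := by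
  have hmaps : Set.MapsTo (fun τ => T - τ) (Set.Icc 0 T) (Set.Icc 0 T) := fun τ hτ =>
    ⟨by linarith [hτ.2], by linarith [hτ.1]⟩
  -- Time reversal changes the sign of `s` and exchanges the two layers, hence `B` and `A` trade
  -- places.
  have h := scalar_stable (u := fun τ => u (T - τ)) (g := fun τ => -g (T - τ)) (s := -s)
    (T := T) hr (by simp [hs]) hc hcr hB hA
    (hu.comp (by fun_prop) hmaps)
    (fun τ hτ => by
      have h1 := (hu' (T - τ) ⟨by linarith [hτ.2], by linarith [hτ.1]⟩).comp_const_sub T τ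
      exact h1.congr_deriv (by ring))
    (fun τ hτ => by
      rw [norm_neg]
      refine (hg (T - τ) (hmaps hτ)).trans (le_of_eq ?_)
      rw [sub_sub_cancel, add_comm]) (hmaps ht)
  simp only [sub_sub_cancel, sub_zero] at h
  linarith

theorem tendstoUniformlyOn_of_norm_sub_le {α : Type*} {F : Finset α → ℝ → ℂ} {f : ℝ → ℂ}
    {b : Finset α → ℝ} {U : Set ℝ} (hb : Filter.Tendsto b Filter.atTop (nhds 0))
    (h : ∀ s, ∀ t ∈ U, ‖F s t - f t‖ ≤ b s) : TendstoUniformlyOn F f Filter.atTop U := by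
  rw [Metric.tendstoUniformlyOn_iff]
  intro ε hε
  filter_upwards [hb.eventually (gt_mem_nhds hε)] with s hs t ht
  rw [dist_comm, dist_eq_norm]
  exact (h s t ht).trans_lt hs

/-! ### Evolution of functionals along solutions. -/

namespace ModalSystem

variable {ι : Type*} (S : ModalSystem ι)

/-- The square of the norm of the unweighted space. -/
def xNormSq (θ : (ι → ℂ) × (ι → ℂ)) : ℝ := ∑' k, (‖θ.1 k‖ ^ 2 + ‖θ.2 k‖ ^ 2)

/-- The unweighted space. -/
abbrev X₀ (ι : Type*) : Submodule ℂ ((ι → ℂ) × (ι → ℂ)) := space fun _ => 1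

/-- Solutions of the modal equations on `[0, T]`, bounded in the unweighted space. -/
structure IsSol (T : ℝ) (x : ℝ → (ι → ℂ) × (ι → ℂ)) : Prop where
  cont₁ : ∀ k, ContinuousOn (fun t => (x t).1 k) (Set.Icc 0 T)
  cont₂ : ∀ k, ContinuousOn (fun t => (x t).2 k) (Set.Icc 0 T)
  deriv₁ : ∀ t ∈ Set.Ioo 0 T, ∀ k, HasDerivAt (fun τ => (x τ).1 k)
    (-Complex.I * S.ν k * (x t).1 k + S.β k * ∑' j, S.β j * (x t).2 j) t
  deriv₂ : ∀ t ∈ Set.Ioo 0 T, ∀ k, HasDerivAt (fun τ => (x τ).2 k)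
    (-Complex.I * S.ν k * (x t).2 k + (x t).1 k) t
  mem : ∀ t ∈ Set.Icc 0 T, x t ∈ X₀ ι
  bdd : ∃ M, ∀ t ∈ Set.Icc 0 T, xNormSq (x t) ≤ M

theorem summable_norm_sq {x : ι → ℂ} (hx : WSq (fun _ => 1) x) : Summable fun k => ‖x k‖ ^ 2 := by
  simpa only [one_mul] using (show Summable fun k => (1 * ‖x k‖) ^ 2 from hx)

theorem xNormSq_nonneg (θ : (ι → ℂ) × (ι → ℂ)) : 0 ≤ xNormSq θ :=
  tsum_nonneg fun _ => by positivity

theorem sqSummable_norm_add {θ : (ι → ℂ) × (ι → ℂ)} (hθ : θ ∈ X₀ ι) :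
    SqSummable fun k => ‖θ.1 k‖ + ‖θ.2 k‖ :=
  SqSummable.add (f := fun k => ‖θ.1 k‖) (summable_norm_sq hθ.1) (summable_norm_sq hθ.2)

theorem tsum_norm_add_sq_le {θ : (ι → ℂ) × (ι → ℂ)} (hθ : θ ∈ X₀ ι) :
    ∑' k, (‖θ.1 k‖ + ‖θ.2 k‖) ^ 2 ≤ 2 * xNormSq θ := by
  rw [xNormSq, ← tsum_mul_left]
  refine Summable.tsum_le_tsum (fun m => ?_) (sqSummable_norm_add hθ)
    ((Summable.add (summable_norm_sq hθ.1) (summable_norm_sq hθ.2)).mul_left 2)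
  nlinarith [sq_nonneg (‖θ.1 m‖ - ‖θ.2 m‖)]

/-- The square sum of a functional outside a finite set of modes. -/
def tailSq (φ : (ι → ℂ) × (ι → ℂ)) (s : Finset ι) : ℝ :=
  ∑' k, ((s : Set ι)ᶜ.indicator (fun k => ‖φ.1 k‖ + ‖φ.2 k‖) k) ^ 2

theorem tendsto_tailSq {φ : (ι → ℂ) × (ι → ℂ)} :
    Filter.Tendsto (tailSq φ) Filter.atTop (nhds 0) := by
  have h := tendsto_tsum_compl_atTop_zero fun k => (‖φ.1 k‖ + ‖φ.2 k‖) ^ 2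
  refine h.congr fun s => ?_
  rw [tailSq]
  have e : (fun k => ((s : Set ι)ᶜ.indicator (fun k => ‖φ.1 k‖ + ‖φ.2 k‖) k) ^ 2)
      = (s : Set ι)ᶜ.indicator fun k => (‖φ.1 k‖ + ‖φ.2 k‖) ^ 2 := by
    funext k
    by_cases hk : k ∈ (s : Set ι)ᶜ
    · rw [Set.indicator_of_mem hk, Set.indicator_of_mem hk]
    · rw [Set.indicator_of_notMem hk, Set.indicator_of_notMem hk, zero_pow two_ne_zero]
  rw [e, ← tsum_subtype]
  rfl

theorem summable_bil {φ θ : (ι → ℂ) × (ι → ℂ)} (hφ : φ ∈ X₀ ι) (hθ : θ ∈ X₀ ι) :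
    Summable fun k => φ.1 k * θ.2 k + φ.2 k * θ.1 k := by
  refine Summable.of_norm_bounded
    ((sqSummable_norm_add hφ).mul (sqSummable_norm_add hθ)) fun k => ?_
  refine (norm_add_le _ _).trans ?_
  rw [norm_mul, norm_mul]
  nlinarith [mul_nonneg (norm_nonneg (φ.1 k)) (norm_nonneg (θ.1 k)),
    mul_nonneg (norm_nonneg (φ.2 k)) (norm_nonneg (θ.2 k))]

/-- The error separates into a tail of `φ` and the norm of `θ`, so the convergence is uniform along
a bounded solution. -/
theorem norm_sum_sub_bil_le {φ θ : (ι → ℂ) × (ι → ℂ)} (hφ : φ ∈ X₀ ι) (hθ : θ ∈ X₀ ι)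
    (s : Finset ι) :
    ‖∑ k ∈ s, (φ.1 k * θ.2 k + φ.2 k * θ.1 k) - bil φ θ‖
      ≤ √(tailSq φ s) * √(2 * xNormSq θ) := by
  have hp : SqSummable ((s : Set ι)ᶜ.indicator fun k => ‖φ.1 k‖ + ‖φ.2 k‖) := by
    refine (sqSummable_norm_add hφ).of_le 1 fun k => ?_
    rw [one_mul]
    by_cases hk : k ∈ (s : Set ι)ᶜ
    · rw [Set.indicator_of_mem hk]
    · rw [Set.indicator_of_notMem hk, abs_zero]; exact abs_nonneg _
  have hq := sqSummable_norm_add hθ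
  have h1 := (summable_bil hφ hθ).sum_add_tsum_compl (s := s)
  have e : ∑ k ∈ s, (φ.1 k * θ.2 k + φ.2 k * θ.1 k) - bil φ θ
      = -∑' k, (s : Set ι)ᶜ.indicator (fun k => φ.1 k * θ.2 k + φ.2 k * θ.1 k) k := by
    rw [← tsum_subtype, bil, ← h1]
    ring
  rw [e, norm_neg]
  refine (tsum_of_norm_bounded (hp.mul hq).hasSum fun k => ?_).trans
    ((hp.tsum_mul_le hq).trans ?_)
  · by_cases hk : k ∈ (s : Set ι)ᶜ
    · rw [Set.indicator_of_mem hk, Set.indicator_of_mem hk]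
      refine (norm_add_le _ _).trans ?_
      rw [norm_mul, norm_mul]
      nlinarith [mul_nonneg (norm_nonneg (φ.1 k)) (norm_nonneg (θ.1 k)),
        mul_nonneg (norm_nonneg (φ.2 k)) (norm_nonneg (θ.2 k))]
    · rw [Set.indicator_of_notMem hk, Set.indicator_of_notMem hk, norm_zero, zero_mul]
  · exact mul_le_mul_of_nonneg_left (Real.sqrt_le_sqrt (tsum_norm_add_sq_le hθ))
      (Real.sqrt_nonneg _)

theorem norm_bil_le {φ θ : (ι → ℂ) × (ι → ℂ)} (hφ : φ ∈ X₀ ι) (hθ : θ ∈ X₀ ι) :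
    ‖bil φ θ‖ ≤ √(tailSq φ ∅) * √(2 * xNormSq θ) := by
  have := norm_sum_sub_bil_le hφ hθ ∅
  rwa [Finset.sum_empty, zero_sub, norm_neg] at this

variable {S}

theorem IsSol.exists_bound {T : ℝ} {x : ℝ → (ι → ℂ) × (ι → ℂ)} (hx : S.IsSol T x) :
    ∃ M, 0 ≤ M ∧ ∀ t ∈ Set.Icc 0 T, √(2 * xNormSq (x t)) ≤ M := by
  obtain ⟨M, hM⟩ := hx.bdd
  exact ⟨√(2 * M), Real.sqrt_nonneg _, fun t ht => Real.sqrt_le_sqrt (by linarith [hM t ht])⟩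

theorem tendsto_sqrt_tailSq_mul (φ : (ι → ℂ) × (ι → ℂ)) (M : ℝ) :
    Filter.Tendsto (fun s => √(tailSq φ s) * M) Filter.atTop (nhds 0) := by
  simpa using (tendsto_tailSq (φ := φ)).sqrt.mul_const M

theorem IsSol.tendstoUniformlyOn {T : ℝ} {x : ℝ → (ι → ℂ) × (ι → ℂ)} (hx : S.IsSol T x)
    {φ : (ι → ℂ) × (ι → ℂ)} (hφ : φ ∈ X₀ ι) :
    TendstoUniformlyOn (fun (s : Finset ι) t => ∑ k ∈ s, (φ.1 k * (x t).2 k + φ.2 k * (x t).1 k))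
      (fun t => bil φ (x t)) Filter.atTop (Set.Icc 0 T) := by
  obtain ⟨M, hM0, hM⟩ := hx.exists_bound
  refine tendstoUniformlyOn_of_norm_sub_le (tendsto_sqrt_tailSq_mul φ M) fun s t ht => ?_
  exact (norm_sum_sub_bil_le hφ (hx.mem t ht) s).trans
    (mul_le_mul_of_nonneg_left (hM t ht) (Real.sqrt_nonneg _))

theorem IsSol.continuousOn_bil {T : ℝ} {x : ℝ → (ι → ℂ) × (ι → ℂ)} (hx : S.IsSol T x)
    {φ : (ι → ℂ) × (ι → ℂ)} (hφ : φ ∈ X₀ ι) :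
    ContinuousOn (fun t => bil φ (x t)) (Set.Icc 0 T) := by
  refine (hx.tendstoUniformlyOn hφ).continuousOn (Filter.Frequently.of_forall fun s => ?_)
  exact continuousOn_finsetSum _ fun k _ =>
    (continuousOn_const.mul (hx.cont₂ k)).add (continuousOn_const.mul (hx.cont₁ k))

/-- Along solutions, functionals evolve by the formal generator. -/
theorem IsSol.hasDerivAt_bil {T : ℝ} {x : ℝ → (ι → ℂ) × (ι → ℂ)} (hx : S.IsSol T x)
    {φ φ' : (ι → ℂ) × (ι → ℂ)} (hφ : φ ∈ X₀ ι) (hφ' : φ' ∈ X₀ ι) (h : S.IsGen φ φ')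
    {t : ℝ} (ht : t ∈ Set.Ioo 0 T) :
    HasDerivAt (fun τ => bil φ (x τ)) (bil φ' (x t)) t := by
  obtain ⟨g, hg, h1, h2⟩ := h
  obtain ⟨M, hM0, hM⟩ := hx.exists_bound
  -- Pairing with `ψ` reads off the control `Σ βq` of the solution.
  let ψ : (ι → ℂ) × (ι → ℂ) := (fun k => S.β k, 0)
  have hψ : ψ ∈ X₀ ι := ⟨S.wsq_β, (X₀ ι).zero_mem.2⟩
  have hψx : ∀ τ, bil ψ (x τ) = ∑' j, S.β j * (x τ).2 j := fun τ =>
    tsum_congr fun k => by simp [ψ]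
  let F' : Finset ι → ℝ → ℂ := fun s τ => ∑ k ∈ s,
    (φ.1 k * (-Complex.I * S.ν k * (x τ).2 k + (x τ).1 k)
      + φ.2 k * (-Complex.I * S.ν k * (x τ).1 k + S.β k * ∑' j, S.β j * (x τ).2 j))
  have hF' : ∀ s, ∀ τ ∈ Set.Ioo 0 T, HasDerivAt
      (fun τ => ∑ k ∈ s, (φ.1 k * (x τ).2 k + φ.2 k * (x τ).1 k)) (F' s τ) τ := by
    intro s τ hτ
    exact HasDerivAt.fun_sum fun k _ =>
      ((hx.deriv₂ τ hτ k).const_mul _).add ((hx.deriv₁ τ hτ k).const_mul _)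
  refine hasDerivAt_of_tendstoUniformlyOn (l := Filter.atTop) isOpen_Ioo (f' := F')
    (g' := fun τ => bil φ' (x τ)) ?_ (Filter.Eventually.of_forall hF')
    (fun τ hτ => (summable_bil hφ (hx.mem τ (Set.Ioo_subset_Icc_self hτ))).hasSum) ht
  have hgt : Filter.Tendsto (fun s : Finset ι => ‖∑ k ∈ s, S.β k * φ.2 k - g‖)
      Filter.atTop (nhds 0) := by
    have := (tendsto_sub_nhds_zero_iff.2 hg).norm
    rwa [norm_zero] at this
  have hb := ((tendsto_sqrt_tailSq_mul φ' M).add ((tendsto_sqrt_tailSq_mul ψ M).const_mul ‖g‖)).add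
    (hgt.mul_const (√(tailSq ψ ∅) * M))
  rw [mul_zero, zero_mul, add_zero, add_zero] at hb
  refine tendstoUniformlyOn_of_norm_sub_le hb fun s τ hτ => ?_
  have hτ' := Set.Ioo_subset_Icc_self hτ
  have hxm := hx.mem τ hτ'
  -- Truncation breaks the symmetry of the generator. The defect consists of `g` times the truncated
  -- control of `x` and the truncated control of `φ` times that of `x`, and these cancel only in the
  -- limit.
  have e : F' s τ - bil φ' (x τ)
      = (∑ k ∈ s, (φ'.1 k * (x τ).2 k + φ'.2 k * (x τ).1 k) - bil φ' (x τ))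
        - g * (∑ k ∈ s, (ψ.1 k * (x τ).2 k + ψ.2 k * (x τ).1 k) - bil ψ (x τ))
        + (∑ k ∈ s, S.β k * φ.2 k - g) * bil ψ (x τ) := by
    have e1 : F' s τ = ∑ k ∈ s, (φ'.1 k * (x τ).2 k + φ'.2 k * (x τ).1 k)
        - g * ∑ k ∈ s, (ψ.1 k * (x τ).2 k + ψ.2 k * (x τ).1 k)
        + (∑ k ∈ s, S.β k * φ.2 k) * bil ψ (x τ) := by
      rw [Finset.mul_sum, Finset.sum_mul, ← Finset.sum_sub_distrib, ← Finset.sum_add_distrib]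
      refine Finset.sum_congr rfl fun k _ => ?_
      rw [h1, h2, hψx]
      simp only [ψ, Pi.zero_apply]
      ring
    rw [e1]; ring
  rw [e]
  refine (norm_add_le _ _).trans (add_le_add ((norm_sub_le _ _).trans (add_le_add ?_ ?_)) ?_)
  · exact (norm_sum_sub_bil_le hφ' hxm s).trans
      (mul_le_mul_of_nonneg_left (hM τ hτ') (Real.sqrt_nonneg _))
  · rw [norm_mul]
    exact mul_le_mul_of_nonneg_left ((norm_sum_sub_bil_le hψ hxm s).trans
      (mul_le_mul_of_nonneg_left (hM τ hτ') (Real.sqrt_nonneg _))) (norm_nonneg _)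
  · rw [norm_mul]
    exact mul_le_mul_of_nonneg_left ((norm_bil_le hψ hxm).trans
      (mul_le_mul_of_nonneg_left (hM τ hτ') (Real.sqrt_nonneg _))) (norm_nonneg _)

end ModalSystem

/-! ### Exponential decay of the spectral functionals. -/

namespace ModalSystem

variable {ι : Type*} (S : ModalSystem ι)

/-- A multiple of the norm of the unweighted space. -/
def xNorm (θ : (ι → ℂ) × (ι → ℂ)) : ℝ := √(2 * xNormSq θ)

theorem xNorm_nonneg (θ : (ι → ℂ) × (ι → ℂ)) : 0 ≤ xNorm θ := Real.sqrt_nonneg _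

/-- Functionals with exponential layers at both ends along all solutions. -/
def Decays (φ : (ι → ℂ) × (ι → ℂ)) : Prop :=
  ∃ C c, 0 ≤ C ∧ 0 < c ∧ ∀ T x, S.IsSol T x → ∀ t ∈ Set.Icc 0 T, ‖bil φ (x t)‖
    ≤ C * xNorm (x 0) * Real.exp (-c * t) + C * xNorm (x T) * Real.exp (-c * (T - t))

theorem X₀_le_E : X₀ ι ≤ S.E := fun _ h => ⟨S.wsq_w_of_one h.1, S.wsq_w_of_one h.2⟩

theorem G_le_X₀ : S.G ≤ X₀ ι := fun _ h => ⟨S.wsq_one_of_inv h.1, S.wsq_one_of_inv h.2⟩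

variable {S}

theorem bil_add_left {φ ψ θ : (ι → ℂ) × (ι → ℂ)} (hφ : φ ∈ S.G) (hψ : ψ ∈ S.G) (hθ : θ ∈ S.E) :
    bil (φ + ψ) θ = bil φ θ + bil ψ θ := by
  refine HasSum.tsum_eq ?_
  convert (hasSum_bil hφ hθ).add (hasSum_bil hψ hθ) using 2 with k
  simp only [Prod.fst_add, Prod.snd_add, Pi.add_apply]
  ring

theorem bil_smul_left (φ θ : (ι → ℂ) × (ι → ℂ)) (c : ℂ) : bil (c • φ) θ = c * bil φ θ := by
  rw [bil_comm, bil_smul, bil_comm]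

theorem exp_neg_mul_le {c c' t : ℝ} (h : c ≤ c') (ht : 0 ≤ t) :
    Real.exp (-c' * t) ≤ Real.exp (-c * t) :=
  Real.exp_le_exp.2 (by nlinarith)

theorem Decays.zero : S.Decays 0 := by
  refine ⟨0, 1, le_rfl, one_pos, fun T x _ t _ => ?_⟩
  simp [bil]

theorem Decays.add {φ ψ : (ι → ℂ) × (ι → ℂ)} (hφ : φ ∈ S.G) (hψ : ψ ∈ S.G) (h1 : S.Decays φ)
    (h2 : S.Decays ψ) : S.Decays (φ + ψ) := by
  obtain ⟨C₁, c₁, hC₁, hc₁, h1⟩ := h1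
  obtain ⟨C₂, c₂, hC₂, hc₂, h2⟩ := h2
  refine ⟨C₁ + C₂, min c₁ c₂, by positivity, lt_min hc₁ hc₂, fun T x hx t ht => ?_⟩
  have ht' : 0 ≤ T - t := sub_nonneg.2 ht.2
  have n0 := xNorm_nonneg (x 0)
  have nT := xNorm_nonneg (x T)
  rw [bil_add_left hφ hψ (S.X₀_le_E (hx.mem t ht))]
  calc ‖bil φ (x t) + bil ψ (x t)‖ ≤ _ := norm_add_le _ _
    _ ≤ _ := add_le_add (h1 T x hx t ht) (h2 T x hx t ht)
    _ ≤ (C₁ * xNorm (x 0) * Real.exp (-(min c₁ c₂) * t)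
          + C₁ * xNorm (x T) * Real.exp (-(min c₁ c₂) * (T - t)))
        + (C₂ * xNorm (x 0) * Real.exp (-(min c₁ c₂) * t)
          + C₂ * xNorm (x T) * Real.exp (-(min c₁ c₂) * (T - t))) := by
      refine add_le_add (add_le_add ?_ ?_) (add_le_add ?_ ?_) <;>
      refine mul_le_mul_of_nonneg_left (exp_neg_mul_le ?_ ?_) (by positivity) <;>
      first | exact min_le_left _ _ | exact min_le_right _ _ | exact ht.1 | exact ht'
    _ = _ := by ring

theorem norm_bil_le_xNorm {φ : (ι → ℂ) × (ι → ℂ)} (hφ : φ ∈ X₀ ι) :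
    ∃ D, 0 ≤ D ∧ ∀ θ ∈ X₀ ι, ‖bil φ θ‖ ≤ D * xNorm θ :=
  ⟨_, Real.sqrt_nonneg _, fun _ hθ => norm_bil_le hφ hθ⟩

/-- The function `u = bil φ x` solves `u' = su` plus the forcing `bil (φ' - s • φ) x`, which already
has layers. It is integrated forward if `Re s < 0` and backward if `Re s > 0`. -/
theorem Decays.of_isGen {φ φ' : (ι → ℂ) × (ι → ℂ)} {s : ℂ} (hs : s.re ≠ 0) (hφ : φ ∈ S.G)
    (hφ' : φ' ∈ S.G) (hg : S.IsGen φ φ') (h : S.Decays (φ' - s • φ)) : S.Decays φ := by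
  obtain ⟨C, c', hC, hc', h⟩ := h
  obtain ⟨D, hD, hDb⟩ := norm_bil_le_xNorm (S.G_le_X₀ hφ)
  set r := |s.re| with hr
  have hr0 : 0 < r := abs_pos.2 hs
  set c := min c' (r / 2) with hc
  have hc0 : 0 < c := lt_min hc' (by positivity)
  have hcr : c ≤ r / 2 := min_le_right _ _
  refine ⟨D + 2 / r * C, c, by positivity, hc0, fun T x hx t ht => ?_⟩
  have ht' : 0 ≤ T - t := sub_nonneg.2 ht.2
  have n0 := xNorm_nonneg (x 0)
  have nT := xNorm_nonneg (x T)
  have h0 : (0 : ℝ) ∈ Set.Icc 0 T := ⟨le_rfl, ht.1.trans ht.2⟩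
  have hT : T ∈ Set.Icc 0 T := ⟨ht.1.trans ht.2, le_rfl⟩
  have hu := hx.continuousOn_bil (S.G_le_X₀ hφ)
  have hu' : ∀ τ ∈ Set.Ioo 0 T, HasDerivAt (fun τ => bil φ (x τ))
      (s * bil φ (x τ) + bil (φ' - s • φ) (x τ)) τ := fun τ hτ => by
    refine (hx.hasDerivAt_bil (S.G_le_X₀ hφ) (S.G_le_X₀ hφ') hg hτ).congr_deriv ?_
    rw [← bil_smul_left, ← bil_add_left (S.G.smul_mem s hφ)
      (S.G.sub_mem hφ' (S.G.smul_mem s hφ)) (S.X₀_le_E (hx.mem τ (Set.Ioo_subset_Icc_self hτ))),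
      add_sub_cancel]
  have hforce : ∀ τ ∈ Set.Icc 0 T, ‖bil (φ' - s • φ) (x τ)‖
      ≤ C * xNorm (x 0) * Real.exp (-c * τ) + C * xNorm (x T) * Real.exp (-c * (T - τ)) :=
    fun τ hτ => (h T x hx τ hτ).trans (add_le_add
      (mul_le_mul_of_nonneg_left (exp_neg_mul_le (min_le_left _ _) hτ.1) (by positivity))
      (mul_le_mul_of_nonneg_left (exp_neg_mul_le (min_le_left _ _) (sub_nonneg.2 hτ.2))
        (by positivity)))
  have hA : 0 ≤ C * xNorm (x 0) := by positivity
  have hB : 0 ≤ C * xNorm (x T) := by positivity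
  have e1 := exp_neg_mul_le (show c ≤ r by linarith) ht.1
  have e2 := exp_neg_mul_le (show c ≤ r by linarith) ht'
  have p1 := Real.exp_pos (-c * t)
  have p2 := Real.exp_pos (-c * (T - t))
  have hfin : (D + 2 / r * C) * xNorm (x 0) * Real.exp (-c * t)
      + (D + 2 / r * C) * xNorm (x T) * Real.exp (-c * (T - t))
      = Real.exp (-c * t) * (D * xNorm (x 0)) + Real.exp (-c * (T - t)) * (D * xNorm (x T))
        + 2 / r * (C * xNorm (x 0) * Real.exp (-c * t)
          + C * xNorm (x T) * Real.exp (-c * (T - t))) := by ring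
  rw [hfin]
  rcases lt_or_gt_of_ne hs with hlt | hgt
  · have key := scalar_stable hr0 (by rw [hr, abs_of_neg hlt, neg_neg]) hc0 hcr hA hB hu hu'
      hforce ht
    refine key.trans (add_le_add ?_ le_rfl)
    exact (mul_le_mul e1 (hDb _ (hx.mem 0 h0)) (norm_nonneg _) p1.le).trans
      (le_add_of_nonneg_right (by positivity))
  · have key := scalar_unstable hr0 (by rw [hr, abs_of_pos hgt]) hc0 hcr hA hB hu hu'
      hforce ht
    refine key.trans (add_le_add ?_ le_rfl)
    exact (mul_le_mul e2 (hDb _ (hx.mem T hT)) (norm_nonneg _) p2.le).trans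
      (le_add_of_nonneg_left (by positivity))

variable [Nonempty ι] {P : Set ℂ}

/-- Induction along a Jordan chain, each link being forced by the previous one. For imaginary `s`
the chain is zero, since there are no imaginary eigenvalues. -/
theorem decays_of_pow_eq_zero (hP : S.IsSpec P) [FiniteDimensional ℂ (S.kerSpec P)]
    {A : Module.End ℂ (S.kerSpec P)} (hA : ∀ ζ, S.IsGen ζ.1 (A ζ).1) (s : ℂ) (m : ℕ) :
    ∀ ζ : S.kerSpec P, ((A - s • 1) ^ m) ζ = 0 → S.Decays ζ.1 := by
  by_cases hs : s.re = 0
  · suffices h : ∀ ζ : S.kerSpec P, ((A - s • 1) ^ m) ζ = 0 → ζ = 0 by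
      intro ζ hζ
      rw [h ζ hζ]
      exact Decays.zero
    induction m with
    | zero => intro ζ hζ; simpa using hζ
    | succ m ih =>
      intro ζ hζ
      rw [pow_succ, Module.End.mul_apply] at hζ
      have h1 := ih _ hζ
      have h2 : A ζ = s • ζ := by
        rw [LinearMap.sub_apply, sub_eq_zero] at h1; simpa using h1
      have h3 := hA ζ
      rw [h2] at h3
      exact Subtype.ext (h3.eq_zero_of_re_eq_zero hs)
  · induction m with
    | zero =>
      intro ζ hζ
      have : ζ = 0 := by simpa using hζ
      rw [this]
      exact Decays.zero
    | succ m ih =>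
      intro ζ hζ
      rw [pow_succ, Module.End.mul_apply] at hζ
      refine Decays.of_isGen hs (kerSpec_le_G hP ζ.2) (kerSpec_le_G hP (A ζ).2) (hA ζ) ?_
      simpa using ih _ hζ

/-- The remaining spectral directions decay exponentially. -/
theorem decays_of_mem_kerSpec (hP : S.IsSpec P) [FiniteDimensional ℂ (S.kerSpec P)]
    (ζ : S.kerSpec P) : S.Decays ζ.1 := by
  obtain ⟨A, hA⟩ := exists_generator hP
  have htop : ζ ∈ ⨆ μ : ℂ, A.maxGenEigenspace μ := by
    rw [Module.End.iSup_maxGenEigenspace_eq_top A]; trivial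
  refine Submodule.iSup_induction (fun μ : ℂ => A.maxGenEigenspace μ)
    (motive := fun ζ : S.kerSpec P => S.Decays ζ.1) htop ?_ Decays.zero ?_
  · intro s ζ hζ
    obtain ⟨m, hm⟩ := (Module.End.mem_maxGenEigenspace A s ζ).1 hζ
    exact decays_of_pow_eq_zero hP hA s m ζ hm
  · exact fun x y hx hy => hx.add (kerSpec_le_G hP x.2) (kerSpec_le_G hP y.2) hy

/-- Exact eigenfunctionals obey an unforced scalar equation, with real part `∓Re d` and `Re d ≥
3β_n/4`. -/
theorem IsPair.eigFun_decay {n : ι} {d : ℂ} (h : S.IsPair n d) {T : ℝ}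
    {x : ℝ → (ι → ℂ) × (ι → ℂ)} (hx : S.IsSol T x) {t : ℝ} (ht : t ∈ Set.Icc 0 T) :
    ‖S.eigFun n (-(starRingEnd ℂ) d) (x t)‖
        ≤ Real.exp (-(3 / 4 * S.β n) * t) * ‖S.eigFun n (-(starRingEnd ℂ) d) (x 0)‖ ∧
      ‖S.eigFun n d (x t)‖
        ≤ Real.exp (-(3 / 4 * S.β n) * (T - t)) * ‖S.eigFun n d (x T)‖ := by
  have hβ := S.β_pos n
  have hd0 : 0 < d.re := by linarith [h.le_re]
  have hd' : (-(starRingEnd ℂ) d).re = -d.re := by simp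
  have ht' : 0 ≤ T - t := sub_nonneg.2 ht.2
  have key : ∀ e : ℂ, S.IsRoot n e → e.re ≠ 0 →
      ContinuousOn (fun τ => S.eigFun n e (x τ)) (Set.Icc 0 T) ∧
      ∀ τ ∈ Set.Ioo 0 T, HasDerivAt (fun τ => S.eigFun n e (x τ))
        (S.sp n e * S.eigFun n e (x τ) + 0) τ := fun e he hre => by
    have hG := S.phi_mem_G (S.sp n e)
    have hX := S.G_le_X₀ hG
    refine ⟨continuousOn_const.mul (hx.continuousOn_bil hX), fun τ hτ => ?_⟩
    have h1 := (hx.hasDerivAt_bil hX ((X₀ ι).smul_mem (S.sp n e) hX)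
      (isGen_phi (by rwa [sp_re]) (he.h_eq_zero h.good)) hτ).const_mul (e ^ 2 / S.β n)
    refine h1.congr_deriv ?_
    rw [bil_smul_left, eigFun]
    ring
  constructor
  · obtain ⟨k1, k2⟩ := key _ h.root.neg_conj (by rw [hd']; linarith)
    have := scalar_stable (A := 0) (B := 0) (c := d.re / 2) hd0 (by rw [sp_re, hd']) (by positivity)
      le_rfl le_rfl le_rfl k1 k2 (fun τ _ => by simp) ht
    rw [zero_mul, zero_mul, add_zero, mul_zero, add_zero] at this
    exact this.trans (mul_le_mul_of_nonneg_right (exp_neg_mul_le h.le_re ht.1) (norm_nonneg _))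
  · obtain ⟨k1, k2⟩ := key _ h.root hd0.ne'
    have := scalar_unstable (A := 0) (B := 0) (c := d.re / 2) hd0 (by rw [sp_re]) (by positivity)
      le_rfl le_rfl le_rfl k1 k2 (fun τ _ => by simp) ht
    rw [zero_mul, zero_mul, add_zero, mul_zero, add_zero] at this
    exact this.trans (mul_le_mul_of_nonneg_right (exp_neg_mul_le h.le_re ht') (norm_nonneg _))

end ModalSystem

/-! ### Polynomial rates, majorants and coordinates on the kernel. -/

/-- Apply `x ≤ exp x` to `x = cb(t+1)/p` and raise to the power `p`. Replacing `t` by `t + 1` costs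
only `exp(cb) ≤ exp(cB)`, which makes the bound uniform in `b`. -/
theorem rpow_mul_exp_neg_le {p c B : ℝ} (hp : 0 < p) (hc : 0 < c) :
    ∃ K, 0 < K ∧ ∀ b, 0 < b → b ≤ B → ∀ t, 0 ≤ t →
      b ^ p * Real.exp (-(c * b) * t) ≤ K / (t + 1) ^ p := by
  refine ⟨(p / c) ^ p * Real.exp (c * B), by positivity, fun b hb hbB t ht => ?_⟩
  have ht1 : 0 < t + 1 := by linarith
  rw [le_div_iff₀ (by positivity)]
  have h1 : b * (t + 1) ≤ p / c * Real.exp (c * (b * (t + 1)) / p) := by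
    have h := Real.add_one_le_exp (c * (b * (t + 1)) / p)
    have e : b * (t + 1) = p / c * (c * (b * (t + 1)) / p) := by field_simp
    calc b * (t + 1) = p / c * (c * (b * (t + 1)) / p) := e
      _ ≤ _ := mul_le_mul_of_nonneg_left (by linarith) (by positivity)
  have h2 : (b * (t + 1)) ^ p ≤ (p / c) ^ p * Real.exp (c * (b * (t + 1))) := by
    refine (Real.rpow_le_rpow (by positivity) h1 hp.le).trans (le_of_eq ?_)
    rw [Real.mul_rpow (by positivity) (Real.exp_pos _).le, ← Real.exp_mul,
      div_mul_cancel₀ _ hp.ne']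
  calc b ^ p * Real.exp (-(c * b) * t) * (t + 1) ^ p
      = (b * (t + 1)) ^ p * Real.exp (-(c * b) * t) := by
        rw [Real.mul_rpow hb.le ht1.le]; ring
    _ ≤ (p / c) ^ p * Real.exp (c * (b * (t + 1))) * Real.exp (-(c * b) * t) :=
        mul_le_mul_of_nonneg_right h2 (Real.exp_pos _).le
    _ = (p / c) ^ p * Real.exp (c * b) := by
        rw [mul_assoc, ← Real.exp_add]; congr 2; ring
    _ ≤ _ := by gcongr

theorem exp_neg_le_rpow {p c : ℝ} (hp : 0 < p) (hc : 0 < c) :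
    ∃ K, 0 < K ∧ ∀ t, 0 ≤ t → Real.exp (-c * t) ≤ K / (t + 1) ^ p := by
  obtain ⟨K, hK, h⟩ := rpow_mul_exp_neg_le (B := c) hp one_pos
  refine ⟨K / c ^ p, by positivity, fun t ht => ?_⟩
  have := h c hc le_rfl t ht
  rw [one_mul] at this
  rw [div_right_comm, le_div_iff₀ (by positivity), mul_comm]
  exact this

/-- Polynomial layers at both ends of the interval `[0, T]`. -/
def layers (p T t N₀ N₁ : ℝ) : ℝ := N₀ / (t + 1) ^ p + N₁ / (T - t + 1) ^ p

namespace ModalSystem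

variable {ι : Type*} {S : ModalSystem ι}

theorem layers_nonneg {p T t N₀ N₁ : ℝ} (ht : t ∈ Set.Icc 0 T) (h0 : 0 ≤ N₀) (h1 : 0 ≤ N₁) :
    0 ≤ layers p T t N₀ N₁ := by
  have h2 : 0 ≤ t + 1 := by linarith [ht.1]
  have h3 : 0 ≤ T - t + 1 := by linarith [ht.2]
  unfold layers
  positivity

theorem Decays.exists_layers {φ : (ι → ℂ) × (ι → ℂ)} (h : S.Decays φ) {p : ℝ} (hp : 0 < p) :
    ∃ K, 0 ≤ K ∧ ∀ T x, S.IsSol T x → ∀ t ∈ Set.Icc 0 T,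
      ‖bil φ (x t)‖ ≤ K * layers p T t (xNorm (x 0)) (xNorm (x T)) := by
  obtain ⟨C, c, hC, hc, h⟩ := h
  obtain ⟨K, hK, hexp⟩ := exp_neg_le_rpow hp hc
  refine ⟨C * K, by positivity, fun T x hx t ht => (h T x hx t ht).trans ?_⟩
  have n0 := xNorm_nonneg (x 0)
  have nT := xNorm_nonneg (x T)
  calc _ ≤ C * xNorm (x 0) * (K / (t + 1) ^ p) + C * xNorm (x T) * (K / (T - t + 1) ^ p) :=
        add_le_add (mul_le_mul_of_nonneg_left (hexp t ht.1) (by positivity))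
          (mul_le_mul_of_nonneg_left (hexp _ (sub_nonneg.2 ht.2)) (by positivity))
    _ = _ := by rw [layers]; ring

theorem xNorm_sq (θ : (ι → ℂ) × (ι → ℂ)) : xNorm θ ^ 2 = 2 * xNormSq θ :=
  Real.sq_sqrt (mul_nonneg zero_le_two (xNormSq_nonneg θ))

theorem coupling_le_xNorm : ∃ C, 0 ≤ C ∧ ∀ n, ∀ θ ∈ X₀ ι, S.coupling n θ ≤ C * xNorm θ := by
  have hg := S.gap_pos
  refine ⟨1 / S.gap * √(∑' k, S.β k ^ 2), by positivity, fun n θ hθ => ?_⟩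
  have h1 := S.β_sq.tsum_mul_le (sqSummable_norm_add hθ)
  calc S.coupling n θ ≤ ∑' m, 1 / S.gap * (S.β m * (‖θ.1 m‖ + ‖θ.2 m‖)) := by
        refine (summable_coupling n (S.X₀_le_E hθ)).tsum_le_tsum (fun m => ?_)
          ((S.β_sq.mul (sqSummable_norm_add hθ)).mul_left _)
        have hβ := S.β_pos m
        have := mul_le_mul_of_nonneg_right (recDiff_le (S := S) n m)
          (show 0 ≤ S.β m * (‖θ.1 m‖ + ‖θ.2 m‖) by positivity)
        linarith
    _ = 1 / S.gap * ∑' m, S.β m * (‖θ.1 m‖ + ‖θ.2 m‖) := tsum_mul_left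
    _ ≤ 1 / S.gap * (√(∑' k, S.β k ^ 2) * √(2 * xNormSq θ)) :=
        mul_le_mul_of_nonneg_left (h1.trans (mul_le_mul_of_nonneg_left
          (Real.sqrt_le_sqrt (tsum_norm_add_sq_le hθ)) (Real.sqrt_nonneg _))) (by positivity)
    _ = _ := by rw [xNorm]; ring

/-- The spectral coordinates of a state are square summable. -/
theorem exists_majorant [Nonempty ι] : ∃ C, 0 ≤ C ∧ ∀ θ ∈ X₀ ι, ∃ y : ι → ℝ, SqSummable y ∧
    (∀ n, 0 ≤ y n) ∧ ∑' n, y n ^ 2 ≤ C * xNorm θ ^ 2 ∧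
    ∀ n d, S.IsGood n → S.IsRoot n d → ‖S.eigFun n d θ‖ ≤ y n := by
  have hg := S.gap_pos
  obtain ⟨c, hc, hcoup⟩ := coupling_le_xNorm (S := S)
  set D := (4 + 7 / S.gap) * c with hD
  have hD0 : 0 ≤ D := by positivity
  have hB0 : 0 ≤ ∑' k, S.β k ^ 2 := tsum_nonneg fun _ => sq_nonneg _
  refine ⟨3 * (1 + S.gap ^ 2) + 3 * D ^ 2 * ∑' k, S.β k ^ 2, by positivity, fun θ hθ => ?_⟩
  have hN := xNorm_nonneg θ
  set y : ι → ℝ := fun n => ‖θ.1 n‖ + S.gap * ‖θ.2 n‖ + D * xNorm θ * S.β n with hy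
  have hs1 : Summable fun n => ‖θ.1 n‖ ^ 2 + ‖θ.2 n‖ ^ 2 :=
    Summable.add (summable_norm_sq hθ.1) (summable_norm_sq hθ.2)
  have hs : Summable fun n => 3 * (1 + S.gap ^ 2) * (‖θ.1 n‖ ^ 2 + ‖θ.2 n‖ ^ 2)
      + 3 * (D * xNorm θ) ^ 2 * S.β n ^ 2 := (hs1.mul_left _).add (Summable.mul_left _ S.β_sq)
  have hle : ∀ n, y n ^ 2 ≤ 3 * (1 + S.gap ^ 2) * (‖θ.1 n‖ ^ 2 + ‖θ.2 n‖ ^ 2)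
      + 3 * (D * xNorm θ) ^ 2 * S.β n ^ 2 := fun n => by
    have key : ∀ a b e : ℝ, (a + b + e) ^ 2 ≤ 3 * (a ^ 2 + b ^ 2 + e ^ 2) := fun a b e => by
      nlinarith [sq_nonneg (a - b), sq_nonneg (a - e), sq_nonneg (b - e)]
    refine (key _ _ _).trans ?_
    have h1 : 0 ≤ ‖θ.2 n‖ ^ 2 := sq_nonneg _
    have h2 : 0 ≤ S.gap ^ 2 * ‖θ.1 n‖ ^ 2 := by positivity
    nlinarith
  refine ⟨y, Summable.of_nonneg_of_le (fun _ => sq_nonneg _) hle hs, fun n => ?_, ?_,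
    fun n d hn hd => ?_⟩
  · have := S.β_pos n
    positivity
  · refine (Summable.tsum_le_tsum hle (Summable.of_nonneg_of_le (fun _ => sq_nonneg _) hle hs)
      hs).trans ?_
    rw [Summable.tsum_add (hs1.mul_left _) (Summable.mul_left _ S.β_sq), tsum_mul_left,
      tsum_mul_left]
    have e := xNorm_sq θ
    have h0 := xNormSq_nonneg θ
    have e2 : ∑' n, (‖θ.1 n‖ ^ 2 + ‖θ.2 n‖ ^ 2) ≤ xNorm θ ^ 2 := by
      rw [e]; rw [xNormSq] at h0 ⊢; linarith
    calc _ ≤ 3 * (1 + S.gap ^ 2) * xNorm θ ^ 2 + 3 * (D * xNorm θ) ^ 2 * ∑' k, S.β k ^ 2 := by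
          gcongr
      _ = _ := by ring
  · have hβ := S.β_pos n
    rw [eigFun_eq hn hd (S.X₀_le_E hθ)]
    refine (norm_add_le _ _).trans (add_le_add ((norm_add_le _ _).trans
      (add_le_add le_rfl ?_)) ((hd.norm_off_le hn (S.X₀_le_E hθ)).trans ?_))
    · rw [norm_mul]
      exact mul_le_mul_of_nonneg_right (by linarith [hd.1, hn.1]) (norm_nonneg _)
    · calc (4 + 7 / S.gap) * S.β n * S.coupling n θ
          ≤ (4 + 7 / S.gap) * S.β n * (c * xNorm θ) :=
            mul_le_mul_of_nonneg_left (hcoup n θ hθ) (by positivity)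
        _ = _ := by rw [hD]; ring

theorem norm_bil_sq_le {φ : (ι → ℂ) × (ι → ℂ)} (hφ : φ ∈ S.G) :
    ∃ D, 0 ≤ D ∧ ∀ θ ∈ S.E, ‖bil φ θ‖ ^ 2 ≤ D * S.eNormSq θ := by
  have hp : SqSummable fun k => (S.w k)⁻¹ * ‖φ.1 k‖ + (S.w k)⁻¹ * ‖φ.2 k‖ :=
    SqSummable.add hφ.1 hφ.2
  refine ⟨(∑' k, ((S.w k)⁻¹ * ‖φ.1 k‖ + (S.w k)⁻¹ * ‖φ.2 k‖) ^ 2) * 2,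
    mul_nonneg (tsum_nonneg fun _ => sq_nonneg _) zero_le_two, fun θ hθ => ?_⟩
  have hq : SqSummable fun k => S.w k * ‖θ.1 k‖ + S.w k * ‖θ.2 k‖ := SqSummable.add hθ.1 hθ.2
  have h1 : ‖bil φ θ‖ ≤ ∑' k, ((S.w k)⁻¹ * ‖φ.1 k‖ + (S.w k)⁻¹ * ‖φ.2 k‖)
      * (S.w k * ‖θ.1 k‖ + S.w k * ‖θ.2 k‖) := by
    refine tsum_of_norm_bounded (hp.mul hq).hasSum fun k => ?_
    have hw := (S.w_pos k).ne'
    have e : ((S.w k)⁻¹ * ‖φ.1 k‖ + (S.w k)⁻¹ * ‖φ.2 k‖) * (S.w k * ‖θ.1 k‖ + S.w k * ‖θ.2 k‖)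
        = (‖φ.1 k‖ + ‖φ.2 k‖) * (‖θ.1 k‖ + ‖θ.2 k‖) := by field_simp
    rw [e]
    refine (norm_add_le _ _).trans ?_
    rw [norm_mul, norm_mul]
    nlinarith [mul_nonneg (norm_nonneg (φ.1 k)) (norm_nonneg (θ.1 k)),
      mul_nonneg (norm_nonneg (φ.2 k)) (norm_nonneg (θ.2 k))]
  have h2 : ∑' k, (S.w k * ‖θ.1 k‖ + S.w k * ‖θ.2 k‖) ^ 2 ≤ 2 * S.eNormSq θ := by
    rw [eNormSq, ← tsum_mul_left]
    refine Summable.tsum_le_tsum (fun m => ?_) hq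
      ((Summable.add (f := fun k => (S.w k * ‖θ.1 k‖) ^ 2) hθ.1 hθ.2).mul_left 2)
    nlinarith [sq_nonneg (S.w m * ‖θ.1 m‖ - S.w m * ‖θ.2 m‖)]
  have h3 := pow_le_pow_left₀ (norm_nonneg _) (h1.trans (hp.tsum_mul_le hq)) 2
  rw [mul_pow, Real.sq_sqrt (tsum_nonneg fun _ => sq_nonneg _),
    Real.sq_sqrt (tsum_nonneg fun _ => sq_nonneg _)] at h3
  rw [mul_assoc]
  exact h3.trans (mul_le_mul_of_nonneg_left h2 (tsum_nonneg fun _ => sq_nonneg _))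

theorem eNormSq_add_le {θ η : (ι → ℂ) × (ι → ℂ)} (hθ : θ ∈ S.E) (hη : η ∈ S.E) :
    S.eNormSq (θ + η) ≤ 2 * S.eNormSq θ + 2 * S.eNormSq η := by
  have h := S.E.add_mem hθ hη
  rw [eNormSq, eNormSq, eNormSq, ← tsum_mul_left, ← tsum_mul_left,
    ← Summable.tsum_add ((Summable.add hθ.1 hθ.2).mul_left 2)
      ((Summable.add hη.1 hη.2).mul_left 2)]
  refine Summable.tsum_le_tsum (fun k => ?_) (Summable.add h.1 h.2)
    (((Summable.add hθ.1 hθ.2).mul_left 2).add ((Summable.add hη.1 hη.2).mul_left 2))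
  have hw := S.w_pos k
  have key : ∀ a b : ℂ, (S.w k * ‖a + b‖) ^ 2 ≤ 2 * (S.w k * ‖a‖) ^ 2 + 2 * (S.w k * ‖b‖) ^ 2 :=
    fun a b => by
      have h1 : S.w k * ‖a + b‖ ≤ S.w k * ‖a‖ + S.w k * ‖b‖ := by
        rw [← mul_add]; exact mul_le_mul_of_nonneg_left (norm_add_le a b) hw.le
      have h2 := pow_le_pow_left₀ (by positivity) h1 2
      nlinarith [sq_nonneg (S.w k * ‖a‖ - S.w k * ‖b‖)]
  have h1 := key (θ.1 k) (η.1 k)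
  have h2 := key (θ.2 k) (η.2 k)
  simp only [Prod.fst_add, Prod.snd_add, Pi.add_apply]
  linarith

theorem eNormSq_sum_le {m : ℕ} (c : Fin m → ℂ) {v : Fin m → (ι → ℂ) × (ι → ℂ)}
    (hv : ∀ i, v i ∈ S.E) :
    S.eNormSq (∑ i, c i • v i) ≤ (∑ i, ‖c i‖ ^ 2) * ∑ i, S.eNormSq (v i) := by
  have hs : ∀ i, Summable fun k => (S.w k * ‖(v i).1 k‖) ^ 2 + (S.w k * ‖(v i).2 k‖) ^ 2 :=
    fun i => Summable.add (hv i).1 (hv i).2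
  have hE : ∑ i, c i • v i ∈ S.E := S.E.sum_mem fun i _ => S.E.smul_mem _ (hv i)
  simp only [eNormSq]
  rw [← Summable.tsum_finsetSum fun i _ => hs i, ← tsum_mul_left]
  refine Summable.tsum_le_tsum (fun k => ?_) (Summable.add hE.1 hE.2)
    ((summable_sum fun i _ => hs i).mul_left _)
  have hw := S.w_pos k
  have key : ∀ f : Fin m → ℂ, (S.w k * ‖∑ i, c i * f i‖) ^ 2
      ≤ (∑ i, ‖c i‖ ^ 2) * ∑ i, (S.w k * ‖f i‖) ^ 2 := fun f => by
    have h1 : S.w k * ‖∑ i, c i * f i‖ ≤ ∑ i, ‖c i‖ * (S.w k * ‖f i‖) := by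
      rw [show ∑ i, ‖c i‖ * (S.w k * ‖f i‖) = S.w k * ∑ i, ‖c i * f i‖ by
        rw [Finset.mul_sum]
        exact Finset.sum_congr rfl fun i _ => by rw [norm_mul]; ring]
      exact mul_le_mul_of_nonneg_left (norm_sum_le _ _) hw.le
    exact (pow_le_pow_left₀ (by positivity) h1 2).trans (Finset.sum_mul_sq_le_sq_mul_sq _ _ _)
  have e1 : (∑ i, c i • v i).1 k = ∑ i, c i * (v i).1 k := by
    simp [Prod.fst_sum, Finset.sum_apply]
  have e2 : (∑ i, c i • v i).2 k = ∑ i, c i * (v i).2 k := by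
    simp [Prod.snd_sum, Finset.sum_apply]
  rw [e1, e2, Finset.sum_add_distrib, mul_add]
  exact add_le_add (key _) (key _)

/-- On the kernel of the eigenfunctionals, the norm is controlled by finitely many functionals. -/
theorem exists_coordinates [Nonempty ι] {P : Set ℂ} (hP : S.IsSpec P)
    [FiniteDimensional ℂ (S.kerSpec P)] :
    ∃ (m : ℕ) (φ : Fin m → S.kerSpec P) (C : ℝ), 0 ≤ C ∧
      ∀ ζ : S.kerSpec P, S.eNormSq ζ.1 ≤ C * ∑ i, ‖bil (φ i).1 ζ.1‖ ^ 2 := by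
  let b := Module.finBasis ℂ (S.kerSpec P)
  let L : S.kerSpec P →ₗ[ℂ] Fin (Module.finrank ℂ (S.kerSpec P)) → ℂ :=
    { toFun := fun ζ i => bil (b i).1 ζ.1
      map_add' := fun x y => funext fun i => bil_add (kerSpec_le_G hP (b i).2) x.2.1 y.2.1
      map_smul' := fun c x => funext fun i => bil_smul _ _ _ }
  -- Pairing with a basis of the kernel is injective by nondegeneracy; a linear left inverse then
  -- reconstructs `ζ` from its pairings.
  have hL : LinearMap.ker L = ⊥ := by
    rw [LinearMap.ker_eq_bot']
    intro ζ hζ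
    let F : S.kerSpec P →ₗ[ℂ] ℂ :=
      { toFun := fun η => bil η.1 ζ.1
        map_add' := fun x y => bil_add_left (kerSpec_le_G hP x.2) (kerSpec_le_G hP y.2) ζ.2.1
        map_smul' := fun c x => bil_smul_left _ _ _ }
    have hF : F = 0 := b.ext fun i => congrFun hζ i
    exact bil_nondegenerate hP ζ fun η => LinearMap.congr_fun hF η
  obtain ⟨R, hR⟩ := L.exists_leftInverse_of_injective hL
  refine ⟨_, b, ∑ i, S.eNormSq (R (Pi.single i 1)).1,
    Finset.sum_nonneg fun i _ => eNormSq_nonneg _, fun ζ => ?_⟩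
  have e : ζ.1 = ∑ i, L ζ i • (R (Pi.single i 1)).1 := by
    have h1 : R (L ζ) = ζ := LinearMap.congr_fun hR ζ
    have h2 : L ζ = ∑ i, L ζ i • (Pi.single i 1 : Fin _ → ℂ) := pi_eq_sum_univ' (L ζ)
    conv_lhs => rw [← h1, h2, map_sum]
    simp only [map_smul, Submodule.coe_sum, Submodule.coe_smul]
  rw [mul_comm]
  conv_lhs => rw [e]
  exact eNormSq_sum_le _ fun i => (R (Pi.single i 1)).2.1

end ModalSystem

/-! ### The turnpike estimate in modal coordinates. -/

namespace ModalSystem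

variable {ι : Type*} {S : ModalSystem ι}

theorem sq_add_sq_le_layers {p T t N₀ N₁ : ℝ} (ht : t ∈ Set.Icc 0 T) (h0 : 0 ≤ N₀) (h1 : 0 ≤ N₁) :
    (N₀ / (t + 1) ^ p) ^ 2 + (N₁ / (T - t + 1) ^ p) ^ 2 ≤ layers p T t N₀ N₁ ^ 2 := by
  have h2 : 0 ≤ t + 1 := by linarith [ht.1]
  have h3 : 0 ≤ T - t + 1 := by linarith [ht.2]
  have h4 : 0 ≤ N₀ / (t + 1) ^ p * (N₁ / (T - t + 1) ^ p) := by positivity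
  rw [layers]
  nlinarith

/-- The spectral coordinates of a solution decay in the weighted space. -/
theorem weighted_decay {ρ : ℝ} (hw : ∀ k, S.w k = S.β k ^ ρ) {K B : ℝ}
    (hK : ∀ b, 0 < b → b ≤ B → ∀ t, 0 ≤ t →
      b ^ (ρ - 1) * Real.exp (-(3 / 4 * b) * t) ≤ K / (t + 1) ^ (ρ - 1))
    (hB : ∀ k, S.β k ≤ B) {n : ι} {e N : ℝ} {t : ℝ} (ht : 0 ≤ t)
    (he : e ≤ Real.exp (-(3 / 4 * S.β n) * t) * N) (hN : 0 ≤ N) :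
    S.w n * e ≤ S.β n * (K * (N / (t + 1) ^ (ρ - 1))) := by
  have hβ := S.β_pos n
  -- One power of `β_n` is set aside for the division in `IsPair.norm_hat_le`; the other `ρ - 1`
  -- become the polynomial rate.
  have hβw : S.w n = S.β n * S.β n ^ (ρ - 1) := by
    conv_lhs => rw [hw, ← add_sub_cancel 1 ρ, Real.rpow_add hβ, Real.rpow_one]
  calc S.w n * e ≤ S.w n * (Real.exp (-(3 / 4 * S.β n) * t) * N) :=
        mul_le_mul_of_nonneg_left he (S.w_pos n).le
    _ = S.β n * ((S.β n ^ (ρ - 1) * Real.exp (-(3 / 4 * S.β n) * t)) * N) := by rw [hβw]; ring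
    _ ≤ S.β n * (K / (t + 1) ^ (ρ - 1) * N) := by
        gcongr
        exact hK _ hβ (hB n) t ht
    _ = _ := by ring

/-- The polynomial turnpike estimate in modal coordinates. -/
theorem exists_turnpike [Nonempty ι] {ρ : ℝ} (hρ : 1 < ρ) (hw : ∀ k, S.w k = S.β k ^ ρ) :
    ∃ C, 0 < C ∧ ∀ T x, S.IsSol T x → ∀ t ∈ Set.Icc 0 T,
      √(S.eNormSq (x t)) ≤ C * layers (ρ - 1) T t (xNorm (x 0)) (xNorm (x T)) := by
  have hp : 0 < ρ - 1 := sub_pos.2 hρ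
  obtain ⟨B, hB0, hB⟩ := S.β_bdd
  obtain ⟨K, hK0, hK⟩ := rpow_mul_exp_neg_le (p := ρ - 1) (c := 3 / 4) (B := B) hp (by norm_num)
  obtain ⟨Cy, hCy0, hy⟩ := exists_majorant (S := S)
  obtain ⟨Low, d, hpair, hfin, C₁, hC₁, hdec⟩ := exists_decomposition (S := S)
  have hspec := IsPair.isSpec hpair
  obtain ⟨m, φ, C₂, hC₂, hcoord⟩ := exists_coordinates hspec
  choose Kφ hKφ0 hKφ using fun i => (decays_of_mem_kerSpec hspec (φ i)).exists_layers hp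
  choose D hD0 hD using fun i => norm_bil_sq_le (kerSpec_le_G hspec (φ i).2)
  -- `M₁` bounds the squared norm of the part seen by the eigenfunctionals, `M₂` that of the kernel
  -- part, both relative to `q²`.
  set M₁ := C₁ * (2 * K ^ 2 * Cy) with hM₁
  set M₂ := C₂ * ∑ i, (2 * Kφ i ^ 2 + 2 * D i * M₁) with hM₂
  have hM₁0 : 0 ≤ M₁ := by positivity
  have hM₂0 : 0 ≤ M₂ := mul_nonneg hC₂ (Finset.sum_nonneg fun i _ => by
    have := hD0 i; positivity)
  refine ⟨√(2 * M₁ + 2 * M₂) + 1, by positivity, fun T x hx t ht => ?_⟩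
  have h0 : (0 : ℝ) ∈ Set.Icc 0 T := ⟨le_rfl, ht.1.trans ht.2⟩
  have hT : T ∈ Set.Icc 0 T := ⟨ht.1.trans ht.2, le_rfl⟩
  have ht' : 0 ≤ T - t := sub_nonneg.2 ht.2
  have n0 := xNorm_nonneg (x 0)
  have nT := xNorm_nonneg (x T)
  set q := layers (ρ - 1) T t (xNorm (x 0)) (xNorm (x T)) with hq
  have hq0 : 0 ≤ q := layers_nonneg ht n0 nT
  obtain ⟨y₀, hy₀s, hy₀n, hy₀, hy₀e⟩ := hy _ (hx.mem 0 h0)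
  obtain ⟨y₁, hy₁s, hy₁n, hy₁, hy₁e⟩ := hy _ (hx.mem T hT)
  set α := 1 / (t + 1) ^ (ρ - 1) with hα
  set α' := 1 / (T - t + 1) ^ (ρ - 1) with hα'
  have hα0 : 0 ≤ α := by have := ht.1; positivity
  have hα'0 : 0 ≤ α' := by positivity
  set X : ι → ℝ := fun n => K * α * y₀ n + K * α' * y₁ n with hX
  have hXs : SqSummable X := (hy₀s.const_mul _).add (hy₁s.const_mul _)
  have hXle : ∑' n, X n ^ 2 ≤ 2 * K ^ 2 * Cy * q ^ 2 := by
    have hs : Summable fun n => 2 * (K * α) ^ 2 * y₀ n ^ 2 + 2 * (K * α') ^ 2 * y₁ n ^ 2 :=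
      (Summable.mul_left _ hy₀s).add (Summable.mul_left _ hy₁s)
    have h1 : ∑' n, X n ^ 2 ≤ 2 * (K * α) ^ 2 * ∑' n, y₀ n ^ 2 + 2 * (K * α') ^ 2 * ∑' n, y₁ n ^ 2 := by
      rw [← tsum_mul_left, ← tsum_mul_left,
        ← Summable.tsum_add (Summable.mul_left _ hy₀s) (Summable.mul_left _ hy₁s)]
      refine Summable.tsum_le_tsum (fun n => ?_) hXs hs
      simp only [hX]
      nlinarith [sq_nonneg (K * α * y₀ n - K * α' * y₁ n)]
    refine h1.trans ?_
    have h2 := sq_add_sq_le_layers (p := ρ - 1) ht n0 nT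
    calc _ ≤ 2 * (K * α) ^ 2 * (Cy * xNorm (x 0) ^ 2) + 2 * (K * α') ^ 2 * (Cy * xNorm (x T) ^ 2) := by
          gcongr
      _ = 2 * K ^ 2 * Cy * ((xNorm (x 0) / (t + 1) ^ (ρ - 1)) ^ 2
            + (xNorm (x T) / (T - t + 1) ^ (ρ - 1)) ^ 2) := by rw [hα, hα']; ring
      _ ≤ _ := mul_le_mul_of_nonneg_left h2 (by positivity)
  have hθ := S.X₀_le_E (hx.mem t ht)
  obtain ⟨ζ, hζ, hζle⟩ := hdec (x t) hθ X hXs fun n hn => by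
    have hβ := S.β_pos n
    have hd := (hpair n hn).eigFun_decay hx ht
    have hb0 : 0 ≤ K * α * y₀ n := by have := hy₀n n; positivity
    have hb1 : 0 ≤ K * α' * y₁ n := by have := hy₁n n; positivity
    constructor
    · refine (weighted_decay hw hK hB ht' (hd.2.trans (mul_le_mul_of_nonneg_left
        (hy₁e n _ (hpair n hn).good (hpair n hn).root) (Real.exp_pos _).le)) (hy₁n n)).trans ?_
      refine mul_le_mul_of_nonneg_left ?_ hβ.le
      have e : K * (y₁ n / (T - t + 1) ^ (ρ - 1)) = K * α' * y₁ n := by rw [hα']; ring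
      rw [e]
      exact le_add_of_nonneg_left hb0
    · refine (weighted_decay hw hK hB ht.1 (hd.1.trans (mul_le_mul_of_nonneg_left
        (hy₀e n _ (hpair n hn).good (hpair n hn).root.neg_conj) (Real.exp_pos _).le))
        (hy₀n n)).trans ?_
      refine mul_le_mul_of_nonneg_left ?_ hβ.le
      have e : K * (y₀ n / (t + 1) ^ (ρ - 1)) = K * α * y₀ n := by rw [hα]; ring
      rw [e]
      exact le_add_of_nonneg_right hb1
  have hrest : S.eNormSq (x t - ζ) ≤ M₁ * q ^ 2 := by
    refine hζle.trans ((mul_le_mul_of_nonneg_left hXle hC₁).trans (le_of_eq ?_))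
    rw [hM₁]; ring
  have hζE : ζ ∈ S.E := hζ.1
  have hsubE : x t - ζ ∈ S.E := S.E.sub_mem hθ hζE
  -- The coordinate functionals decay on the solution, not on `ζ` itself. The difference `x t - ζ`
  -- is already controlled by `M₁`.
  have hζn : S.eNormSq ζ ≤ M₂ * q ^ 2 := by
    refine (hcoord ⟨ζ, hζ⟩).trans ?_
    rw [hM₂, mul_assoc, Finset.sum_mul]
    refine mul_le_mul_of_nonneg_left (Finset.sum_le_sum fun i _ => ?_) hC₂
    have e1 : bil (φ i).1 (x t) = bil (φ i).1 ζ + bil (φ i).1 (x t - ζ) := by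
      rw [← bil_add (kerSpec_le_G hspec (φ i).2) hζE hsubE, add_sub_cancel]
    have e2 : ‖bil (φ i).1 ζ‖ ≤ ‖bil (φ i).1 (x t)‖ + ‖bil (φ i).1 (x t - ζ)‖ := by
      rw [show bil (φ i).1 ζ = bil (φ i).1 (x t) - bil (φ i).1 (x t - ζ) by rw [e1]; ring]
      exact norm_sub_le _ _
    have e3 := pow_le_pow_left₀ (norm_nonneg _) (hKφ i T x hx t ht) 2
    have e4 := (hD i _ hsubE).trans (mul_le_mul_of_nonneg_left hrest (hD0 i))
    have e5 := pow_le_pow_left₀ (norm_nonneg _) e2 2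
    rw [← hq] at e3
    nlinarith [sq_nonneg (‖bil (φ i).1 (x t)‖ - ‖bil (φ i).1 (x t - ζ)‖)]
  have hfinal : S.eNormSq (x t) ≤ (2 * M₁ + 2 * M₂) * q ^ 2 := by
    have := eNormSq_add_le hsubE hζE
    rw [sub_add_cancel] at this
    linarith
  calc √(S.eNormSq (x t)) ≤ √((2 * M₁ + 2 * M₂) * q ^ 2) := Real.sqrt_le_sqrt hfinal
    _ = √(2 * M₁ + 2 * M₂) * q := by
        rw [Real.sqrt_mul (by positivity), Real.sqrt_sq hq0]
    _ ≤ _ := by rw [add_mul, one_mul]; exact le_add_of_nonneg_right hq0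

end ModalSystem

/-! ### From the variational system to the modal system. -/

/-- The sign of a branch of the spectrum. -/
def sgn (e : Bool) : ℝ := if e then 1 else -1

theorem sgn_sq (e : Bool) : sgn e * sgn e = 1 := by cases e <;> simp [sgn]

/-- One constant separates the frequencies within a branch, by the gap, and across the branches
`±ω`, by positivity of the lowest frequency. -/
theorem A2.pos_and_gap {ω : ℕ → ℝ} (h : A2 ω) :
    ∃ g, 0 < g ∧ (∀ k, g ≤ 2 * ω k) ∧ ∀ j k, j ≠ k → g ≤ |ω j - ω k| := by
  obtain ⟨h0, g, hg, hstep⟩ := h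
  have hmono : StrictMono ω := strictMono_nat_of_lt_succ fun k => by linarith [hstep k]
  have hlt : ∀ j k, j < k → g ≤ ω k - ω j := fun j k hjk => by
    have := hmono.monotone (Nat.succ_le_of_lt hjk)
    have h1 := hstep j
    rw [Nat.succ_eq_add_one] at this
    linarith
  refine ⟨min g (2 * ω 0), by positivity, fun k => ?_, fun j k hjk => ?_⟩
  · have := hmono.monotone (Nat.zero_le k)
    exact (min_le_right _ _).trans (by linarith)
  · refine (min_le_left _ _).trans ?_
    rcases lt_or_gt_of_ne hjk with h | h
    · rw [abs_sub_comm]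
      exact (hlt j k h).trans (le_abs_self _)
    · exact (hlt k j h).trans (le_abs_self _)

theorem summable_and_tsum_prod_bool {f : ℕ × Bool → ℝ} {g : ℕ → ℝ} (hf : ∀ p, 0 ≤ f p)
    (h : ∀ k, f (k, true) + f (k, false) = g k) (hg : Summable g) :
    Summable f ∧ ∑' p, f p = ∑' k, g k := by
  have hin : ∀ k, ∑' e, f (k, e) = g k := fun k => by
    rw [tsum_fintype, Fintype.sum_bool, h]
  have hs : Summable f := (summable_prod_of_nonneg hf).2
    ⟨fun k => Summable.of_finite, by simpa only [hin] using hg⟩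
  exact ⟨hs, by rw [hs.tsum_prod]; exact tsum_congr hin⟩

theorem summable_prod_bool_of_summable {H : ℕ × ℕ → ℝ} (h0 : ∀ p, 0 ≤ H p) (hH : Summable H) :
    Summable fun p : (ℕ × Bool) × ℕ × Bool => H (p.1.1, p.2.1) := by
  have h1 : Summable fun p : (ℕ × ℕ) × Bool × Bool => H p.1 := by
    have := hH.mul_of_nonneg (g := fun _ : Bool × Bool => (1 : ℝ)) Summable.of_finite h0
      fun _ => zero_le_one
    simpa using this
  exact h1.comp_injective (Equiv.prodProdProdComm ℕ Bool ℕ Bool).injective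

/-- For nonnegative terms the iterated series is a double series. The indices are swapped so that
the first is the numerator mode, as in `ModalSystem.hs`. -/
theorem A5.summable {ω b : ℕ → ℝ} {ρ : ℝ} (h : A5 ω b ρ) :
    Summable fun p : ℕ × ℕ => if p.1 = p.2 then 0 else
      |b p.1| ^ (2 * (1 + ρ)) / (|b p.2| ^ (2 * ρ) * (ω p.1 - ω p.2) ^ 2) := by
  let G : ℕ → ℕ → ℝ := fun k j => |b j| ^ (2 * (1 + ρ)) / (ω j - ω k) ^ 2
  have hG : ∀ k, Summable (({j | j ≠ k} : Set ℕ).indicator (G k)) := fun k =>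
    summable_subtype_iff_indicator.1 (h.1 k)
  have hG' : ∀ k, ∑' j : {j : ℕ // j ≠ k}, |b j| ^ (2 * (1 + ρ)) / (ω j - ω k) ^ 2
      = ∑' j, ({j | j ≠ k} : Set ℕ).indicator (G k) j := fun k => tsum_subtype {j | j ≠ k} (G k)
  let F : ℕ × ℕ → ℝ := fun p => 1 / |b p.1| ^ (2 * ρ) *
    ({j | j ≠ p.1} : Set ℕ).indicator (G p.1) p.2
  have h0 : ∀ p, 0 ≤ F p := fun p => by
    refine mul_nonneg (by positivity) (Set.indicator_nonneg (fun _ _ => by positivity) _)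
  have hs : Summable F := by
    refine (summable_prod_of_nonneg h0).2 ⟨fun k => ?_, ?_⟩
    · exact (hG k).mul_left (1 / |b k| ^ (2 * ρ))
    · refine h.2.congr fun k => ?_
      rw [hG', ← tsum_mul_left]
  refine (hs.comp_injective (Equiv.prodComm ℕ ℕ).injective).congr fun p => ?_
  simp only [F, Function.comp, Equiv.prodComm_apply, Prod.fst_swap, Prod.snd_swap]
  by_cases hp : p.1 = p.2
  · simp [hp]
  · rw [if_neg hp, Set.indicator_of_mem (show p.1 ∈ ({j | j ≠ p.2} : Set ℕ) from hp),
      div_mul_div_comm, one_mul]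

theorem summable_diagonal {u : ℕ → ℝ} (h0 : ∀ k, 0 ≤ u k) (hu : Summable u) :
    Summable fun p : ℕ × ℕ => if p.1 = p.2 then u p.1 else 0 := by
  refine (summable_prod_of_nonneg fun p => ?_).2 ⟨fun k => ?_, ?_⟩
  · simp only []
    split_ifs
    exacts [h0 _, le_rfl]
  · refine summable_of_ne_finset_zero (s := {k}) fun j hj => if_neg fun h => hj ?_
    simp only at h
    simp [h]
  · simpa using hu

theorem sqSummable_of_memℓp {b : ℕ → ℝ} (h : Memℓp b 2) : SqSummable b := by
  have := h.summable (by norm_num)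
  simpa [SqSummable] using this

theorem sqSummable_abs_div_sqrt_two {b : ℕ → ℝ} (hb : SqSummable b) :
    SqSummable fun p : ℕ × Bool => |b p.1| / √2 := by
  refine (summable_and_tsum_prod_bool (fun _ => sq_nonneg _) (fun k => ?_) hb).1
  rw [div_pow, Real.sq_sqrt zero_le_two, sq_abs]
  ring

section Coupling

variable {ω b : ℕ → ℝ} {ρ : ℝ}

theorem coupling_entry_sq {j k : ℕ} (hj : b j ≠ 0) (hk : b k ≠ 0) (x : ℝ) :
    (|b j| / √2 * (|b j| / √2) ^ ρ / ((|b k| / √2) ^ ρ * x)) ^ 2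
      = 1 / 2 * (|b j| ^ (2 * (1 + ρ)) / (|b k| ^ (2 * ρ) * x ^ 2)) := by
  have hj' := abs_pos.2 hj
  have hk' := abs_pos.2 hk
  have e1 : |b j| ^ (2 * (1 + ρ)) = (|b j| * |b j| ^ ρ) ^ 2 := by
    rw [mul_comm, Real.rpow_mul hj'.le, Real.rpow_add hj', Real.rpow_one, Real.rpow_two]
  have e2 : |b k| ^ (2 * ρ) = (|b k| ^ ρ) ^ 2 := by
    rw [mul_comm, Real.rpow_mul hk'.le, Real.rpow_two]
  have h2 : (√2 : ℝ) ^ 2 = 2 := Real.sq_sqrt zero_le_two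
  have h3 : (0 : ℝ) < √2 ^ ρ := by positivity
  have h4 : 0 < |b k| ^ ρ := by positivity
  rw [e1, e2, Real.div_rpow hj'.le (Real.sqrt_nonneg _), Real.div_rpow hk'.le (Real.sqrt_nonneg _)]
  have e3 : |b j| / √2 * (|b j| ^ ρ / √2 ^ ρ) / (|b k| ^ ρ / √2 ^ ρ * x)
      = (|b j| * |b j| ^ ρ) / (|b k| ^ ρ * x) / √2 := by
    field_simp
  rw [e3, div_pow, div_pow, h2, mul_pow (|b k| ^ ρ)]
  ring

/-- Between distinct modes, `|±ω_j ± ω_k| ≥ |ω_j - ω_k|` reduces every sign choice to (A5). Between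
the two branches of one mode the weights cancel and the frequencies differ by `2ω_j ≥ g`, leaving a
multiple of `b_j²/g²`. -/
theorem sqSummable_coupling (hb : SqSummable b) (hb0 : ∀ k, b k ≠ 0) (h5 : A5 ω b ρ) {g : ℝ}
    (hg : 0 < g) (hω : ∀ k, g ≤ 2 * ω k)
    (hgap : ∀ j k, j ≠ k → g ≤ |ω j - ω k|) :
    SqSummable fun p : (ℕ × Bool) × ℕ × Bool =>
      |b p.1.1| / √2 * (|b p.1.1| / √2) ^ ρ
        / ((|b p.2.1| / √2) ^ ρ * (sgn p.1.2 * ω p.1.1 - sgn p.2.2 * ω p.2.1)) := by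
  have hH := h5.summable.add (summable_diagonal (u := fun k => |b k| ^ 2 / g ^ 2)
    (fun k => by positivity) (by
      simpa only [sq_abs] using Summable.div_const (show Summable fun k => b k ^ 2 from hb) (g ^ 2)))
  have hpos : ∀ k, 0 < ω k := fun k => by linarith [hω k]
  refine Summable.of_nonneg_of_le (fun _ => sq_nonneg _) ?_
    (summable_prod_bool_of_summable (fun p => ?_) hH)
  · rintro ⟨⟨j, e⟩, k, e'⟩
    simp only []
    rw [coupling_entry_sq (hb0 j) (hb0 k)]
    have hj' := abs_pos.2 (hb0 j)
    have hk' := abs_pos.2 (hb0 k)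
    by_cases hjk : j = k
    · subst hjk
      rw [if_pos rfl, if_pos rfl, zero_add, mul_add, mul_one, Real.rpow_add hj', Real.rpow_two,
        mul_comm (|b j| ^ 2) (|b j| ^ (2 * ρ)),
        mul_div_mul_left _ _ (Real.rpow_pos_of_pos hj' _).ne']
      have h1 : |b j| ^ 2 / (sgn e * ω j - sgn e' * ω j) ^ 2 ≤ |b j| ^ 2 / g ^ 2 := by
        have h2 := hω j
        cases e <;> cases e' <;> simp only [sgn] <;> norm_num
        · positivity
        · gcongr ?_ / ?_
          · exact le_rfl
          · nlinarith
        · gcongr ?_ / ?_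
          · exact le_rfl
          · nlinarith
        · positivity
      have h3 : 0 ≤ |b j| ^ 2 / (sgn e * ω j - sgn e' * ω j) ^ 2 := by positivity
      linarith
    · rw [if_neg hjk, if_neg hjk, add_zero]
      have hd : 0 < (ω j - ω k) ^ 2 := by
        rw [← sq_abs]
        exact pow_pos (hg.trans_le (hgap j k hjk)) 2
      have h1 : (ω j - ω k) ^ 2 ≤ (sgn e * ω j - sgn e' * ω k) ^ 2 := by
        have := mul_pos (hpos j) (hpos k)
        cases e <;> cases e' <;> simp only [sgn] <;> norm_num <;> nlinarith
      have h2 : |b j| ^ (2 * (1 + ρ)) / (|b k| ^ (2 * ρ) * (sgn e * ω j - sgn e' * ω k) ^ 2)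
          ≤ |b j| ^ (2 * (1 + ρ)) / (|b k| ^ (2 * ρ) * (ω j - ω k) ^ 2) := by
        gcongr
      have h3 : 0 ≤ |b j| ^ (2 * (1 + ρ))
        / (|b k| ^ (2 * ρ) * (sgn e * ω j - sgn e' * ω k) ^ 2) := by positivity
      linarith
  · split_ifs <;> positivity

end Coupling

/-- The modal form of the variational system. -/
def modalSystem (ω b : ℕ → ℝ) (ρ g : ℝ) (hρ : 0 ≤ ρ) (hb : SqSummable b) (hb0 : ∀ k, b k ≠ 0)
    (h5 : A5 ω b ρ) (hg : 0 < g) (hω : ∀ k, g ≤ 2 * ω k) (hgap : ∀ j k, j ≠ k → g ≤ |ω j - ω k|) :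
    ModalSystem (ℕ × Bool) where
  ν p := sgn p.2 * ω p.1
  β p := |b p.1| / √2
  w p := (|b p.1| / √2) ^ ρ
  gap := g
  β_pos p := div_pos (abs_pos.2 (hb0 p.1)) (by positivity)
  w_pos p := Real.rpow_pos_of_pos (div_pos (abs_pos.2 (hb0 p.1)) (by positivity)) _
  gap_pos := hg
  β_sq := sqSummable_abs_div_sqrt_two hb
  w_bdd := by
    obtain ⟨C, hC, h⟩ := hb.bdd
    refine ⟨(C / √2) ^ ρ, by positivity, fun p => ?_⟩
    exact Real.rpow_le_rpow (by positivity) (by have := h p.1; gcongr) hρ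
  gap_le := by
    rintro ⟨j, e⟩ ⟨k, e'⟩ hne
    have hj := hω j
    have hk := hω k
    have hne' : e = e' → j ≠ k := fun h1 h2 => hne (by rw [h1, h2])
    cases e <;> cases e' <;> simp only [sgn] <;> norm_num
    · rw [neg_add_eq_sub, abs_sub_comm]; exact hgap j k (hne' rfl)
    · exact le_trans (by linarith) (neg_le_abs _)
    · exact le_trans (by linarith) (le_abs_self _)
    · exact hgap j k (hne' rfl)
  hs := sqSummable_coupling hb hb0 h5 hg hω hgap

open ModalSystem

/-- The complex modal coordinates of a state. -/
def modal (b : ℕ → ℝ) (θ : X) : (ℕ × Bool → ℂ) × (ℕ × Bool → ℂ) :=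
  (fun p => ((b p.1 / |b p.1| : ℝ) : ℂ) * (sgn p.2 * θ 0 p.1 + Complex.I * θ 1 p.1),
   fun p => ((b p.1 / |b p.1| : ℝ) : ℂ) * (sgn p.2 * θ 2 p.1 + Complex.I * θ 3 p.1))

theorem summable_coordinates (θ : X) : Summable fun k => ∑ i : Fin 4, ‖θ i k‖ ^ 2 :=
  summable_sum fun i _ => lp_two_summable (θ i)

theorem norm_sq_eq_tsum (θ : X) : ‖θ‖ ^ 2 = ∑' k, ∑ i : Fin 4, ‖θ i k‖ ^ 2 := by
  rw [PiLp.norm_sq_eq_of_L2, Summable.tsum_finsetSum fun i _ => lp_two_summable (θ i)]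
  exact Finset.sum_congr rfl fun i _ => lp_two_norm_sq (θ i)

/-- The parallelogram law; it makes the passage to modal coordinates an isometry up to the factor
`√2`. -/
theorem norm_branches_sq {σ : ℝ} (hσ : σ ^ 2 = 1) (x y : ℂ) :
    ‖(σ : ℂ) * (sgn true * x + Complex.I * y)‖ ^ 2 + ‖(σ : ℂ) * (sgn false * x + Complex.I * y)‖ ^ 2
      = 2 * (‖x‖ ^ 2 + ‖y‖ ^ 2) := by
  have h := parallelogram_law_with_norm ℝ (Complex.I * y) x
  have e1 : (sgn true : ℂ) * x + Complex.I * y = Complex.I * y + x := by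
    simp [sgn, add_comm]
  have e2 : (sgn false : ℂ) * x + Complex.I * y = Complex.I * y - x := by
    simp [sgn]; ring
  rw [e1, e2, norm_mul, norm_mul, mul_pow, mul_pow, Complex.norm_real, Real.norm_eq_abs, sq_abs,
    hσ, one_mul, one_mul]
  rw [norm_mul, Complex.norm_I, one_mul] at h
  nlinarith

theorem sign_sq {x : ℝ} (hx : x ≠ 0) : (x / |x|) ^ 2 = 1 := by
  rw [div_pow, sq_abs, div_self (pow_ne_zero 2 hx)]

theorem sign_mul_self {x : ℝ} (hx : x ≠ 0) :
    ((x / |x| : ℝ) : ℂ) * x = ((|x| / √2 : ℝ) : ℂ) * (√2 : ℝ) := by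
  rw [← Complex.ofReal_mul, ← Complex.ofReal_mul, div_mul_cancel₀ _ (by positivity),
    div_mul_eq_mul_div, ← abs_mul_abs_self, mul_div_cancel_right₀ _ (abs_ne_zero.2 hx)]

theorem modal_branches {b : ℕ → ℝ} (hb0 : ∀ k, b k ≠ 0) (θ : X) (k : ℕ) :
    (‖(modal b θ).1 (k, true)‖ ^ 2 + ‖(modal b θ).2 (k, true)‖ ^ 2)
      + (‖(modal b θ).1 (k, false)‖ ^ 2 + ‖(modal b θ).2 (k, false)‖ ^ 2)
      = 2 * ∑ i : Fin 4, ‖θ i k‖ ^ 2 := by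
  have h1 := norm_branches_sq (sign_sq (hb0 k)) (θ 0 k) (θ 1 k)
  have h2 := norm_branches_sq (sign_sq (hb0 k)) (θ 2 k) (θ 3 k)
  simp only [modal, Fin.sum_univ_four]
  linarith

theorem modal_sums {b : ℕ → ℝ} (hb0 : ∀ k, b k ≠ 0) (θ : X) :
    (Summable fun p => ‖(modal b θ).1 p‖ ^ 2 + ‖(modal b θ).2 p‖ ^ 2) ∧
      xNormSq (modal b θ) = 2 * ‖θ‖ ^ 2 := by
  have h := summable_and_tsum_prod_bool
    (f := fun p => ‖(modal b θ).1 p‖ ^ 2 + ‖(modal b θ).2 p‖ ^ 2) (fun _ => by positivity)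
    (modal_branches hb0 θ) ((summable_coordinates θ).mul_left 2)
  refine ⟨h.1, ?_⟩
  rw [xNormSq, h.2, norm_sq_eq_tsum, tsum_mul_left]

theorem modal_mem_X₀ {b : ℕ → ℝ} (hb0 : ∀ k, b k ≠ 0) (θ : X) :
    modal b θ ∈ X₀ (ℕ × Bool) := by
  have h := (modal_sums hb0 θ).1
  constructor <;>
  · refine Summable.of_nonneg_of_le (fun _ => sq_nonneg _) (fun p => ?_) h
    simp only [one_mul]
    nlinarith [sq_nonneg ‖(modal b θ).1 p‖, sq_nonneg ‖(modal b θ).2 p‖]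

theorem xNorm_modal {b : ℕ → ℝ} (hb0 : ∀ k, b k ≠ 0) (θ : X) : xNorm (modal b θ) = 2 * ‖θ‖ := by
  rw [xNorm, (modal_sums hb0 θ).2, show 2 * (2 * ‖θ‖ ^ 2) = (2 * ‖θ‖) ^ 2 by ring,
    Real.sqrt_sq (by positivity)]

/-- Across the two branches `δλ` cancels and `iδμ` doubles. The factor `√2` left here cancels the
`1/√2` in the coefficient `β` multiplying the control. -/
theorem tsum_modal_control {b : ℕ → ℝ} (hb : SqSummable b) (hb0 : ∀ k, b k ≠ 0) (θ : X) :
    ∑' p : ℕ × Bool, (((|b p.1| / √2 : ℝ)) : ℂ) * (modal b θ).2 p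
      = √2 * Complex.I * ∑' j, (b j : ℂ) * θ 3 j := by
  have hs : Summable fun p : ℕ × Bool => (((|b p.1| / √2 : ℝ)) : ℂ) * (modal b θ).2 p := by
    refine Summable.of_norm_bounded ((sqSummable_abs_div_sqrt_two hb).mul
      (modal_mem_X₀ hb0 θ).2) fun p => ?_
    rw [norm_mul, Complex.norm_real, Real.norm_of_nonneg (by positivity), one_mul]
  rw [hs.tsum_prod, ← tsum_mul_left]
  refine tsum_congr fun j => ?_
  rw [tsum_fintype, Fintype.sum_bool]
  have h1 : |b j| / √2 * (b j / |b j|) * 2 = √2 * b j := by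
    have h2 : |b j| ≠ 0 := abs_ne_zero.2 (hb0 j)
    have h3 : (√2 : ℝ) ^ 2 = 2 := Real.sq_sqrt zero_le_two
    field_simp
    linear_combination -b j * h3
  have h2 := congrArg (fun x : ℝ => (x : ℂ)) h1
  simp only [Complex.ofReal_mul, Complex.ofReal_ofNat] at h2
  have e1 : (sgn true : ℂ) = 1 := by simp [sgn]
  have e2 : (sgn false : ℂ) = -1 := by simp [sgn]
  simp only [modal]
  rw [e1, e2]
  linear_combination (Complex.I * θ 3 j) * h2

theorem isSol_modal {ω b : ℕ → ℝ} {ρ g : ℝ} (hρ : 0 ≤ ρ) (hb : SqSummable b)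
    (hb0 : ∀ k, b k ≠ 0) (h5 : A5 ω b ρ) (hg : 0 < g) (hω : ∀ k, g ≤ 2 * ω k)
    (hgap : ∀ j k, j ≠ k → g ≤ |ω j - ω k|) {T : ℝ} {Δ : ℝ → X} (h : IsSolution ω b T Δ) :
    (modalSystem ω b ρ g hρ hb hb0 h5 hg hω hgap).IsSol T fun t => modal b (Δ t) := by
  have hc : ∀ i k, ContinuousOn (fun t => Δ t i k) (Set.Icc 0 T) := fun i k t ht =>
    (h.2 t ht i k).continuousWithinAt
  have hd : ∀ t ∈ Set.Ioo 0 T, ∀ i k,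
      HasDerivAt (fun s => Δ s i k) (hamiltonianAction ω b (Δ t) i k) t := fun t ht i k =>
    (h.2 t (Set.Ioo_subset_Icc_self ht) i k).hasDerivAt (Icc_mem_nhds ht.1 ht.2)
  have hs : ∀ e, (sgn e : ℂ) * sgn e = 1 := fun e => by
    rw [← Complex.ofReal_mul, sgn_sq, Complex.ofReal_one]
  refine ⟨fun p => ?_, fun p => ?_, fun t ht p => ?_, fun t ht p => ?_, fun t _ =>
    modal_mem_X₀ hb0 _, ?_⟩
  · exact continuousOn_const.mul ((continuousOn_const.mul (hc 0 p.1)).add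
      (continuousOn_const.mul (hc 1 p.1)))
  · exact continuousOn_const.mul ((continuousOn_const.mul (hc 2 p.1)).add
      (continuousOn_const.mul (hc 3 p.1)))
  · refine ((((hd t ht 0 p.1).const_mul _).add ((hd t ht 1 p.1).const_mul _)).const_mul
      _).congr_deriv ?_
    simp only [modalSystem]
    rw [tsum_modal_control hb hb0]
    simp only [modal, hamiltonianAction, Matrix.cons_val_zero, Matrix.cons_val_one]
    rw [Complex.ofReal_mul]
    linear_combination
      (sgn p.2 * ω p.1 * ((b p.1 / |b p.1| : ℝ) : ℂ) * Δ t 1 p.1) * Complex.I_sq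
      + (Complex.I * ((b p.1 / |b p.1| : ℝ) : ℂ) * ω p.1 * Δ t 0 p.1) * hs p.2
      + (Complex.I * ∑' j, (b j : ℂ) * Δ t 3 j) * sign_mul_self (hb0 p.1)
  · refine ((((hd t ht 2 p.1).const_mul _).add ((hd t ht 3 p.1).const_mul _)).const_mul
      _).congr_deriv ?_
    simp only [modalSystem, modal, hamiltonianAction, Matrix.cons_val]
    rw [Complex.ofReal_mul]
    linear_combination
      (sgn p.2 * ω p.1 * ((b p.1 / |b p.1| : ℝ) : ℂ) * Δ t 3 p.1) * Complex.I_sq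
      + (Complex.I * ((b p.1 / |b p.1| : ℝ) : ℂ) * ω p.1 * Δ t 2 p.1) * hs p.2
  · obtain ⟨M, hM⟩ := isCompact_Icc.exists_bound_of_continuousOn h.1
    refine ⟨2 * M ^ 2, fun t ht => ?_⟩
    rw [(modal_sums hb0 _).2]
    have := pow_le_pow_left₀ (norm_nonneg _) (hM t ht) 2
    linarith

/-- The weight `|b|^(2ρ)` is bounded, so membership is automatic. The factor `2^ρ/2` comes from `β =
|b|/√2` and from the doubling by the two branches. -/
theorem weighted_norm {ω b : ℕ → ℝ} {ρ g : ℝ} (hρ : 0 ≤ ρ) (hb : SqSummable b)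
    (hb0 : ∀ k, b k ≠ 0) (h5 : A5 ω b ρ) (hg : 0 < g) (hω : ∀ k, g ≤ 2 * ω k)
    (hgap : ∀ j k, j ≠ k → g ≤ |ω j - ω k|) (θ : X) :
    MemV b (-ρ) θ ∧ normV b (-ρ) θ = √(2 ^ ρ / 2)
      * √((modalSystem ω b ρ g hρ hb hb0 h5 hg hω hgap).eNormSq (modal b θ)) := by
  have e : ∀ k, weightedTerm b (-ρ) θ k = 2 ^ ρ * (((|b k| / √2) ^ ρ) ^ 2 * ∑ i : Fin 4, ‖θ i k‖ ^ 2) := by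
    intro k
    have hk := abs_pos.2 (hb0 k)
    have h2 : (√2 ^ ρ) ^ 2 = (2 : ℝ) ^ ρ := by
      rw [← Real.rpow_mul_natCast (Real.sqrt_nonneg _), mul_comm, Real.rpow_mul (Real.sqrt_nonneg _),
        Real.rpow_natCast, Real.sq_sqrt zero_le_two]
    have h3 : (|b k| ^ ρ) ^ 2 = |b k| ^ (2 * ρ) := by
      rw [← Real.rpow_mul_natCast hk.le, mul_comm]; norm_num
    have h4 : (0 : ℝ) < 2 ^ ρ := by positivity
    rw [weightedTerm, Real.div_rpow hk.le (Real.sqrt_nonneg _), div_pow, h2, h3, mul_neg,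
      Real.rpow_neg hk.le]
    field_simp
  have hmem : MemV b (-ρ) θ := by
    obtain ⟨C, hC, h⟩ := hb.bdd
    refine Summable.of_nonneg_of_le (fun k => ?_) (fun k => ?_)
      ((summable_coordinates θ).mul_left (2 ^ ρ * ((C / √2) ^ ρ) ^ 2))
    · rw [e]; positivity
    · rw [e, mul_assoc]
      gcongr
      exact h k
  refine ⟨hmem, ?_⟩
  have hs : Summable fun k => ((|b k| / √2) ^ ρ) ^ 2 * ∑ i : Fin 4, ‖θ i k‖ ^ 2 := by
    refine ((Summable.mul_left (2 ^ ρ)⁻¹ hmem)).congr fun k => ?_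
    rw [e, inv_mul_cancel_left₀ (by positivity)]
  have h1 := (summable_and_tsum_prod_bool
    (f := fun p : ℕ × Bool => ((|b p.1| / √2) ^ ρ * ‖(modal b θ).1 p‖) ^ 2
      + ((|b p.1| / √2) ^ ρ * ‖(modal b θ).2 p‖) ^ 2) (fun _ => by positivity)
    (g := fun k => 2 * (((|b k| / √2) ^ ρ) ^ 2 * ∑ i : Fin 4, ‖θ i k‖ ^ 2)) (fun k => by
      have := modal_branches hb0 θ k
      simp only [mul_pow, ← mul_add]
      rw [this]; ring) (hs.mul_left 2)).2
  have h2 : (modalSystem ω b ρ g hρ hb hb0 h5 hg hω hgap).eNormSq (modal b θ)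
      = 2 * ∑' k, ((|b k| / √2) ^ ρ) ^ 2 * ∑ i : Fin 4, ‖θ i k‖ ^ 2 := by
    rw [← tsum_mul_left]; exact h1
  rw [normV, ← Real.sqrt_mul (by positivity), h2]
  simp only [e]
  rw [tsum_mul_left]
  congr 1
  ring

end Turnpike

end

theorem mainTheorem2 (ω b : ℕ → ℝ) (ρ : ℝ) (hρ : 1 < ρ)
    (h1 : Turnpike.A1 b) (h2 : Turnpike.A2 ω) (h3 : Turnpike.A3 ω)
    (h5 : Turnpike.A5 ω b ρ) :
    ∃ C : ℝ, 0 < C ∧ ∀ T : ℝ, 0 < T → ∀ Δ : ℝ → Turnpike.X,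
      Turnpike.IsSolution ω b T Δ → ∀ t ∈ Set.Icc (0 : ℝ) T,
        Turnpike.MemV b (-ρ) (Δ t) ∧
        Turnpike.normV b (-ρ) (Δ t) ≤
          C * (‖Δ 0‖ / (t + 1) ^ (ρ - 1) + ‖Δ T‖ / (T - t + 1) ^ (ρ - 1)) := by
  have hρ0 : 0 ≤ ρ := by linarith
  have hb := Turnpike.sqSummable_of_memℓp h1.1
  obtain ⟨g, hg, hω, hgap⟩ := h2.pos_and_gap
  obtain ⟨C, hC, hmain⟩ := Turnpike.ModalSystem.exists_turnpike
    (S := Turnpike.modalSystem ω b ρ g hρ0 hb h1.2 h5 hg hω hgap) hρ fun _ => rfl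
  -- The square root converts the weighted norm and the final `2` comes from `xNorm_modal`.
  refine ⟨√(2 ^ ρ / 2) * C * 2, by positivity, fun T _ Δ hΔ t ht => ?_⟩
  obtain ⟨hmem, hnorm⟩ := Turnpike.weighted_norm hρ0 hb h1.2 h5 hg hω hgap (Δ t)
  refine ⟨hmem, ?_⟩
  have h := hmain T _ (Turnpike.isSol_modal hρ0 hb h1.2 h5 hg hω hgap hΔ) t ht
  simp only [Turnpike.xNorm_modal h1.2, Turnpike.layers] at h
  rw [hnorm]
  refine (mul_le_mul_of_nonneg_left h (Real.sqrt_nonneg _)).trans (le_of_eq ?_)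
  ring
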